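/- Fix an integer $k\ge 1$. For a vector $\mathbf n=(n_1,\dots,n_k)$ of positive integers with $n=n_1+\dots+n_k$, and $p,q\in[0,1]$, let $\mathcal G(\mathbf n,p,q)$ be the random graph on the disjoint union of blocks $V_1,\dots,V_k$ with $|V_i|=n_i$ in which the pairs of distinct vertices are edges independently of each other, with probability $p$ if both vertices lie in the same block and with probability $q$ otherwise. Consider a sequence of such models, that is, a sequence of triples $(\mathbf n,p,q)$ with $k$ fixed and $n\to\infty$; all asymptotics are along this sequence. Assume: (A2) $qn^2\to\infty$; (A3) $\max_{1\le i\le k}n_i\le n/2$ if $p=O(1/n)$, in the sense that for every constant $C$, all but finitely many members of the sequence with $p\le C/n$ satisfy $\max_{1\le i\le k} n_i\le n/2$; (A4) $\min_{1\le i\le k} n_i=\Omega(n)$, i.e. there is a constant $c>0$ such that $\min_{1\le i\le k} n_i\ge cn$ for all but finitely many members of the sequence. Then $$\lim \mathbb P\bigl(\mathcal G(\mathbf n,p,q)\text{ is Hamiltonian}\bigr)=\begin{cases}0 & \text{if } \min_{1\le i\le k}\{pn_i+(n-n_i)q-\log n_i\}<\log\log n-\omega(1),\\ 1 & \text{if }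 \min_{1\le i\le k}\{pn_i+(n-n_i)q-\log n_i\}>\log\log n+\omega(1),\end{cases}$$ where $\omega(1)$ stands for an arbitrary sequence of real numbers that tends to $+\infty$, and the inequality is required for all but finitely many members of the sequence. -/

import Mathlib

open Filter Topology MeasureTheory unitInterval

noncomputable section

namespace BlockModel

variable {k : ℕ}

/-- The vertex set `V = ⋃ i, V_i`, where the block `V_i` consists of the pairs `(i, j)` with `j`
in a set of `n i` elements. -/
abbrev Vertex (n : Fin k → ℕ) : Type := Σ i : Fin k, Fin (n i)

/-- The order `n_1 + ... + n_k` of the graph. -/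
def order (n : Fin k → ℕ) : ℕ := ∑ i, n i

/-- The unordered pairs of distinct vertices, that is, the potential edges. -/
abbrev Pair (n : Fin k → ℕ) : Type := {e : Sym2 (Vertex n) // ¬ e.IsDiag}

/-- The probability with which a pair of vertices is an edge: `p` for two vertices of the same
block, `q` for vertices of different blocks. -/
def edgeProb (n : Fin k → ℕ) (p q : I) (e : Sym2 (Vertex n)) : I :=
  Sym2.lift ⟨fun u v => if u.1 = v.1 then p else q, fun u v => by simp only [eq_comm]⟩ e

/-- The law of the indicators of the potential edges: they are mutually independent and the
indicator of `e` is Bernoulli with success probability `edgeProb n p q e`. -/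
def edgeLaw (n : Fin k → ℕ) (p q : I) : Measure (Pair n → Bool) :=
  Measure.pi fun e =>
    ENNReal.ofReal (edgeProb n p q e) • Measure.dirac true +
      ENNReal.ofReal (1 - (edgeProb n p q e : ℝ)) • Measure.dirac false

/-- The graph whose edges are the pairs `e` with `x e = true`. -/
def graphOf (n : Fin k → ℕ) (x : Pair n → Bool) : SimpleGraph (Vertex n) :=
  SimpleGraph.fromEdgeSet {e | ∃ h : ¬ e.IsDiag, x ⟨e, h⟩ = true}

/-- The stochastic block model with block sizes `n` and edge probabilities `p` inside the blocks
and `q` between different blocks, as a probability measure on graphs. -/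
def stochasticBlockModel (n : Fin k → ℕ) (p q : I) : Measure (SimpleGraph (Vertex n)) :=
  (edgeLaw n p q).map (graphOf n)

/-- The probability that the stochastic block model is Hamiltonian. -/
def hamProb (n : Fin k → ℕ) (p q : I) : ℝ :=
  (stochasticBlockModel n p q).real {G | G.IsHamiltonian}

/-- The quantity `min_i {p n_i + (n - n_i) q - log n_i}`, where `n` is the order (an infimum over
a finite index set, so a minimum when `1 ≤ k`). -/
def minExcess (n : Fin k → ℕ) (p q : I) : ℝ :=
  ⨅ i : Fin k, ((p : ℝ) * n i + ((order n : ℝ) - n i) * q - Real.log (n i))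

/-- Condition (A2): `q n² = ω(1)`. -/
def CondA2 (n : ℕ → Fin k → ℕ) (q : ℕ → I) : Prop :=
  Tendsto (fun t => (q t : ℝ) * (order (n t) : ℝ) ^ 2) atTop atTop

/-- Condition (A3): `max_i n_i ≤ n / 2` if `p = O(1 / n)`. The condition is imposed along every
subsequence on which `p = O(1 / n)`: for each constant `C`, with finitely many exceptions, the
block sizes are at most `n / 2` at all those indices at which `p ≤ C / n`. -/
def CondA3 (n : ℕ → Fin k → ℕ) (p : ℕ → I) : Prop :=
  ∀ C : ℝ, ∀ᶠ t in atTop, (p t : ℝ) ≤ C / (order (n t) : ℝ) →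
    ∀ i, (n t i : ℝ) ≤ (order (n t) : ℝ) / 2

/-- Condition (A4): `min_i n_i = Ω(n)`. -/
def CondA4 (n : ℕ → Fin k → ℕ) : Prop :=
  ∃ c : ℝ, 0 < c ∧ ∀ᶠ t in atTop, ∀ i, c * (order (n t) : ℝ) ≤ (n t i : ℝ)

end BlockModel

end

/-! Zero-statement. If block `i` attains the minimum, the vertices of `V_i` have expected degree at
most `D = log n_i + log log n - W`. Such a vertex has degree at most one with probability at least
about `(1 + D) e^{-D}`, so the expected number of such vertices in `V_i` is at least of order `e^W`.
Two of these events share a single pair of small probability and are almost independent. Chebyshev's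
inequality then gives a vertex of degree at most one (`exists_hamProb_le`).

One-statement. All probabilities are first lowered to at most `K log N / N`, where `N` is the order;
the expected degrees stay above `log N + log log N + W`. Hamiltonicity then comes from Pósa
rotations and sprinkling inside a host graph on which the probability is bounded below by `C / N`.
The host consists of the pairs with `f u + f v = 0`, for a function `f` into an abelian group. Three
functions are used. (1) If `p, q ≥ C / N`, then `f = 0` and all pairs are host pairs. (2) If `q < C
/ N`, then `f` is the indicator of the block with values mod 2, and the host pairs are those inside
blocks. The expected degrees inside the blocks are already above the threshold. By (A2) the blocks
can be linked cyclically by single edges, which are forced into the cycle. (3) If `p < C / N`, then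
(A3) bounds each block by half of the vertices. The blocks are divided into two sides of similar
size, `f = ±1`, and the host pairs join the two sides. A forced path inside one side, using pairs
between different blocks of that side, makes up for the difference in size.

The rotation argument works with lists through all vertices that contain a set `M` of forced pairs
and otherwise only host pairs, present in the random graph or not; the cost of a list is the number
of its absent pairs. Telescoping the sum of `f` over the pairs shows that `f a + f b` is the same
for the ends `a, b` of all such lists (`Admissible.closes`). Hence if the ends of one list form a
host pair, so do the ends of all. Joining the ends of a cheapest list completes a Hamilton cycle or
lowers the least cost. Expansion yields quadratically many such boosters
(`RotationSetup.card_boosters`), and a union bound over the few sprinkled edges really needed shows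
that a layer of density `C / N` suffices (`prob_not_isHamiltonian_le`).

Expansion fails only around atypical vertices, those with few neighbours in a prescribed test set.
With high probability they are rare and spread out (`exists_typical`), so Hall's theorem gives each
of them two private neighbours (`Typical.exists_attached`). The resulting paths of length two are
forced, so atypical vertices are never ends of lists, and the sets that avoid them expand by a
density argument (`Typical.expand`). The layers for structure, links and sprinkling are put together
in `exists_prob_not_isHamiltonian_le`, and the regimes in `exists_le_hamProb`. -/

namespace HamiltonPath

/-! ### Paths as lists, rotations with forced pairs, Pósa's lemma -/

variable {V : Type*}

/-- The unordered pairs of consecutive entries of a list. -/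
def pathEdges : List V → List (Sym2 V)
  | a :: b :: l => s(a, b) :: pathEdges (b :: l)
  | _ => []

@[simp] lemma pathEdges_nil : pathEdges ([] : List V) = [] := rfl

@[simp] lemma pathEdges_singleton (a : V) : pathEdges [a] = [] := rfl

@[simp] lemma pathEdges_cons_cons (a b : V) (l : List V) :
    pathEdges (a :: b :: l) = s(a, b) :: pathEdges (b :: l) := rfl

lemma pathEdges_append_cons (l₁ : List V) (a : V) (l₂ : List V) :
    pathEdges (l₁ ++ a :: l₂) = pathEdges (l₁ ++ [a]) ++ pathEdges (a :: l₂) := by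
  induction l₁ with
  | nil => simp
  | cons x l ih =>
    cases l with
    | nil => simp
    | cons y l => simpa using ih

lemma pathEdges_append_cons_cons (l₁ : List V) (a b : V) (l₂ : List V) :
    pathEdges (l₁ ++ a :: b :: l₂) =
      pathEdges (l₁ ++ [a]) ++ s(a, b) :: pathEdges (b :: l₂) := by
  rw [pathEdges_append_cons]; simp

lemma pathEdges_reverse (l : List V) : pathEdges l.reverse = (pathEdges l).reverse := by
  induction l with
  | nil => simp
  | cons a l ih =>
    cases l with
    | nil => simp
    | cons b l =>
      have h : (a :: b :: l).reverse = l.reverse ++ b :: [a] := by simp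
      rw [h, pathEdges_append_cons]
      have h' : (b :: l).reverse = l.reverse ++ [b] := by simp
      rw [← h', ih]
      simp [Sym2.eq_swap]

lemma mem_of_mem_pathEdges {l : List V} {e : Sym2 V} (he : e ∈ pathEdges l) {v : V}
    (hv : v ∈ e) : v ∈ l := by
  induction l with
  | nil => simp at he
  | cons a l ih =>
    cases l with
    | nil => simp at he
    | cons b l =>
      rw [pathEdges_cons_cons, List.mem_cons] at he
      rcases he with rfl | he
      · rcases Sym2.mem_iff.1 hv with rfl | rfl <;> simp
      · exact List.mem_cons_of_mem _ (ih he)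

lemma nodup_pathEdges {l : List V} (hl : l.Nodup) : (pathEdges l).Nodup := by
  induction l with
  | nil => simp
  | cons a l ih =>
    cases l with
    | nil => simp
    | cons b l =>
      rw [pathEdges_cons_cons, List.nodup_cons]
      refine ⟨fun h => ?_, ih hl.of_cons⟩
      exact (List.nodup_cons.1 hl).1 (mem_of_mem_pathEdges h (Sym2.mem_mk_left _ _))

lemma exists_of_mem_pathEdges {l : List V} {e : Sym2 V} (he : e ∈ pathEdges l) :
    ∃ l₁ a b l₂, l = l₁ ++ a :: b :: l₂ ∧ e = s(a, b) := by
  induction l with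
  | nil => simp at he
  | cons a l ih =>
    cases l with
    | nil => simp at he
    | cons b l =>
      rw [pathEdges_cons_cons, List.mem_cons] at he
      rcases he with rfl | he
      · exact ⟨[], a, b, l, rfl, rfl⟩
      · obtain ⟨l₁, x, y, l₂, h, rfl⟩ := ih he
        exact ⟨a :: l₁, x, y, l₂, by rw [h]; rfl, rfl⟩

lemma head?_of_mem_pathEdges_cons {x y : V} {l : List V} (hx : x ∉ l)
    (h : s(x, y) ∈ pathEdges (x :: l)) : l.head? = some y := by
  cases l with
  | nil => simp at h
  | cons b l =>
    rw [pathEdges_cons_cons, List.mem_cons] at h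
    rcases h with h | h
    · rw [Sym2.eq_iff] at h
      rcases h with h | h
      · simp [h.2]
      · exact absurd (by simp [h.1]) hx
    · exact absurd (mem_of_mem_pathEdges h (Sym2.mem_mk_left _ _)) hx

lemma getLast?_of_mem_pathEdges_append {x y : V} {l : List V} (hx : x ∉ l)
    (h : s(x, y) ∈ pathEdges (l ++ [x])) : l.getLast? = some y := by
  have h' : s(x, y) ∈ pathEdges (x :: l.reverse) := by
    have : x :: l.reverse = (l ++ [x]).reverse := by simp
    rw [this, pathEdges_reverse]; simpa using h
  simpa using head?_of_mem_pathEdges_cons (by simpa using hx) h'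

lemma neighbor_of_mem_pathEdges {x y : V} {l₁ l₂ : List V} (hl : (l₁ ++ x :: l₂).Nodup)
    (h : s(x, y) ∈ pathEdges (l₁ ++ x :: l₂)) :
    l₁.getLast? = some y ∨ l₂.head? = some y := by
  rw [List.nodup_append] at hl
  rw [pathEdges_append_cons, List.mem_append] at h
  rcases h with h | h
  · refine Or.inl (getLast?_of_mem_pathEdges_append (fun hx => ?_) h)
    exact hl.2.2 x hx x (by simp) rfl
  · exact Or.inr (head?_of_mem_pathEdges_cons (List.nodup_cons.1 hl.2.1).1 h)

lemma card_neighbors_le [Fintype V] [DecidableEq V] {l : List V} (hl : l.Nodup) (x : V) :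
    (Finset.univ.filter fun y => s(x, y) ∈ pathEdges l).card ≤ 2 := by
  by_cases hx : x ∈ l
  · obtain ⟨l₁, l₂, rfl⟩ := List.append_of_mem hx
    calc _ ≤ (l₁.getLast?.toFinset ∪ l₂.head?.toFinset).card := by
          refine Finset.card_le_card fun y hy => ?_
          have := neighbor_of_mem_pathEdges hl (Finset.mem_filter.1 hy).2
          simpa [Option.mem_def] using this
      _ ≤ l₁.getLast?.toFinset.card + l₂.head?.toFinset.card := Finset.card_union_le _ _
      _ ≤ 1 + 1 := by
          have h (o : Option V) : o.toFinset.card ≤ 1 := by cases o <;> simp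
          exact add_le_add (h _) (h _)
      _ = 2 := rfl
  · rw [Finset.filter_eq_empty_iff.2]
    · simp
    · intro y _ h
      exact hx (mem_of_mem_pathEdges h (Sym2.mem_mk_left _ _))

lemma eq_of_mem_pathEdges_getLast {l : List V} (hl : l.Nodup) {x : V}
    (hx : l.getLast? = some x) {e₁ e₂ : Sym2 V} (h₁ : e₁ ∈ pathEdges l) (h₂ : e₂ ∈ pathEdges l)
    (hx₁ : x ∈ e₁) (hx₂ : x ∈ e₂) : e₁ = e₂ := by
  obtain ⟨l₁, rfl⟩ := List.getLast?_eq_some_iff.1 hx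
  obtain ⟨y, rfl⟩ := hx₁
  obtain ⟨z, rfl⟩ := hx₂
  have hy := neighbor_of_mem_pathEdges hl h₁
  have hz := neighbor_of_mem_pathEdges hl h₂
  simp only [List.head?_nil, reduceCtorEq, or_false] at hy hz
  rw [hy] at hz
  rw [Option.some.inj hz]

/-- The sum of the values of `f` at the two ends of a pair. -/
def pairSum {A : Type*} [AddCommGroup A] (f : V → A) : Sym2 V → A :=
  Sym2.lift ⟨fun u v => f u + f v, fun _ _ => add_comm _ _⟩

@[simp] lemma pairSum_mk {A : Type*} [AddCommGroup A] (f : V → A) (u v : V) :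
    pairSum f s(u, v) = f u + f v := rfl

/-- Inner entries lie on two consecutive pairs and the ends on one; adding the ends once more evens
this out. -/
lemma sum_pairSum_pathEdges {A : Type*} [AddCommGroup A] (f : V → A) (l : List V) (a b : V)
    (ha : l.head? = some a) (hb : l.getLast? = some b) :
    ((pathEdges l).map (pairSum f)).sum + (f a + f b) = 2 • (l.map f).sum := by
  induction l generalizing a with
  | nil => simp at ha
  | cons x l ih =>
    obtain rfl : x = a := by simpa using ha
    cases l with
    | nil =>
      obtain rfl : x = b := by simpa using hb
      simp [two_smul]
    | cons y l =>
      have := ih y rfl (by simpa using hb)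
      rw [List.map_cons, List.sum_cons, smul_add, ← this]
      simp only [pathEdges_cons_cons, List.map_cons, List.sum_cons, pairSum_mk]
      abel

variable {A : Type*} [AddCommGroup A]

/-- A list through all vertices that uses all pairs of `M`, and apart from these only pairs at
which `pairSum f` vanishes. -/
structure Admissible (f : V → A) (M : Finset (Sym2 V)) (l : List V) : Prop where
  nodup : l.Nodup
  mem : ∀ v, v ∈ l
  subset : ∀ e ∈ M, e ∈ pathEdges l
  host : ∀ e ∈ pathEdges l, e ∈ M ∨ pairSum f e = 0

lemma Admissible.reverse {f : V → A} {M : Finset (Sym2 V)} {l : List V}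
    (h : Admissible f M l) : Admissible f M l.reverse where
  nodup := by simpa using h.nodup
  mem := by simpa using h.mem
  subset e he := by rw [pathEdges_reverse]; simpa using h.subset e he
  host e he := by rw [pathEdges_reverse] at he; exact h.host e (by simpa using he)

/-- Host pairs contribute zero to the telescoped sum, so only `M` remains: the value at the two ends
depends on `f` and `M` but not on the list. -/
lemma Admissible.sum_eq [Fintype V] [DecidableEq V] {f : V → A} {M : Finset (Sym2 V)}
    {l : List V} (h : Admissible f M l) {a b : V} (ha : l.head? = some a)
    (hb : l.getLast? = some b) : ∑ e ∈ M, pairSum f e + (f a + f b) = 2 • ∑ v, f v := by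
  have h1 := sum_pairSum_pathEdges f l a b ha hb
  have h2 : (l.map f).sum = ∑ v, f v := by
    rw [← List.sum_toFinset _ h.nodup]
    congr 1
    ext v; simp [h.mem]
  have h3 : ((pathEdges l).map (pairSum f)).sum = ∑ e ∈ M, pairSum f e := by
    rw [← List.sum_toFinset _ (nodup_pathEdges h.nodup)]
    symm
    refine Finset.sum_subset (fun e he => by simpa using h.subset e he) fun e he heM => ?_
    exact (h.host e (by simpa using he)).resolve_left heM
  rw [← h2, ← h3, h1]

/-- One admissible list whose ends can be joined forces all of them to have this property. -/
lemma Admissible.closes [Fintype V] [DecidableEq V] {f : V → A} {M : Finset (Sym2 V)}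
    {l l₀ : List V} (h : Admissible f M l) (h₀ : Admissible f M l₀) {a b a₀ b₀ : V}
    (ha₀ : l₀.head? = some a₀) (hb₀ : l₀.getLast? = some b₀) (h0 : f a₀ + f b₀ = 0)
    (ha : l.head? = some a) (hb : l.getLast? = some b) : f a + f b = 0 := by
  have h1 := h.sum_eq ha hb
  have h2 := h₀.sum_eq ha₀ hb₀
  rw [← h2, h0] at h1
  simpa using h1

open Classical in
/-- The number of consecutive pairs of a list that are not edges of the graph. -/
noncomputable def cost (Γ : SimpleGraph V) (l : List V) : ℕ :=
  (pathEdges l).countP fun e => decide (e ∉ Γ.edgeSet)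

lemma cost_reverse (Γ : SimpleGraph V) (l : List V) : cost Γ l.reverse = cost Γ l := by
  rw [cost, pathEdges_reverse, List.countP_reverse, cost]

lemma cost_mono {Γ Γ' : SimpleGraph V} (h : Γ ≤ Γ') (l : List V) : cost Γ' l ≤ cost Γ l := by
  refine List.countP_mono_left fun e _ he => ?_
  have := SimpleGraph.edgeSet_mono h
  simp only [decide_eq_true_eq] at he ⊢
  exact fun h' => he (this h')

/-- A rotation of a list at an entry `y` outside `F`. -/
def Rotates (Γ : SimpleGraph V) (f : V → A) (F : Finset V) (l l' : List V) : Prop :=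
  ∃ l₁ y l₂ x, l = l₁ ++ y :: (l₂ ++ [x]) ∧ l' = l₁ ++ y :: x :: l₂.reverse ∧
    Γ.Adj x y ∧ f x + f y = 0 ∧ y ∉ F

section rotation

variable {Γ : SimpleGraph V} {f : V → A} {F : Finset V} {M : Finset (Sym2 V)}
  {l l' : List V}

lemma pathEdges_rotate (l₁ : List V) (y w : V) (t : List V) (x : V) :
    pathEdges (l₁ ++ y :: (w :: t ++ [x])) =
        pathEdges (l₁ ++ [y]) ++ s(y, w) :: pathEdges (w :: t ++ [x]) ∧
      pathEdges (l₁ ++ y :: x :: (w :: t).reverse) =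
        pathEdges (l₁ ++ [y]) ++ s(y, x) :: (pathEdges (w :: t ++ [x])).reverse := by
  refine ⟨by simpa using pathEdges_append_cons_cons l₁ y w (t ++ [x]), ?_⟩
  rw [pathEdges_append_cons_cons, ← pathEdges_reverse]
  simp

/-- The pair that is removed contains the pivot `y`, which lies outside `F`, so it is not forced.
The pair that is added is a host pair. If `y` already precedes `x`, nothing changes. -/
lemma Rotates.admissible (hF : ∀ e ∈ M, ∀ v ∈ e, v ∈ F) (h : Rotates Γ f F l l')
    (hl : Admissible f M l) : Admissible f M l' := by
  obtain ⟨l₁, y, l₂, x, rfl, rfl, hxy, hf, hy⟩ := h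
  cases l₂ with
  | nil => simpa using hl
  | cons w t =>
    obtain ⟨e1, e2⟩ := pathEdges_rotate l₁ y w t x
    have hp : (l₁ ++ y :: x :: (w :: t).reverse).Perm (l₁ ++ y :: (w :: t ++ [x])) := by
      refine List.Perm.append_left _ (List.Perm.cons _ ?_)
      have : x :: (w :: t).reverse = (w :: t ++ [x]).reverse := by simp
      rw [this]; exact List.reverse_perm _
    refine ⟨hp.nodup_iff.2 hl.nodup, fun v => hp.mem_iff.2 (hl.mem v), fun e he => ?_,
      fun e he => ?_⟩
    · have h1 := hl.subset e he
      rw [e1] at h1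
      rw [e2]
      simp only [List.mem_append, List.mem_cons, List.mem_reverse] at h1 ⊢
      rcases h1 with h1 | h1 | h1
      · exact Or.inl h1
      · exact absurd (hF e he y (by rw [h1]; simp)) hy
      · exact Or.inr (Or.inr h1)
    · rw [e2] at he
      have h1 := hl.host e
      rw [e1] at h1
      simp only [List.mem_append, List.mem_cons, List.mem_reverse] at h1 he
      rcases he with he | he | he
      · exact h1 (Or.inl he)
      · right; rw [he, pairSum_mk, add_comm, hf]
      · exact h1 (Or.inr (Or.inr he))

lemma Rotates.cost_le (h : Rotates Γ f F l l') : cost Γ l' ≤ cost Γ l := by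
  obtain ⟨l₁, y, l₂, x, rfl, rfl, hxy, hf, hy⟩ := h
  cases l₂ with
  | nil => simp
  | cons w t =>
    obtain ⟨e1, e2⟩ := pathEdges_rotate l₁ y w t x
    have : Γ.Adj y x := hxy.symm
    rw [cost, cost, e1, e2, List.countP_append, List.countP_append, List.countP_cons,
      List.countP_cons, List.countP_reverse]
    simp [this]

lemma Rotates.head?_eq (h : Rotates Γ f F l l') : l'.head? = l.head? := by
  obtain ⟨l₁, y, l₂, x, rfl, rfl, hxy, hf, hy⟩ := h
  cases l₁ <;> simp

/-- The last entries of the lists obtained from `l` by repeated rotation. -/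
def ends (Γ : SimpleGraph V) (f : V → A) (F : Finset V) (l : List V) : Set V :=
  {v | ∃ l', Relation.ReflTransGen (Rotates Γ f F) l l' ∧ l'.getLast? = some v}

lemma admissible_of_reflTransGen (hF : ∀ e ∈ M, ∀ v ∈ e, v ∈ F) (hl : Admissible f M l)
    (h : Relation.ReflTransGen (Rotates Γ f F) l l') :
    Admissible f M l' ∧ cost Γ l' ≤ cost Γ l ∧ l'.head? = l.head? := by
  induction h with
  | refl => exact ⟨hl, le_rfl, rfl⟩
  | tail _ h ih =>
    exact ⟨h.admissible hF ih.1, h.cost_le.trans ih.2.1, h.head?_eq.trans ih.2.2⟩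

/-- A rotation replaces `s(y, w)` by `s(y, x)`, where `x` and `w` are the ends before and after it.
So `z` can be affected only as the pivot `y`; but then, by induction, `z` was next to the end `w`
already on `l`. -/
lemma mem_pathEdges_iff_of_reflTransGen
    (h : Relation.ReflTransGen (Rotates Γ f F) l l') {z : V} (hz : z ∉ ends Γ f F l)
    (hzn : ∀ x ∈ ends Γ f F l, s(z, x) ∉ pathEdges l) (u : V) :
    s(z, u) ∈ pathEdges l' ↔ s(z, u) ∈ pathEdges l := by
  induction h generalizing u with
  | refl => rfl
  | @tail l' l'' h h' ih =>
    have hl'' := h.tail h'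
    obtain ⟨l₁, y, l₂, x, rfl, rfl, hxy, hf, hy⟩ := h'
    cases l₂ with
    | nil => simpa using ih u
    | cons w t =>
      obtain ⟨e1, e2⟩ := pathEdges_rotate l₁ y w t x
      have hx : x ∈ ends Γ f F l :=
        ⟨_, h, List.getLast?_eq_some_iff.2 ⟨l₁ ++ y :: w :: t, by simp⟩⟩
      have hw : w ∈ ends Γ f F l := ⟨_, hl'', by
        rw [List.getLast?_eq_some_iff]; exact ⟨l₁ ++ y :: x :: t.reverse, by simp⟩⟩
      have hzx : z ≠ x := fun h => hz (h ▸ hx)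
      have hzw : z ≠ w := fun h => hz (h ▸ hw)
      have hzy : z ≠ y := by
        rintro rfl
        refine hzn w hw ((ih w).1 ?_)
        rw [e1]; simp
      rw [← ih u, e1, e2]
      simp only [List.mem_append, List.mem_cons, List.mem_reverse, Sym2.eq_iff]
      simp [hzx, hzw, hzy]

/-- Pósa's lemma. -/
lemma exists_mem_ends_of_adj (hF : ∀ e ∈ M, ∀ v ∈ e, v ∈ F) (hl : Admissible f M l) {u x : V}
    (huF : u ∉ F) (hu : u ∉ ends Γ f F l) (hx : x ∈ ends Γ f F l) (hxu : Γ.Adj x u)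
    (hf : f x + f u = 0) : ∃ x ∈ ends Γ f F l, s(x, u) ∈ pathEdges l := by
  by_contra! hcon
  have hcon' : ∀ x ∈ ends Γ f F l, s(u, x) ∉ pathEdges l := fun x hx => by
    rw [Sym2.eq_swap]; exact hcon x hx
  obtain ⟨l', hl', hlast⟩ := hx
  have hadm := (admissible_of_reflTransGen hF hl hl').1
  obtain ⟨m, rfl⟩ := List.getLast?_eq_some_iff.1 hlast
  have hum : u ∈ m := by
    have := hadm.mem u
    rcases List.mem_append.1 this with h | h
    · exact h
    · exact absurd (List.mem_singleton.1 h) hxu.ne'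
  obtain ⟨l₁, l₂, rfl⟩ := List.append_of_mem hum
  have key := fun w => mem_pathEdges_iff_of_reflTransGen hl' hu hcon' w
  cases l₂ with
  -- Here `u` directly precedes the end `x`, so `x` itself is a neighbour of `u` on the list.
  | nil =>
    refine hcon' x ⟨_, hl', hlast⟩ ((key x).1 ?_)
    rw [List.append_assoc, List.cons_append, List.nil_append, pathEdges_append_cons_cons]; simp
  -- Rotating at `u` makes its successor `w` an end, and `s(u, w)` is a pair of the original list
  -- because the pairs at `u` have not changed.
  | cons w t =>
    have e1 := (pathEdges_rotate l₁ u w t x).1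
    rw [List.append_assoc, List.cons_append] at hl' key
    have hw : w ∈ ends Γ f F l := by
      refine ⟨_, hl'.tail ⟨l₁, u, w :: t, x, rfl, rfl, hxu, hf, huF⟩, ?_⟩
      rw [List.getLast?_eq_some_iff]; exact ⟨l₁ ++ u :: x :: t.reverse, by simp⟩
    refine hcon' w hw ((key w).1 ?_)
    rw [e1]; simp

end rotation

end HamiltonPath

/-! ### Boosters -/

namespace HamiltonPath

variable {V : Type*}

lemma edges_eq_pathEdges_support {G : SimpleGraph V} {a b : V} (p : G.Walk a b) :
    p.edges = pathEdges p.support := by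
  induction p with
  | nil => simp
  | cons h p ih =>
    cases p with
    | nil => simp
    | cons h' p => simpa using ih

lemma isChain_of_pathEdges {G : SimpleGraph V} {l : List V}
    (h : ∀ e ∈ pathEdges l, e ∈ G.edgeSet) : l.IsChain G.Adj := by
  induction l with
  | nil => simp
  | cons a l ih =>
    cases l with
    | nil => simp
    | cons b l =>
      rw [List.isChain_cons_cons]
      refine ⟨by simpa using h s(a, b) (by simp), ih fun e he => h e (by simp [he])⟩

variable [Fintype V] [DecidableEq V]

/-- The point that needs three vertices is that the closing edge is not already a pair of the list.
-/
lemma isHamiltonian_of_list {G : SimpleGraph V} {l : List V} (hcard : 3 ≤ Fintype.card V)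
    (hl : l.Nodup) (hmem : ∀ v, v ∈ l) (h : ∀ e ∈ pathEdges l, e ∈ G.edgeSet) {a b : V}
    (ha : l.head? = some a) (hb : l.getLast? = some b) (hab : G.Adj b a) :
    G.IsHamiltonian := by
  intro _
  have hne : l ≠ [] := by rintro rfl; simp at ha
  have hlen : l.length = Fintype.card V := by
    rw [← List.toFinset_card_of_nodup hl, ← Finset.card_univ]
    congr 1; ext v; simp [hmem]
  have hae : l.head hne = a := by
    rw [List.head?_eq_some_head hne] at ha; exact Option.some.inj ha
  have hbe : l.getLast hne = b := by
    rw [List.getLast?_eq_some_getLast hne] at hb; exact Option.some.inj hb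
  subst hae hbe
  let p := SimpleGraph.Walk.ofSupport l hne (isChain_of_pathEdges h)
  have hsupp : p.support = l := SimpleGraph.Walk.support_ofSupport _ _
  refine ⟨l.getLast hne, SimpleGraph.Walk.cons hab p, ?_⟩
  rw [SimpleGraph.Walk.isHamiltonianCycle_iff_isCycle_and_length_eq,
    SimpleGraph.Walk.cons_isCycle_iff, edges_eq_pathEdges_support, hsupp]
  refine ⟨⟨⟨⟨by rw [edges_eq_pathEdges_support, hsupp]; exact nodup_pathEdges hl⟩,
    by rw [hsupp]; exact hl⟩, fun hmem' => ?_⟩, ?_⟩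
  · obtain ⟨x, t, rfl⟩ := List.exists_cons_of_ne_nil hne
    have h1 := head?_of_mem_pathEdges_cons (List.nodup_cons.1 hl).1
      (by rw [Sym2.eq_swap] at hmem'; exact hmem')
    cases t with
    | nil => simp at h1
    | cons y t =>
      cases t with
      | nil => simp at hlen; omega
      | cons z t =>
        have h2 : y = (z :: t).getLast (by simp) := by simpa using h1
        have : y ∈ z :: t := h2 ▸ List.getLast_mem _
        exact (List.nodup_cons.1 (List.nodup_cons.1 hl).2).1 this
  · rw [SimpleGraph.Walk.length_cons]
    have : p.support.length = p.length + 1 := SimpleGraph.Walk.length_support _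
    rw [← this, hsupp, hlen]

variable {A : Type*} [AddCommGroup A] {f : V → A} {M : Finset (Sym2 V)} {F D : Finset V}
  {l₀ : List V} {Γ Γ' : SimpleGraph V} {m : ℕ}

open Classical in
/-- The hypotheses of the rotation argument: forced pairs `M` inside `F`, an admissible list whose
ends can be joined, and expansion of the sets that avoid `D`, where all vertices of `D` lie on two
forced pairs. -/
structure RotationSetup (f : V → A) (M : Finset (Sym2 V)) (F D : Finset V) (l₀ : List V) (m : ℕ)
    (Γ : SimpleGraph V) : Prop where
  three_le : 3 ≤ Fintype.card V
  admissible : Admissible f M l₀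
  closes : ∀ a b, l₀.head? = some a → l₀.getLast? = some b → f a + f b = 0
  touched : ∀ e ∈ M, ∀ v ∈ e, v ∈ F
  subset : ∀ e ∈ M, e ∈ Γ.edgeSet
  two_forced : ∀ v ∈ D, ∃ e₁ ∈ M, ∃ e₂ ∈ M, e₁ ≠ e₂ ∧ v ∈ e₁ ∧ v ∈ e₂
  expand : ∀ S : Finset V, S.Nonempty → Disjoint S D → S.card ≤ m →
    2 * S.card <
      (Finset.univ.filter fun u => u ∉ F ∧ u ∉ S ∧ ∃ v ∈ S, Γ.Adj v u ∧ f v + f u = 0).card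

namespace RotationSetup

lemma mono (h : RotationSetup f M F D l₀ m Γ) (hle : Γ ≤ Γ') :
    RotationSetup f M F D l₀ m Γ' where
  three_le := h.three_le
  admissible := h.admissible
  closes := h.closes
  touched := h.touched
  subset e he := SimpleGraph.edgeSet_mono hle (h.subset e he)
  two_forced := h.two_forced
  expand S hS hD hm := (h.expand S hS hD hm).trans_le <| Finset.card_le_card fun u hu => by
    simp only [Finset.mem_filter, Finset.mem_univ, true_and] at hu ⊢
    obtain ⟨h1, h2, v, hv, hvu, h0⟩ := hu
    exact ⟨h1, h2, v, hv, hle hvu, h0⟩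

lemma head_ne_last (h : RotationSetup f M F D l₀ m Γ) {l : List V} (hl : Admissible f M l) :
    ∃ a b, l.head? = some a ∧ l.getLast? = some b ∧ a ≠ b := by
  have hlen : l.length = Fintype.card V := by
    rw [← List.toFinset_card_of_nodup hl.nodup, ← Finset.card_univ]
    congr 1; ext v; simp [hl.mem]
  have h3 := h.three_le
  match l, hl, hlen with
  | [], _, hlen => simp at hlen; omega
  | [a], _, hlen => simp at hlen; omega
  | a :: b :: t, hl, _ =>
    refine ⟨a, (b :: t).getLast (by simp), rfl, ?_, ?_⟩
    · rw [List.getLast?_eq_some_getLast (by simp)]; simp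
    · intro hab
      have : a ∈ b :: t := by rw [hab]; exact List.getLast_mem _
      exact (List.nodup_cons.1 hl.nodup).1 this

/-- The set of ends avoids `D`, because an end lies on only one pair of its list and a vertex of `D`
on two forced ones. By Pósa's lemma every vertex counted in `expand` is next to an end on `l`, so
there are at most twice as many of them as ends. This contradicts expansion unless there are more
than `m` ends. -/
lemma lt_card_ends (h : RotationSetup f M F D l₀ m Γ) {l : List V} (hl : Admissible f M l) :
    ∃ R : Finset V, (R : Set V) = ends Γ f F l ∧ m < R.card := by
  classical
  refine ⟨(Set.toFinite (ends Γ f F l)).toFinset, by simp, ?_⟩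
  set R := (Set.toFinite (ends Γ f F l)).toFinset with hR
  have hmem : ∀ v, v ∈ R ↔ v ∈ ends Γ f F l := fun v => by simp [hR]
  by_contra! hcon
  obtain ⟨a, b, -, hb, -⟩ := h.head_ne_last hl
  have hne : R.Nonempty := ⟨b, (hmem b).2 ⟨l, .refl, hb⟩⟩
  have hdisj : Disjoint R D := by
    rw [Finset.disjoint_left]
    intro v hv hvD
    obtain ⟨l', hl', hlast⟩ := (hmem v).1 hv
    have hadm := (admissible_of_reflTransGen h.touched hl hl').1
    obtain ⟨e₁, h₁, e₂, h₂, hne, hv₁, hv₂⟩ := h.two_forced v hvD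
    exact hne (eq_of_mem_pathEdges_getLast hadm.nodup hlast (hadm.subset _ h₁)
      (hadm.subset _ h₂) hv₁ hv₂)
  refine (h.expand R hne hdisj hcon).not_ge ?_
  calc _ ≤ (R.biUnion fun x => Finset.univ.filter fun u => s(x, u) ∈ pathEdges l).card := by
        refine Finset.card_le_card fun u hu => ?_
        obtain ⟨huF, huR, x, hx, hxu, h0⟩ := (Finset.mem_filter.1 hu).2
        obtain ⟨y, hy, hyu⟩ := exists_mem_ends_of_adj h.touched hl huF
          (fun h' => huR ((hmem u).2 h')) ((hmem x).1 hx) hxu h0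
        exact Finset.mem_biUnion.2 ⟨y, (hmem y).2 hy, by simpa using hyu⟩
    _ ≤ R.card * 2 := Finset.card_biUnion_le_card_mul _ _ _ fun x _ =>
        card_neighbors_le hl.nodup x
    _ = 2 * R.card := mul_comm _ _

end RotationSetup

/-- The smallest cost of an admissible list. -/
noncomputable def minCost (f : V → A) (M : Finset (Sym2 V)) (Γ : SimpleGraph V) : ℕ :=
  sInf {c | ∃ l, Admissible f M l ∧ cost Γ l = c}

omit [Fintype V] [DecidableEq V] in
lemma minCost_le {l : List V} (h : Admissible f M l) : minCost f M Γ ≤ cost Γ l :=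
  Nat.sInf_le ⟨l, h, rfl⟩

open Classical in
/-- The pairs of ends of admissible lists of smallest cost. -/
noncomputable def boosters (f : V → A) (M : Finset (Sym2 V)) (Γ : SimpleGraph V) :
    Finset (Sym2 V) :=
  Finset.univ.filter fun e => ∃ l a b, Admissible f M l ∧ cost Γ l = minCost f M Γ ∧
    l.head? = some a ∧ l.getLast? = some b ∧ e = s(a, b)

omit [DecidableEq V] in
lemma mem_boosters {e : Sym2 V} : e ∈ boosters f M Γ ↔
    ∃ l a b, Admissible f M l ∧ cost Γ l = minCost f M Γ ∧
      l.head? = some a ∧ l.getLast? = some b ∧ e = s(a, b) := by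
  simp [boosters]

namespace RotationSetup

lemma exists_minCost (h : RotationSetup f M F D l₀ m Γ) :
    ∃ l, Admissible f M l ∧ cost Γ l = minCost f M Γ :=
  Nat.sInf_mem (s := {c | ∃ l, Admissible f M l ∧ cost Γ l = c}) ⟨_, l₀, h.admissible, rfl⟩

lemma closes_of_admissible (h : RotationSetup f M F D l₀ m Γ) {l : List V}
    (hl : Admissible f M l) {a b : V} (ha : l.head? = some a) (hb : l.getLast? = some b) :
    f a + f b = 0 := by
  obtain ⟨a₀, b₀, ha₀, hb₀, -⟩ := h.head_ne_last h.admissible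
  exact hl.closes h.admissible ha₀ hb₀ (h.closes _ _ ha₀ hb₀) ha hb

/-- Take a cheapest list whose ends form the pair `e`. If all its pairs are edges of `Γ`, then `e`
closes a Hamilton cycle. Otherwise the closed list is cut open at an absent pair `s(u, v)`, which is
not forced since `M` lies in `Γ`; the resulting list is admissible and cheaper. -/
lemma progress (h : RotationSetup f M F D l₀ m Γ) (hle : Γ ≤ Γ') {e : Sym2 V}
    (he : e ∈ boosters f M Γ) (heΓ : e ∈ Γ'.edgeSet) (hham : ¬ Γ'.IsHamiltonian) :
    minCost f M Γ' < minCost f M Γ := by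
  obtain ⟨l, a, b, hl, hc, ha, hb, rfl⟩ := mem_boosters.1 he
  have hadj : Γ'.Adj b a := by rw [SimpleGraph.mem_edgeSet] at heΓ; exact heΓ.symm
  have hsum := h.closes_of_admissible hl ha hb
  by_cases hall : ∀ e ∈ pathEdges l, e ∈ Γ.edgeSet
  · exact absurd (isHamiltonian_of_list h.three_le hl.nodup hl.mem
      (fun e he => SimpleGraph.edgeSet_mono hle (hall e he)) ha hb hadj) hham
  push Not at hall
  obtain ⟨e, hel, heΓ'⟩ := hall
  obtain ⟨l₁, u, v, l₂, rfl, rfl⟩ := exists_of_mem_pathEdges hel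
  obtain ⟨t, ht⟩ : ∃ t, l₁ ++ [u] = a :: t := by
    cases l₁ with
    | nil => exact ⟨[], by simpa using ha⟩
    | cons x l₁ => exact ⟨l₁ ++ [u], by simpa using ha⟩
  obtain ⟨t', ht'⟩ : ∃ t', v :: l₂ = t' ++ [b] := by
    have e0 : l₁ ++ u :: v :: l₂ = (l₁ ++ [u]) ++ (v :: l₂) := by simp
    rw [← List.getLast?_eq_some_iff, ← hb, e0, List.getLast?_append_of_ne_nil _ (by simp)]
  have e1 : pathEdges (l₁ ++ u :: v :: l₂) =
      pathEdges (a :: t) ++ s(u, v) :: pathEdges (t' ++ [b]) := by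
    rw [pathEdges_append_cons_cons, ht, ht']
  have e2 : pathEdges (t' ++ b :: a :: t) =
      pathEdges (t' ++ [b]) ++ s(b, a) :: pathEdges (a :: t) := pathEdges_append_cons_cons _ _ _ _
  have hperm : (t' ++ b :: a :: t).Perm (l₁ ++ u :: v :: l₂) := by
    have e3 : t' ++ b :: a :: t = (v :: l₂) ++ (l₁ ++ [u]) := by rw [ht, ht']; simp
    have e4 : l₁ ++ u :: v :: l₂ = (l₁ ++ [u]) ++ (v :: l₂) := by simp
    rw [e3, e4]; exact List.perm_append_comm
  have hadm : Admissible f M (t' ++ b :: a :: t) := by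
    refine ⟨hperm.nodup_iff.2 hl.nodup, fun w => hperm.mem_iff.2 (hl.mem w), fun e he => ?_,
      fun e he => ?_⟩
    · have h1 := hl.subset e he
      rw [e1] at h1
      rw [e2]
      simp only [List.mem_append, List.mem_cons] at h1 ⊢
      rcases h1 with h1 | h1 | h1
      · exact Or.inr (Or.inr h1)
      · exact absurd (h1 ▸ h.subset e he) heΓ'
      · exact Or.inl h1
    · have h1 := hl.host e
      rw [e1] at h1
      rw [e2] at he
      simp only [List.mem_append, List.mem_cons] at h1 he
      rcases he with he | he | he
      · exact h1 (Or.inr (Or.inr he))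
      · right; rw [he, pairSum_mk, add_comm, hsum]
      · exact h1 (Or.inl he)
  have hlt : cost Γ' (t' ++ b :: a :: t) < cost Γ (l₁ ++ u :: v :: l₂) := by
    have i1 := cost_mono hle (t' ++ [b])
    have i2 := cost_mono hle (a :: t)
    simp only [cost] at i1 i2 ⊢
    rw [e1, e2, List.countP_append, List.countP_append, List.countP_cons, List.countP_cons]
    have hj1 : s(b, a) ∈ Γ'.edgeSet := hadj
    simp only [hj1, heΓ', not_true_eq_false, not_false_eq_true, decide_true, decide_false,
      if_true, Bool.false_eq_true, if_false]
    omega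
  exact (minCost_le hadm).trans_lt (hlt.trans_le hc.le)

lemma notMem_of_mem_boosters (h : RotationSetup f M F D l₀ m Γ) (hham : ¬ Γ.IsHamiltonian)
    {e : Sym2 V} (he : e ∈ boosters f M Γ) : e ∉ Γ.edgeSet :=
  fun heΓ => (h.progress le_rfl he heΓ hham).false

lemma host_of_mem_boosters (h : RotationSetup f M F D l₀ m Γ) {e : Sym2 V}
    (he : e ∈ boosters f M Γ) : ¬ e.IsDiag ∧ pairSum f e = 0 := by
  obtain ⟨l, a, b, hl, hc, ha, hb, rfl⟩ := mem_boosters.1 he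
  refine ⟨?_, h.closes_of_admissible hl ha hb⟩
  obtain ⟨a', b', ha', hb', hne⟩ := h.head_ne_last hl
  rw [ha] at ha'; rw [hb] at hb'
  rw [Sym2.mk_isDiag_iff, Option.some.inj ha', Option.some.inj hb']
  exact hne

/-- Rotations with fixed head give more than `m` ends `b`. Reversing each of these lists and
rotating again, with `b` as fixed head, gives more than `m` partners of `b`. Costs never rise under
rotation, so all these lists are cheapest. Each unordered pair arises at most twice. -/
lemma card_boosters (h : RotationSetup f M F D l₀ m Γ) :
    m ^ 2 ≤ 2 * (boosters f M Γ).card := by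
  classical
  obtain ⟨l, hl, hc⟩ := h.exists_minCost
  obtain ⟨R, hR, hRm⟩ := h.lt_card_ends hl
  have key : ∀ b, ∃ S : Finset V, b ∈ R → m < S.card ∧ ∀ a ∈ S, s(b, a) ∈ boosters f M Γ := by
    intro b
    by_cases hb : b ∈ R
    swap
    · exact ⟨∅, fun h => absurd h hb⟩
    have hb' : b ∈ ends Γ f F l := by rw [← hR]; exact hb
    obtain ⟨l', hl', hlast⟩ := hb'
    obtain ⟨hadm, hcost, -⟩ := admissible_of_reflTransGen h.touched hl hl'
    obtain ⟨S, hS, hSm⟩ := h.lt_card_ends hadm.reverse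
    refine ⟨S, fun _ => ⟨hSm, fun a ha => ?_⟩⟩
    have ha' : a ∈ ends Γ f F l'.reverse := by rw [← hS]; exact ha
    obtain ⟨l'', hl'', hlast'⟩ := ha'
    obtain ⟨hadm', hcost', hhead⟩ := admissible_of_reflTransGen h.touched hadm.reverse hl''
    rw [cost_reverse] at hcost'
    refine mem_boosters.2 ⟨l'', b, a, hadm', ?_, ?_, hlast', rfl⟩
    · exact le_antisymm (hcost'.trans (hcost.trans hc.le)) (minCost_le hadm')
    · rw [hhead, List.head?_reverse, hlast]
  choose S hS using key
  have h1 : (R.sigma S).card ≤ 2 * (boosters f M Γ).card := by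
    refine Finset.card_le_mul_card_image_of_maps_to (f := fun p => s(p.1, p.2))
      (fun p hp => ?_) 2 fun e he => ?_
    · rw [Finset.mem_sigma] at hp
      exact (hS p.1 hp.1).2 p.2 hp.2
    · induction e with
      | h u v =>
        calc _ ≤ ({⟨u, v⟩, ⟨v, u⟩} : Finset (Σ _ : V, V)).card := by
              refine Finset.card_le_card fun p hp => ?_
              obtain ⟨x, y⟩ := p
              have := (Finset.mem_filter.1 hp).2
              rw [Sym2.eq_iff] at this
              rcases this with ⟨rfl, rfl⟩ | ⟨rfl, rfl⟩ <;> simp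
          _ ≤ 2 := Finset.card_le_two
  refine le_trans ?_ h1
  rw [Finset.card_sigma]
  calc m ^ 2 ≤ R.card * m := by rw [sq]; exact Nat.mul_le_mul_right _ hRm.le
    _ = ∑ _b ∈ R, m := by simp
    _ ≤ _ := Finset.sum_le_sum fun b hb => (hS b hb).1.le

/-- If sprinkled edges do not complete a Hamilton cycle, then few of them lead to a graph all of
whose boosters are missed. -/
lemma exists_missed_boosters (h : RotationSetup f M F D l₀ m Γ) {X : Finset (Sym2 V)}
    (hham : ¬ (Γ ⊔ SimpleGraph.fromEdgeSet (X : Set (Sym2 V))).IsHamiltonian) :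
    ∃ Y ⊆ X, Y.card ≤ Fintype.card V ∧
      ¬ (Γ ⊔ SimpleGraph.fromEdgeSet (Y : Set (Sym2 V))).IsHamiltonian ∧
      Disjoint X (boosters f M (Γ ⊔ SimpleGraph.fromEdgeSet (Y : Set (Sym2 V)))) := by
  classical
  set G : Finset (Sym2 V) → SimpleGraph V :=
    fun Y => Γ ⊔ SimpleGraph.fromEdgeSet (Y : Set (Sym2 V)) with hG
  have hmono : ∀ {Y Y'}, Y ⊆ Y' → G Y ≤ G Y' := fun {Y Y'} hY =>
    sup_le_sup_left (SimpleGraph.fromEdgeSet_mono (by exact_mod_cast hY)) _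
  have hset : ∀ Y, RotationSetup f M F D l₀ m (G Y) := fun Y => h.mono le_sup_left
  have hle0 : minCost f M (G ∅) ≤ Fintype.card V := by
    refine (minCost_le h.admissible).trans ?_
    have hlen : l₀.length = Fintype.card V := by
      rw [← List.toFinset_card_of_nodup h.admissible.nodup, ← Finset.card_univ]
      congr 1; ext v; simp [h.admissible.mem]
    have hle : ∀ l : List V, (pathEdges l).length ≤ l.length := by
      intro l
      induction l with
      | nil => simp
      | cons a l ih =>
        cases l with
        | nil => simp
        | cons b l => simpa using ih
    exact List.countP_le_length.trans ((hle _).trans hlen.le)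
  -- Among the sets each of whose edges is paid for by a drop of the least cost, a largest one is
  -- taken. Its size is at most the number of vertices, and a booster inside `X` could be added to
  -- it.
  let 𝒴 := X.powerset.filter fun Y => minCost f M (G Y) + Y.card ≤ Fintype.card V
  obtain ⟨Y, hY, hmax⟩ := Finset.exists_max_image 𝒴 Finset.card ⟨∅, by simpa [𝒴] using hle0⟩
  simp only [𝒴, Finset.mem_filter, Finset.mem_powerset] at hY hmax
  have hYham : ¬ (G Y).IsHamiltonian := fun h' => hham (h'.mono (hmono hY.1))
  refine ⟨Y, hY.1, by omega, hYham, ?_⟩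
  rw [Finset.disjoint_left]
  intro e heX heB
  have heG := (hset Y).notMem_of_mem_boosters hYham heB
  have hdiag := ((hset Y).host_of_mem_boosters heB).1
  have heY : e ∉ Y := fun heY => heG <| by
    rw [hG, SimpleGraph.edgeSet_sup, SimpleGraph.edgeSet_fromEdgeSet]
    exact Or.inr ⟨heY, hdiag⟩
  have hins : insert e Y ⊆ X := Finset.insert_subset heX hY.1
  have hprog := (hset Y).progress (hmono (Finset.subset_insert e Y)) heB
    (by rw [hG, SimpleGraph.edgeSet_sup, SimpleGraph.edgeSet_fromEdgeSet]
        exact Or.inr ⟨by simp, hdiag⟩)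
    (fun h' => hham (h'.mono (hmono hins)))
  have := hmax (insert e Y) ⟨hins, by rw [Finset.card_insert_of_notMem heY]; omega⟩
  rw [Finset.card_insert_of_notMem heY] at this
  omega

end RotationSetup

end HamiltonPath

/-! ### Independent bits: expectations, layers and exponential moments -/

namespace RandomSubset

variable {E : Type*} [Fintype E]

/-- The probability of the configuration `x` when the coordinates are independent and the
coordinate `e` is `true` with probability `w e`. -/
def weight (w : E → ℝ) (x : E → Bool) : ℝ := ∏ e, if x e = true then w e else 1 - w e

/-- The expectation with respect to `weight w`. -/
def expect [DecidableEq E] (w : E → ℝ) (g : (E → Bool) → ℝ) : ℝ := ∑ x, weight w x * g x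

open Classical in
/-- The probability with respect to `weight w`. -/
noncomputable def prob [DecidableEq E] (w : E → ℝ) (P : (E → Bool) → Prop) : ℝ :=
  expect w fun x => if P x then 1 else 0

lemma weight_nonneg {w : E → ℝ} (h0 : ∀ e, 0 ≤ w e) (h1 : ∀ e, w e ≤ 1) (x : E → Bool) :
    0 ≤ weight w x := by
  refine Finset.prod_nonneg fun e _ => ?_
  split_ifs
  · exact h0 e
  · linarith [h1 e]

variable [DecidableEq E] {w w₁ w₂ : E → ℝ}

lemma prob_eq (w : E → ℝ) (P : (E → Bool) → Prop) [DecidablePred P] :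
    prob w P = expect w fun x => if P x then 1 else 0 := by
  rw [prob]; congr 1; ext x; congr

lemma expect_prod (w : E → ℝ) (g : E → Bool → ℝ) :
    expect w (fun x => ∏ e, g e (x e)) =
      ∏ e, (w e * g e true + (1 - w e) * g e false) := by
  have h := Finset.prod_univ_sum (fun _ : E => (Finset.univ : Finset Bool))
    (fun e b => (if b = true then w e else 1 - w e) * g e b)
  simp only [Fintype.sum_bool, if_true, Bool.false_eq_true, if_false,
    Fintype.piFinset_univ] at h
  rw [h, expect]
  exact Finset.sum_congr rfl fun x _ => by rw [weight, Finset.prod_mul_distrib]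

lemma expect_prod_mul_prod (w : E → ℝ) {s t : Finset E} (hst : Disjoint s t)
    (g h : E → Bool → ℝ) :
    expect w (fun x => (∏ e ∈ s, g e (x e)) * ∏ e ∈ t, h e (x e)) =
      (∏ e ∈ s, (w e * g e true + (1 - w e) * g e false)) *
        ∏ e ∈ t, (w e * h e true + (1 - w e) * h e false) := by
  have key := expect_prod w fun e b =>
    (if e ∈ s then g e b else 1) * (if e ∈ t then h e b else 1)
  have e1 : ∀ x : E → Bool, (∏ e, (if e ∈ s then g e (x e) else 1) *
      (if e ∈ t then h e (x e) else 1)) = (∏ e ∈ s, g e (x e)) * ∏ e ∈ t, h e (x e) := by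
    intro x
    rw [Finset.prod_mul_distrib, Finset.prod_ite_mem, Finset.prod_ite_mem,
      Finset.univ_inter, Finset.univ_inter]
  simp only [e1] at key
  rw [key, ← Finset.univ_inter s, ← Finset.univ_inter t, ← Finset.prod_ite_mem,
    ← Finset.prod_ite_mem, ← Finset.prod_mul_distrib]
  simp only [Finset.univ_inter]
  refine Finset.prod_congr rfl fun e _ => ?_
  by_cases hs : e ∈ s
  · have : e ∉ t := Finset.disjoint_left.1 hst hs
    simp [hs, this]
  · by_cases ht : e ∈ t <;> simp [hs, ht]

lemma expect_prod_finset (w : E → ℝ) (s : Finset E) (g : E → Bool → ℝ) :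
    expect w (fun x => ∏ e ∈ s, g e (x e)) =
      ∏ e ∈ s, (w e * g e true + (1 - w e) * g e false) := by
  simpa using expect_prod_mul_prod w (Finset.disjoint_empty_right s) g g

lemma expect_add (w : E → ℝ) (g h : (E → Bool) → ℝ) :
    expect w (fun x => g x + h x) = expect w g + expect w h := by
  simp [expect, mul_add, Finset.sum_add_distrib]

lemma expect_const_mul (w : E → ℝ) (c : ℝ) (g : (E → Bool) → ℝ) :
    expect w (fun x => c * g x) = c * expect w g := by
  rw [expect, expect, Finset.mul_sum]
  exact Finset.sum_congr rfl fun x _ => by ring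

lemma expect_sum {ι : Type*} (w : E → ℝ) (s : Finset ι) (g : ι → (E → Bool) → ℝ) :
    expect w (fun x => ∑ i ∈ s, g i x) = ∑ i ∈ s, expect w (g i) := by
  simp only [expect, Finset.mul_sum]
  exact Finset.sum_comm

lemma expect_one (w : E → ℝ) : expect w (fun _ => 1) = 1 := by
  simpa using expect_prod w fun _ _ => 1

lemma expect_const (w : E → ℝ) (c : ℝ) : expect w (fun _ => c) = c := by
  simpa [expect_one] using expect_const_mul w c fun _ => 1

lemma expect_mono (h0 : ∀ e, 0 ≤ w e) (h1 : ∀ e, w e ≤ 1) {g h : (E → Bool) → ℝ}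
    (hgh : ∀ x, g x ≤ h x) : expect w g ≤ expect w h :=
  Finset.sum_le_sum fun x _ => mul_le_mul_of_nonneg_left (hgh x) (weight_nonneg h0 h1 x)

lemma prob_le_expect (h0 : ∀ e, 0 ≤ w e) (h1 : ∀ e, w e ≤ 1) {P : (E → Bool) → Prop}
    {g : (E → Bool) → ℝ} (hg : ∀ x, 0 ≤ g x) (hP : ∀ x, P x → 1 ≤ g x) :
    prob w P ≤ expect w g := by
  refine expect_mono h0 h1 fun x => ?_
  split_ifs with h
  · exact hP x h
  · exact hg x

lemma prob_mono (h0 : ∀ e, 0 ≤ w e) (h1 : ∀ e, w e ≤ 1) {P Q : (E → Bool) → Prop}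
    (h : ∀ x, P x → Q x) : prob w P ≤ prob w Q := by
  refine expect_mono h0 h1 fun x => ?_
  by_cases hP : P x
  · simp [hP, h x hP]
  · simp only [hP, if_false]; split_ifs <;> norm_num

lemma prob_nonneg (h0 : ∀ e, 0 ≤ w e) (h1 : ∀ e, w e ≤ 1) (P : (E → Bool) → Prop) :
    0 ≤ prob w P :=
  Finset.sum_nonneg fun x _ => mul_nonneg (weight_nonneg h0 h1 x) (by dsimp only; split_ifs <;> norm_num)

lemma prob_not (w : E → ℝ) (P : (E → Bool) → Prop) : prob w (fun x => ¬ P x) = 1 - prob w P := by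
  classical
  rw [eq_sub_iff_add_eq, prob_eq, prob_eq, ← expect_add]
  refine Eq.trans ?_ (expect_one w)
  congr 1; ext x
  by_cases h : P x
  · simp only [h, not_true_eq_false, if_true, if_false, zero_add]
  · simp only [h, not_false_eq_true, if_true, if_false, add_zero]

lemma prob_le_one (h0 : ∀ e, 0 ≤ w e) (h1 : ∀ e, w e ≤ 1) (P : (E → Bool) → Prop) :
    prob w P ≤ 1 := by
  have := prob_nonneg h0 h1 fun x => ¬ P x
  rw [prob_not] at this; linarith

lemma prob_or_le (h0 : ∀ e, 0 ≤ w e) (h1 : ∀ e, w e ≤ 1) (P Q : (E → Bool) → Prop) :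
    prob w (fun x => P x ∨ Q x) ≤ prob w P + prob w Q := by
  rw [prob, prob, prob, ← expect_add]
  refine expect_mono h0 h1 fun x => ?_
  by_cases hP : P x <;> by_cases hQ : Q x <;> simp [hP, hQ]

lemma prob_exists_le {ι : Type*} (h0 : ∀ e, 0 ≤ w e) (h1 : ∀ e, w e ≤ 1) (s : Finset ι)
    (P : ι → (E → Bool) → Prop) :
    prob w (fun x => ∃ i ∈ s, P i x) ≤ ∑ i ∈ s, prob w (P i) := by
  classical
  simp only [prob]
  rw [← expect_sum]
  refine expect_mono h0 h1 fun x => ?_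
  split_ifs with h
  · obtain ⟨i, hi, hP⟩ := h
    calc (1 : ℝ) = if P i x then 1 else 0 := by simp [hP]
      _ ≤ _ := Finset.single_le_sum (f := fun i => if P i x then (1 : ℝ) else 0)
        (fun j _ => by positivity) hi
  · exact Finset.sum_nonneg fun j _ => by positivity

/-- The union of two independent random sets is again a random set with independent coordinates, and
`1 - w = (1 - w₁)(1 - w₂)` in each coordinate. -/
lemma expect_sup (w₁ w₂ : E → ℝ) (g : (E → Bool) → ℝ) :
    expect w₁ (fun x => expect w₂ fun y => g (x ⊔ y)) =
      expect (fun e => w₁ e + w₂ e - w₁ e * w₂ e) g := by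
  classical
  have hw : ∀ z : E → Bool, (∑ x, ∑ y, if x ⊔ y = z then weight w₁ x * weight w₂ y else 0) =
      weight (fun e => w₁ e + w₂ e - w₁ e * w₂ e) z := by
    intro z
    have h := Finset.prod_univ_sum (fun _ : E => (Finset.univ : Finset (Bool × Bool)))
      (fun e b => if b.1 ⊔ b.2 = z e then
        (if b.1 = true then w₁ e else 1 - w₁ e) * (if b.2 = true then w₂ e else 1 - w₂ e) else 0)
    rw [Fintype.piFinset_univ] at h
    rw [weight]
    calc _ = ∑ p : (E → Bool) × (E → Bool),
          if p.1 ⊔ p.2 = z then weight w₁ p.1 * weight w₂ p.2 else 0 := by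
          rw [Fintype.sum_prod_type]
      _ = ∑ p : E → Bool × Bool, ∏ e, (if (p e).1 ⊔ (p e).2 = z e then
            (if (p e).1 = true then w₁ e else 1 - w₁ e) *
              (if (p e).2 = true then w₂ e else 1 - w₂ e) else 0) := by
          refine (Fintype.sum_equiv (Equiv.arrowProdEquivProdArrow E (fun _ => Bool)
            (fun _ => Bool)) _ _ fun p => ?_).symm
          set P := Equiv.arrowProdEquivProdArrow E (fun _ => Bool) (fun _ => Bool) p with hP
          have hp : ∀ e, p e = (P.1 e, P.2 e) := fun e => rfl
          simp only [hp]
          by_cases hz : P.1 ⊔ P.2 = z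
          · rw [if_pos hz, weight, weight, ← Finset.prod_mul_distrib]
            refine Finset.prod_congr rfl fun e _ => ?_
            rw [if_pos]
            exact congrFun hz e
          · have : ∃ e, ¬ (P.1 e ⊔ P.2 e = z e) := by
              by_contra! hcon
              exact hz (funext hcon)
            obtain ⟨e, he⟩ := this
            rw [if_neg hz]
            refine Finset.prod_eq_zero (Finset.mem_univ e) ?_
            rw [if_neg he]
      _ = _ := by
          rw [← h]
          refine Finset.prod_congr rfl fun e _ => ?_
          rw [Fintype.sum_prod_type]
          cases z e <;> simp <;> ring
  have e1 : expect w₁ (fun x => expect w₂ fun y => g (x ⊔ y)) =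
      ∑ x, ∑ y, ∑ z, (if x ⊔ y = z then weight w₁ x * weight w₂ y else 0) * g z := by
    simp only [expect, Finset.mul_sum]
    refine Finset.sum_congr rfl fun x _ => Finset.sum_congr rfl fun y _ => ?_
    simp [mul_assoc]
  rw [e1]
  calc _ = ∑ z, ∑ x, ∑ y, (if x ⊔ y = z then weight w₁ x * weight w₂ y else 0) * g z := by
        rw [Finset.sum_comm' (t' := Finset.univ) (s' := fun _ => Finset.univ) (by simp)]
        conv_rhs => rw [Finset.sum_comm]
        rw [Finset.sum_comm]
        exact Finset.sum_congr rfl fun x _ => Finset.sum_comm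
    _ = _ := by
        rw [expect]
        refine Finset.sum_congr rfl fun z _ => ?_
        rw [← hw z, Finset.sum_mul]
        exact Finset.sum_congr rfl fun x _ => by rw [Finset.sum_mul]

lemma prob_congr (w : E → ℝ) {P Q : (E → Bool) → Prop} (h : ∀ x, P x ↔ Q x) :
    prob w P = prob w Q := by
  congr 1; ext x; exact h x

/-- Probabilities of increasing events increase with the weights. -/
lemma prob_mono_weight (h0 : ∀ e, 0 ≤ w₁ e) (hle : ∀ e, w₁ e ≤ w₂ e) (h1 : ∀ e, w₂ e ≤ 1)
    {P : (E → Bool) → Prop} (hP : Monotone P) : prob w₁ P ≤ prob w₂ P := by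
  classical
  -- The weight of the additional layer that raises `w₁` to `w₂`. Where `w₁ e = 1` the division by
  -- zero gives `0`, which is right because then `w₂ e = 1`.
  set u : E → ℝ := fun e => (w₂ e - w₁ e) / (1 - w₁ e) with hu
  have hsum : (fun e => w₁ e + u e - w₁ e * u e) = w₂ := by
    ext e
    by_cases h : w₁ e = 1
    · have : w₂ e = 1 := le_antisymm (h1 e) (h ▸ hle e)
      simp [hu, h, this]
    · have : 1 - w₁ e ≠ 0 := fun h' => h (by linarith)
      simp only [hu]; field_simp; ring
  have hu0 : ∀ e, 0 ≤ u e := fun e =>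
    div_nonneg (by linarith [hle e]) (by linarith [hle e, h1 e])
  have hu1 : ∀ e, u e ≤ 1 := fun e =>
    div_le_one_of_le₀ (by linarith [h1 e]) (by linarith [hle e, h1 e])
  have hs := expect_sup w₁ u fun x => if P x then 1 else 0
  rw [hsum] at hs
  rw [prob, prob, ← hs]
  refine expect_mono h0 (fun e => (hle e).trans (h1 e)) fun x => ?_
  split_ifs with hx
  · refine (expect_one u).ge.trans (expect_mono hu0 hu1 fun y => ?_)
    have : P (x ⊔ y) := hP le_sup_left hx
    rw [if_pos this]
  · exact prob_nonneg hu0 hu1 _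

/-- Two-round exposure. -/
lemma prob_not_le_of_two_layers (h0₁ : ∀ e, 0 ≤ w₁ e) (h0₂ : ∀ e, 0 ≤ w₂ e)
    (hle : ∀ e, w₁ e + w₂ e ≤ w e) (h1 : ∀ e, w e ≤ 1) {P Q : (E → Bool) → Prop}
    (hP : Monotone P) {ε₁ ε₂ : ℝ} (hε : 0 ≤ ε₂) (hQ : prob w₁ (fun x => ¬ Q x) ≤ ε₁)
    (hQP : ∀ x, Q x → prob w₂ (fun y => ¬ P (x ⊔ y)) ≤ ε₂) :
    prob w (fun x => ¬ P x) ≤ ε₁ + ε₂ := by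
  classical
  have h1₁ : ∀ e, w₁ e ≤ 1 := fun e => by linarith [h0₂ e, hle e, h1 e]
  have h1₂ : ∀ e, w₂ e ≤ 1 := fun e => by linarith [h0₁ e, hle e, h1 e]
  have hmono := prob_mono_weight (w₁ := fun e => w₁ e + w₂ e - w₁ e * w₂ e) (w₂ := w)
    (fun e => by nlinarith [h0₁ e, h0₂ e, h1₁ e, h1₂ e])
    (fun e => by nlinarith [h0₁ e, h0₂ e, hle e]) h1 hP
  have hs := expect_sup w₁ w₂ fun x => if ¬ P x then 1 else 0
  have h2 : prob (fun e => w₁ e + w₂ e - w₁ e * w₂ e) (fun x => ¬ P x) ≤ ε₁ + ε₂ := by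
    rw [prob_eq] at hQ
    calc _ = expect w₁ fun x => prob w₂ fun y => ¬ P (x ⊔ y) := by
          simp only [prob_eq]; exact hs.symm
      _ ≤ expect w₁ fun x => (if ¬ Q x then 1 else 0) + ε₂ := by
          refine expect_mono h0₁ h1₁ fun x => ?_
          by_cases hx : Q x
          · simpa [hx] using hQP x hx
          · simp only [hx, not_false_eq_true, if_true]
            linarith [prob_le_one h0₂ h1₂ fun y => ¬ P (x ⊔ y)]
      _ ≤ _ := by rw [expect_add, expect_const]; exact add_le_add_left hQ _
  rw [prob_not] at h2 ⊢
  linarith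

lemma one_sub_mul_le_exp (a y : ℝ) : a * y + (1 - a) * 1 ≤ Real.exp (-((1 - y) * a)) := by
  have := Real.add_one_le_exp (-((1 - y) * a))
  linarith

/-- All elements of `s` are present, and a product of factors over `t`. -/
lemma expect_present_mul_prod_le (h0 : ∀ e, 0 ≤ w e) (h1 : ∀ e, w e ≤ 1) {s t : Finset E}
    (hst : Disjoint s t) (y : E → ℝ) (hy : ∀ e ∈ t, 0 ≤ y e) :
    expect w (fun x => (∏ e ∈ s, if x e = true then 1 else 0) *
        ∏ e ∈ t, if x e = true then y e else 1) ≤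
      (∏ e ∈ s, w e) * Real.exp (-∑ e ∈ t, (1 - y e) * w e) := by
  rw [expect_prod_mul_prod w hst (fun _ b => if b = true then 1 else 0)
    (fun e b => if b = true then y e else 1), ← Finset.sum_neg_distrib, Real.exp_sum]
  have e1 : ∀ e ∈ s, w e * (if true = true then 1 else 0) +
      (1 - w e) * (if false = true then 1 else 0) = w e := fun e _ => by simp
  rw [Finset.prod_congr rfl e1]
  refine mul_le_mul_of_nonneg_left ?_ (Finset.prod_nonneg fun e _ => h0 e)
  refine Finset.prod_le_prod (fun e he => ?_) fun e he => ?_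
  · have := h0 e; have := h1 e; have := hy e he
    simp only [if_true, Bool.false_eq_true, if_false]
    have := mul_nonneg (h0 e) (hy e he)
    linarith
  · simpa using one_sub_mul_le_exp (w e) (y e)

/-- Upper tail of the number of elements of `t` that are present. -/
lemma prob_le_card_le (h0 : ∀ e, 0 ≤ w e) (h1 : ∀ e, w e ≤ 1) (t : Finset E) {z : ℝ}
    (hz : 1 ≤ z) {a : ℝ} :
    prob w (fun x => a ≤ ((t.filter fun e => x e = true).card : ℝ)) ≤
      z ^ (-a) * Real.exp ((z - 1) * ∑ e ∈ t, w e) := by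
  have hz0 : 0 < z := by linarith
  have h := expect_present_mul_prod_le h0 h1 (Finset.disjoint_empty_left t) (fun _ => z)
    fun _ _ => hz0.le
  simp only [Finset.prod_empty, one_mul] at h
  rw [← Finset.mul_sum, ← neg_mul, neg_sub] at h
  calc _ ≤ expect w fun x => z ^ (-a) * ∏ e ∈ t, if x e = true then z else 1 := by
        refine prob_le_expect h0 h1 (fun x => ?_) fun x hx => ?_
        · refine mul_nonneg (Real.rpow_nonneg hz0.le _) (Finset.prod_nonneg fun e _ => ?_)
          split_ifs <;> linarith
        · rw [Finset.prod_ite, Finset.prod_const, Finset.prod_const_one, mul_one,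
            ← Real.rpow_natCast, ← Real.rpow_add hz0]
          exact Real.one_le_rpow hz (by linarith)
    _ ≤ _ := by
        rw [expect_const_mul]
        exact mul_le_mul_of_nonneg_left h (Real.rpow_nonneg hz0.le _)

/-- All elements of `s` are present and those of `t` are absent. -/
lemma prob_present_absent_le (h0 : ∀ e, 0 ≤ w e) (h1 : ∀ e, w e ≤ 1) {s t : Finset E}
    (hst : Disjoint s t) :
    prob w (fun x => (∀ e ∈ s, x e = true) ∧ ∀ e ∈ t, x e = false) ≤
      (∏ e ∈ s, w e) * Real.exp (-∑ e ∈ t, w e) := by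
  have h := expect_present_mul_prod_le h0 h1 hst (fun _ => 0) fun _ _ => le_rfl
  simp only [sub_zero, one_mul] at h
  refine le_trans (prob_le_expect h0 h1 (fun x => ?_) fun x hx => ?_) h
  · refine mul_nonneg (Finset.prod_nonneg fun e _ => ?_) (Finset.prod_nonneg fun e _ => ?_) <;>
      split_ifs <;> norm_num
  · rw [Finset.prod_congr rfl fun e he => if_pos (hx.1 e he),
      Finset.prod_congr rfl fun e he => if_neg (by simp [hx.2 e he])]
    simp

end RandomSubset

/-! ### Sprinkling -/

namespace RandomSubset

open HamiltonPath

open Classical in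
/-- The weights that give probability `r` to the pairs of distinct vertices at which `pairSum f`
vanishes. -/
noncomputable def hostWeight {V A : Type*} [AddCommGroup A] (f : V → A) (r : ℝ) (e : Sym2 V) : ℝ :=
  if ¬ e.IsDiag ∧ pairSum f e = 0 then r else 0

lemma hostWeight_of {V A : Type*} [AddCommGroup A] {f : V → A} {r : ℝ} {e : Sym2 V}
    (h : ¬ e.IsDiag ∧ pairSum f e = 0) : hostWeight f r e = r := if_pos h

lemma hostWeight_nonneg {V A : Type*} [AddCommGroup A] {f : V → A} {r : ℝ} (hr : 0 ≤ r) (e : Sym2 V) : 0 ≤ hostWeight f r e := by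
  rw [hostWeight]; split_ifs <;> simp [hr]

lemma hostWeight_le {V A : Type*} [AddCommGroup A] {f : V → A} {r : ℝ} (hr : 0 ≤ r) (e : Sym2 V) : hostWeight f r e ≤ r := by
  rw [hostWeight]; split_ifs <;> simp [hr]

variable {V : Type*} [Fintype V] [DecidableEq V]

/-- The graph whose edges are the pairs selected by `x`. -/
def graph (x : Sym2 V → Bool) : SimpleGraph V := SimpleGraph.fromEdgeSet {e | x e = true}

omit [Fintype V] [DecidableEq V] in
lemma graph_adj {x : Sym2 V → Bool} {u v : V} :
    (graph x).Adj u v ↔ x s(u, v) = true ∧ u ≠ v := by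
  simp [graph]

omit [Fintype V] [DecidableEq V] in
lemma graph_mono : Monotone (graph : (Sym2 V → Bool) → SimpleGraph V) := fun x y hxy =>
  SimpleGraph.fromEdgeSet_mono fun e (he : x e = true) => by
    have := hxy e
    rw [he] at this
    exact top_le_iff.1 this

omit [Fintype V] [DecidableEq V] in
lemma graph_sup (x y : Sym2 V → Bool) : graph (x ⊔ y) = graph x ⊔ graph y := by
  ext u v
  simp only [graph_adj, SimpleGraph.sup_adj, Pi.sup_apply]
  rw [← or_and_right]
  cases x s(u, v) <;> cases y s(u, v) <;> simp

lemma monotone_isHamiltonian : Monotone fun x : Sym2 V → Bool => (graph x).IsHamiltonian :=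
  fun _ _ h h' => h'.mono (graph_mono h)

/-- Since `y ≤ 1` and `Y.card ≤ N`, the term is at most `y⁻¹ ^ N * (r * y) ^ Y.card`. After this
tilt the restriction on the size can be dropped and the binomial theorem applied. -/
lemma sum_pow_card_le (N : ℕ) {r y : ℝ} (hr : 0 ≤ r) (hy0 : 0 < y) (hy1 : y ≤ 1)
    {E : Type*} [Fintype E] [DecidableEq E] :
    ∑ Y : Finset E with Y.card ≤ N, r ^ Y.card ≤
      y⁻¹ ^ N * Real.exp (r * y * Fintype.card E) := by
  calc ∑ Y : Finset E with Y.card ≤ N, r ^ Y.card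
      ≤ ∑ Y : Finset E with Y.card ≤ N, y⁻¹ ^ N * (r * y) ^ Y.card := by
        refine Finset.sum_le_sum fun Y hY => ?_
        have hY' := (Finset.mem_filter.1 hY).2
        have h1 : 1 ≤ y⁻¹ := (one_le_inv₀ hy0).2 hy1
        calc r ^ Y.card = y⁻¹ ^ Y.card * (r * y) ^ Y.card := by
              rw [← mul_pow]; field_simp
          _ ≤ _ := by gcongr
    _ ≤ ∑ Y : Finset E, y⁻¹ ^ N * (r * y) ^ Y.card :=
        Finset.sum_le_sum_of_subset_of_nonneg (Finset.filter_subset _ _) fun _ _ _ => by positivity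
    _ = y⁻¹ ^ N * (1 + r * y) ^ Fintype.card E := by
        rw [← Finset.mul_sum]
        congr 1
        have := Finset.sum_pow_mul_eq_add_pow (r * y) 1 (Finset.univ : Finset E)
        rw [Finset.powerset_univ] at this
        simp only [one_pow, mul_one, Finset.card_univ] at this
        rw [this, add_comm]
    _ ≤ _ := by
        gcongr
        rw [mul_comm (r * y), Real.exp_nat_mul]
        gcongr
        rw [add_comm]
        exact Real.add_one_le_exp _

variable {A : Type*} [AddCommGroup A] {f : V → A} {M : Finset (Sym2 V)} {F D : Finset V}
  {l₀ : List V} {Γ : SimpleGraph V} {m : ℕ}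

/-- Sprinkling completes a Hamilton cycle. -/
theorem prob_not_isHamiltonian_le (h : RotationSetup f M F D l₀ m Γ) {C : ℝ} (hC : 1 ≤ C)
    (hCV : C ≤ Fintype.card V) :
    prob (hostWeight f (C / Fintype.card V))
        (fun x => ¬ (Γ ⊔ graph x).IsHamiltonian) ≤
      C ^ Fintype.card V *
        Real.exp (Fintype.card V - C * m ^ 2 / (2 * Fintype.card V)) := by
  classical
  set N := Fintype.card V with hN
  have hN0 : (0 : ℝ) < N := by linarith
  set r : ℝ := C / N with hr
  have hr0 : 0 ≤ r := by positivity
  have hr1 : r ≤ 1 := div_le_one_of_le₀ hCV hN0.le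
  have h0 : ∀ e, 0 ≤ hostWeight f r e := hostWeight_nonneg hr0
  have h1 : ∀ e, hostWeight f r e ≤ 1 := fun e => (hostWeight_le hr0 e).trans hr1
  let G : Finset (Sym2 V) → SimpleGraph V :=
    fun Y => Γ ⊔ SimpleGraph.fromEdgeSet (Y : Set (Sym2 V))
  have hset : ∀ Y, RotationSetup f M F D l₀ m (G Y) := fun Y => h.mono le_sup_left
  let 𝒴 : Finset (Finset (Sym2 V)) :=
    Finset.univ.filter fun Y => Y.card ≤ N ∧ ¬ (G Y).IsHamiltonian
  have hbound : ∀ Y ∈ 𝒴, prob (hostWeight f r) (fun x => (∀ e ∈ Y, x e = true) ∧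
      ∀ e ∈ boosters f M (G Y), x e = false) ≤
        r ^ Y.card * Real.exp (-(r * (m ^ 2 / 2))) := by
    intro Y hY
    have hYham := (Finset.mem_filter.1 hY).2.2
    have hdisj : Disjoint Y (boosters f M (G Y)) := by
      rw [Finset.disjoint_left]
      intro e heY heB
      refine (hset Y).notMem_of_mem_boosters hYham heB ?_
      rw [SimpleGraph.edgeSet_sup, SimpleGraph.edgeSet_fromEdgeSet]
      exact Or.inr ⟨heY, ((hset Y).host_of_mem_boosters heB).1⟩
    refine (prob_present_absent_le h0 h1 hdisj).trans ?_
    have hr' : ∏ e ∈ Y, hostWeight f r e ≤ r ^ Y.card :=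
      (Finset.prod_le_prod (fun e _ => h0 e) fun e _ => hostWeight_le hr0 e).trans_eq
        (Finset.prod_const r)
    refine mul_le_mul hr' (Real.exp_le_exp.2 (neg_le_neg ?_)) (Real.exp_pos _).le (by positivity)
    · have hB : ∑ e ∈ boosters f M (G Y), hostWeight f r e =
          (boosters f M (G Y)).card * r := by
        rw [Finset.sum_congr rfl fun e he => hostWeight_of ((hset Y).host_of_mem_boosters he)]
        simp
      have hcard : (m : ℝ) ^ 2 ≤ 2 * (boosters f M (G Y)).card := by
        exact_mod_cast (hset Y).card_boosters
      rw [hB, mul_comm r]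
      gcongr
      linarith
  -- Failure of the sprinkling is witnessed by a small set `Y` of selected edges such that all
  -- boosters of the graph with `Y` added are unselected. The union bound over `Y` replaces an
  -- exposure of edges one at a time.
  calc _ ≤ prob (hostWeight f r) (fun x => ∃ Y ∈ 𝒴, (∀ e ∈ Y, x e = true) ∧
        ∀ e ∈ boosters f M (G Y), x e = false) := by
        refine prob_mono h0 h1 fun x hx => ?_
        have hX : graph x = SimpleGraph.fromEdgeSet
            ((Finset.univ.filter fun e => x e = true : Finset (Sym2 V)) : Set (Sym2 V)) := by
          simp [graph]
        rw [hX] at hx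
        obtain ⟨Y, hYX, hYN, hYham, hdisj⟩ := h.exists_missed_boosters hx
        refine ⟨Y, by simp [𝒴, G, hYN, hYham, hN], fun e he => by simpa using hYX he,
          fun e he => ?_⟩
        have := Finset.disjoint_right.1 hdisj he
        simpa using this
    _ ≤ ∑ Y ∈ 𝒴, r ^ Y.card * Real.exp (-(r * (m ^ 2 / 2))) :=
        (prob_exists_le h0 h1 _ _).trans (Finset.sum_le_sum hbound)
    _ ≤ ∑ Y : Finset (Sym2 V) with Y.card ≤ N, r ^ Y.card * Real.exp (-(r * (m ^ 2 / 2))) := by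
        refine Finset.sum_le_sum_of_subset_of_nonneg (fun Y hY => ?_) fun _ _ _ => by positivity
        simp only [𝒴, Finset.mem_filter] at hY ⊢
        exact ⟨hY.1, hY.2.1⟩
    -- The tilt `y = C⁻¹` makes `r * y = 1 / N`, so that the exponential factor is at most `exp N`.
    _ ≤ (C⁻¹⁻¹ ^ N * Real.exp (r * C⁻¹ * Fintype.card (Sym2 V))) *
          Real.exp (-(r * (m ^ 2 / 2))) := by
        rw [← Finset.sum_mul]
        gcongr
        exact sum_pow_card_le N hr0 (by positivity) (inv_le_one_of_one_le₀ hC)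
    _ ≤ _ := by
        rw [inv_inv, mul_assoc, ← Real.exp_add]
        gcongr
        have hsym : (Fintype.card (Sym2 V) : ℝ) ≤ N * N := by
          rw [Sym2.card, ← hN]
          have : (N + 1).choose 2 ≤ N * N := by
            rw [Nat.choose_two_right, Nat.add_sub_cancel]
            apply Nat.div_le_of_le_mul
            nlinarith [Fintype.card_pos_iff.2 (Fintype.card_pos_iff.1 (by exact_mod_cast hN0 : 0 < N))]
          exact_mod_cast this
        have e1 : r * C⁻¹ * Fintype.card (Sym2 V) ≤ N := by
          have : r * C⁻¹ = 1 / N := by rw [hr]; field_simp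
          rw [this]
          calc 1 / (N : ℝ) * _ ≤ 1 / N * (N * N) := by gcongr
            _ = N := by field_simp
        have e2 : r * (m ^ 2 / 2) = C * m ^ 2 / (2 * N) := by rw [hr]; field_simp
        rw [e2]; linarith

end RandomSubset

/-! ### Typical structure: degrees, clusters of low-degree vertices, sparse small sets -/

namespace RandomSubset

variable {V : Type*} [Fintype V] [DecidableEq V]

/-- The number of pairs `s(v, u)` with `u ∈ Z` that are selected by `x`. -/
def degreeTo (x : Sym2 V → Bool) (Z : Finset V) (v : V) : ℕ :=
  (Z.filter fun u => x s(v, u) = true).card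

/-- Exponential Markov inequality with parameter `τ`. Only pairs leaving `C` are counted: they are
distinct for distinct vertices of `S` and are not in `E₀`, so all factors are independent. -/
lemma prob_cluster_le_aux {w : Sym2 V → ℝ} (h0 : ∀ e, 0 ≤ w e) (h1 : ∀ e, w e ≤ 1)
    {C S : Finset V} (hSC : S ⊆ C) {E₀ : Finset (Sym2 V)} (hE₀ : ∀ e ∈ E₀, ∀ v ∈ e, v ∈ C)
    (Z : V → Finset V) {a τ : ℝ} (hτ : 0 ≤ τ) :
    prob w (fun x => (∀ e ∈ E₀, x e = true) ∧ ∀ s ∈ S, (degreeTo x (Z s) s : ℝ) ≤ a) ≤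
      Real.exp (S.card * (τ * a)) * ((∏ e ∈ E₀, w e) *
        Real.exp (-∑ s ∈ S, ∑ u ∈ Z s \ C, (1 - Real.exp (-τ)) * w s(s, u))) := by
  classical
  set D : Finset (Sym2 V) := S.biUnion fun s => (Z s \ C).image fun u => s(s, u) with hD
  have hdisj : Disjoint E₀ D := by
    rw [Finset.disjoint_left]
    intro e he heD
    obtain ⟨s, hs, hes⟩ := Finset.mem_biUnion.1 heD
    obtain ⟨u, hu, rfl⟩ := Finset.mem_image.1 hes
    exact (Finset.mem_sdiff.1 hu).2 (hE₀ _ he u (Sym2.mem_mk_right _ _))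
  have hsum : ∑ e ∈ D, (1 - Real.exp (-τ)) * w e =
      ∑ s ∈ S, ∑ u ∈ Z s \ C, (1 - Real.exp (-τ)) * w s(s, u) := by
    rw [hD, Finset.sum_biUnion]
    · refine Finset.sum_congr rfl fun s _ => Finset.sum_image fun u _ u' _ h => ?_
      exact Sym2.congr_right.1 h
    · intro s hs s' hs' hne
      refine Finset.disjoint_left.2 fun e he he' => ?_
      obtain ⟨u, hu, rfl⟩ := Finset.mem_image.1 he
      obtain ⟨u', hu', h⟩ := Finset.mem_image.1 he'
      rw [Sym2.eq_iff] at h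
      rcases h with h | h
      · exact hne h.1.symm
      · exact (Finset.mem_sdiff.1 hu).2 (h.1 ▸ hSC hs')
  have h := expect_present_mul_prod_le h0 h1 hdisj (fun _ => Real.exp (-τ))
    fun _ _ => (Real.exp_pos _).le
  rw [hsum] at h
  calc _ ≤ expect w fun x => Real.exp (S.card * (τ * a)) *
        ((∏ e ∈ E₀, if x e = true then 1 else 0) *
          ∏ e ∈ D, if x e = true then Real.exp (-τ) else 1) := by
        refine prob_le_expect h0 h1 (fun x => ?_) fun x hx => ?_
        · refine mul_nonneg (Real.exp_pos _).le (mul_nonneg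
            (Finset.prod_nonneg fun e _ => ?_) (Finset.prod_nonneg fun e _ => ?_)) <;>
            split_ifs <;> positivity
        · rw [Finset.prod_congr rfl fun e he => if_pos (hx.1 e he), Finset.prod_const_one,
            one_mul, Finset.prod_ite, Finset.prod_const, Finset.prod_const_one, mul_one,
            ← Real.exp_nat_mul, ← Real.exp_add]
          refine Real.one_le_exp ?_
          have hcard : ((D.filter fun e => x e = true).card : ℝ) ≤ S.card * a := by
            calc ((D.filter fun e => x e = true).card : ℝ)
                ≤ ∑ s ∈ S, (degreeTo x (Z s) s : ℝ) := by
                  have : (D.filter fun e => x e = true).card ≤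
                      ∑ s ∈ S, degreeTo x (Z s) s := by
                    rw [hD, Finset.filter_biUnion]
                    refine Finset.card_biUnion_le.trans (Finset.sum_le_sum fun s _ => ?_)
                    rw [Finset.filter_image]
                    refine Finset.card_image_le.trans (Finset.card_le_card ?_)
                    exact Finset.filter_subset_filter _ Finset.sdiff_subset
                  exact_mod_cast this
              _ ≤ ∑ _s ∈ S, a := Finset.sum_le_sum fun s hs => hx.2 s hs
              _ = _ := by simp
          nlinarith
    _ ≤ _ := by
        rw [expect_const_mul]
        exact mul_le_mul_of_nonneg_left h (Real.exp_pos _).le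

/-- The pairs of `E₀`, inside a small set `C`, are selected and the vertices of `S` have small
degrees. -/
lemma prob_cluster_le {w : Sym2 V → ℝ} (h0 : ∀ e, 0 ≤ w e) (h1 : ∀ e, w e ≤ 1) {κ : ℝ}
    (hκ : ∀ e, w e ≤ κ) {C S : Finset V} (hSC : S ⊆ C) {E₀ : Finset (Sym2 V)}
    (hE₀ : ∀ e ∈ E₀, ∀ v ∈ e, v ∈ C) (Z : V → Finset V) {a τ : ℝ} (hτ : 0 ≤ τ) {μ : V → ℝ}
    (hμ : ∀ s ∈ S, μ s ≤ ∑ u ∈ Z s, w s(s, u)) :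
    prob w (fun x => (∀ e ∈ E₀, x e = true) ∧ ∀ s ∈ S, (degreeTo x (Z s) s : ℝ) ≤ a) ≤
      κ ^ E₀.card * Real.exp (S.card * (τ * a) - (1 - Real.exp (-τ)) * ∑ s ∈ S, μ s +
        S.card * (C.card * κ)) := by
  refine (prob_cluster_le_aux h0 h1 hSC hE₀ Z hτ).trans ?_
  have hprod : ∏ e ∈ E₀, w e ≤ κ ^ E₀.card :=
    (Finset.prod_le_prod (fun e _ => h0 e) fun e _ => hκ e).trans_eq (Finset.prod_const κ)
  rw [mul_left_comm, ← Real.exp_add]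
  refine mul_le_mul hprod (Real.exp_le_exp.2 ?_) (Real.exp_pos _).le
    ((Finset.prod_nonneg fun e _ => h0 e).trans hprod)
  have hτ1 : Real.exp (-τ) ≤ 1 := Real.exp_le_one_iff.2 (by linarith)
  have hτ0 : 0 ≤ 1 - Real.exp (-τ) := by linarith
  have hs : ∀ s ∈ S, (1 - Real.exp (-τ)) * μ s - C.card * κ ≤
      ∑ u ∈ Z s \ C, (1 - Real.exp (-τ)) * w s(s, u) := by
    intro s hs
    -- Ignoring the pairs into `C` lowers the mean by at most `C.card * κ`.
    have e1 : ∑ u ∈ Z s, w s(s, u) ≤ ∑ u ∈ Z s \ C, w s(s, u) + C.card * κ := by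
      rw [← Finset.sum_sdiff (Finset.inter_subset_left : Z s ∩ C ⊆ Z s),
        Finset.sdiff_inter_self_left]
      refine add_le_add_right ?_ _
      calc ∑ u ∈ Z s ∩ C, w s(s, u) ≤ ∑ u ∈ C, w s(s, u) :=
            Finset.sum_le_sum_of_subset_of_nonneg Finset.inter_subset_right fun _ _ _ => h0 _
        _ ≤ ∑ _u ∈ C, κ := Finset.sum_le_sum fun _ _ => hκ _
        _ = _ := by simp
    rw [← Finset.mul_sum]
    have hc : 0 ≤ C.card * κ := by
      rcases Finset.eq_empty_or_nonempty C with hC | ⟨c, _⟩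
      · simp [hC]
      · exact mul_nonneg (Nat.cast_nonneg _) ((h0 s(c, c)).trans (hκ _))
    have := hμ s hs
    have hexp := Real.exp_pos (-τ)
    nlinarith
  have := Finset.sum_le_sum hs
  rw [Finset.sum_sub_distrib, ← Finset.mul_sum, Finset.sum_const, nsmul_eq_mul] at this
  linarith

/-- The vertex `v` has at most `a` selected pairs to its test set. -/
def Atypical (Y : V → Finset V) (a : ℝ) (x : Sym2 V → Bool) (v : V) : Prop :=
  (degreeTo x (Y v) v : ℝ) ≤ a

/-- The vertex `v` has degree at most `a`. -/
def Tiny (a : ℝ) (x : Sym2 V → Bool) (v : V) : Prop :=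
  (degreeTo x (Finset.univ.erase v) v : ℝ) ≤ a

open Classical in
/-- The properties of the random graph that are used to build the forced paths and to establish
expansion. -/
structure Typical (Y : V → Finset V) (a b t ρ : ℝ) (D : ℕ) (x : Sym2 V → Bool) : Prop where
  two_le_degree : ∀ v, 2 ≤ degreeTo x (Finset.univ.erase v) v
  tiny_adj : ∀ s s', s ≠ s' → Tiny a x s → Atypical Y a x s' → x s(s, s') = false
  tiny_dist : ∀ s u s', s ≠ u → u ≠ s' → s ≠ s' → Tiny a x s → Atypical Y a x s' →
    x s(s, u) = true → x s(u, s') = false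
  few_adj : ∀ v, ∀ T : Finset V, v ∉ T → T.card = D →
    ∃ s ∈ T, Atypical Y a x s → x s(v, s) = false
  few_dist : ∀ v, ∀ g : Fin D ⊕ Fin D → V, g.Injective → (∀ i, g i ≠ v) →
    ∃ i, x s(v, g (.inl i)) = true → x s(g (.inl i), g (.inr i)) = true →
      ¬ Atypical Y a x (g (.inr i))
  sparse : ∀ T : Finset V, T.Nonempty → (T.card : ℝ) ≤ t →
    ((T.sym2.filter fun e => x e = true).card : ℝ) < b * T.card
  few_atypical : ((Finset.univ.filter fun v => Atypical Y a x v).card : ℝ) ≤ ρ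

section estimates

variable {w : Sym2 V → ℝ} {Y : V → Finset V} {κ γ τ L a W : ℝ}

/-- For one vertex the parameter `τ = log L` gives the exponent `log L - (1 - 1 / L)(L + log L + W)`
up to a bounded error, which is at most `-L + 3 - W / 2`. The factor `exp (-L) = 1 / N` pays for the
union bound over the vertices. -/
lemma prob_degree_lt_two (h0 : ∀ e, 0 ≤ w e) (h1 : ∀ e, w e ≤ 1) (hκ : ∀ e, w e ≤ κ)
    (hκ1 : κ ≤ 1) (hL : 2 ≤ L) (hLN : Real.exp L = Fintype.card V) (hW : 0 ≤ W)
    (hdeg : ∀ v, L + Real.log L + W ≤ ∑ u ∈ Finset.univ.erase v, w s(v, u)) :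
    prob w (fun x => ∃ v ∈ (Finset.univ : Finset V), degreeTo x (Finset.univ.erase v) v < 2) ≤
      Real.exp (3 - W / 2) := by
  have hv : ∀ v ∈ (Finset.univ : Finset V),
      prob w (fun x => degreeTo x (Finset.univ.erase v) v < 2) ≤
        Real.exp (-L) * Real.exp (3 - W / 2) := by
    intro v _
    have hL0 : 0 < L := by linarith
    have hlog0 : 0 ≤ Real.log L := Real.log_nonneg (by linarith)
    have h := prob_cluster_le h0 h1 hκ (C := {v}) (S := {v}) subset_rfl (E₀ := ∅) (by simp)
      (fun v => Finset.univ.erase v) (a := 1) (τ := Real.log L) hlog0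
      (μ := fun _ => L + Real.log L + W) (fun s _ => hdeg s)
    refine (prob_mono h0 h1 fun x hx => ?_).trans (h.trans ?_)
    · refine ⟨by simp, fun s hs => ?_⟩
      rw [Finset.mem_singleton.1 hs]
      have : degreeTo x (Finset.univ.erase v) v ≤ 1 := by omega
      exact_mod_cast this
    · rw [← Real.exp_add]
      simp only [Finset.card_empty, pow_zero, one_mul, Finset.card_singleton, Nat.cast_one,
        mul_one, Finset.sum_singleton, Real.exp_neg, Real.exp_log hL0]
      refine Real.exp_le_exp.2 ?_
      have hll : Real.log L ≤ L := (Real.log_le_sub_one_of_pos hL0).trans (by linarith)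
      have e1 : L⁻¹ * L = 1 := by field_simp
      have e2 : L⁻¹ * Real.log L ≤ 1 := by
        rw [← e1]; exact mul_le_mul_of_nonneg_left hll (by positivity)
      have e3 : L⁻¹ * W ≤ W / 2 := by
        have : L⁻¹ ≤ 2⁻¹ := inv_anti₀ (by norm_num) hL
        nlinarith
      nlinarith
  calc _ ≤ ∑ v : V, prob w (fun x => degreeTo x (Finset.univ.erase v) v < 2) :=
        prob_exists_le h0 h1 _ _
    _ ≤ ∑ _v : V, Real.exp (-L) * Real.exp (3 - W / 2) := Finset.sum_le_sum hv
    _ = _ := by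
        rw [Finset.sum_const, nsmul_eq_mul, Finset.card_univ, ← hLN, ← mul_assoc,
          ← Real.exp_add]
        simp

/-- The bound for a union of at most `N ^ j` clusters with `j - 1` selected pairs. -/
lemma union_bound {K c : ℝ} {N j i J : ℕ} {q : ℝ} (hN : Real.exp L = N)
    (hK : 1 ≤ K * L) (hj : j ≤ i) (hq : q ≤ -(1 + c) * L + J) :
    (N : ℝ) ^ (j + 1) * ((K * L / N) ^ j * Real.exp q) ≤
      (K * L) ^ i * Real.exp (-c * L + J) := by
  have hN0 : (0 : ℝ) < N := hN ▸ Real.exp_pos _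
  calc (N : ℝ) ^ (j + 1) * ((K * L / N) ^ j * Real.exp q)
      = (K * L) ^ j * (N * Real.exp q) := by rw [div_pow, pow_succ]; field_simp
    _ ≤ (K * L) ^ i * Real.exp (-c * L + J) := by
        refine mul_le_mul (pow_le_pow_right₀ hK hj) ?_ (by positivity) (by positivity)
        rw [← hN, ← Real.exp_add]
        exact Real.exp_le_exp.2 (by linarith)

variable {K : ℝ} {D : ℕ}

/-- Small total degree at one vertex and few neighbours in the test set at another together cost
`exp (-(1 + γ / 2) L)`. With the probability of the joining pair this beats the number `N ^ 2` of
choices. The constant 6 bounds `S.card * C.card` here and for clusters of three vertices. -/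
lemma prob_tiny_adj (h0 : ∀ e, 0 ≤ w e) (h1 : ∀ e, w e ≤ 1)
    (hκ : ∀ e, w e ≤ K * L / Fintype.card V) (hκ1 : K * L / Fintype.card V ≤ 1)
    (hK : 1 ≤ K * L) (hD : 1 ≤ D)
    (hLN : Real.exp L = Fintype.card V)
    (hdeg : ∀ v, L ≤ ∑ u ∈ Finset.univ.erase v, w s(v, u))
    (hY : ∀ v, γ * L ≤ ∑ u ∈ Y v, w s(v, u)) (hτ : 0 ≤ τ)
    (hγ : 2 * (τ * a) - (1 - Real.exp (-τ)) * (L + γ * L) ≤ -(1 + γ / 2) * L) :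
    prob w (fun x => ∃ p ∈ (Finset.univ : Finset (V × V)), p.1 ≠ p.2 ∧ Tiny a x p.1 ∧
      Atypical Y a x p.2 ∧ x s(p.1, p.2) = true) ≤
        (K * L) ^ (2 * D) * Real.exp (-(γ / 2) * L + 6) := by
  classical
  have hκ0 : 0 ≤ K * L / Fintype.card V :=
    div_nonneg (zero_le_one.trans hK) (Nat.cast_nonneg _)
  have hp : ∀ p ∈ (Finset.univ : Finset (V × V)), prob w (fun x => p.1 ≠ p.2 ∧ Tiny a x p.1 ∧
      Atypical Y a x p.2 ∧ x s(p.1, p.2) = true) ≤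
        (K * L / Fintype.card V) ^ 1 * Real.exp (-(1 + γ / 2) * L + 6) := by
    rintro ⟨s, s'⟩ -
    by_cases hne : s = s'
    · refine le_trans (le_of_eq ?_) (by positivity : (0 : ℝ) ≤ _)
      simp [hne, prob, expect]
    have h := prob_cluster_le h0 h1 hκ (C := {s, s'}) (S := {s, s'}) subset_rfl
      (E₀ := {s(s, s')}) (by simp) (fun v => if v = s then Finset.univ.erase v else Y v) (a := a)
      hτ (μ := fun v => if v = s then L else γ * L) (fun v _ => by
        by_cases hv : v = s
        · simpa [hv] using hdeg s
        · simpa [hv] using hY v)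
    refine (prob_mono h0 h1 fun x hx => ?_).trans (h.trans ?_)
    · refine ⟨by simpa using hx.2.2.2, fun v hv => ?_⟩
      rcases Finset.mem_insert.1 hv with rfl | hv
      · simpa [Tiny] using hx.2.1
      · rw [Finset.mem_singleton.1 hv, if_neg (Ne.symm hne)]
        exact hx.2.2.1
    · rw [Finset.card_singleton, Finset.card_pair hne, Finset.sum_pair hne, if_pos rfl,
        if_neg (Ne.symm hne)]
      refine mul_le_mul_of_nonneg_left (Real.exp_le_exp.2 ?_) (by positivity)
      push_cast
      linarith
  calc _ ≤ ∑ p : V × V, _ := prob_exists_le h0 h1 _ _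
    _ ≤ ∑ _p : V × V, (K * L / Fintype.card V) ^ 1 * Real.exp (-(1 + γ / 2) * L + 6) :=
        Finset.sum_le_sum hp
    _ = (Fintype.card V : ℝ) ^ (1 + 1) *
        ((K * L / Fintype.card V) ^ 1 * Real.exp (-(1 + γ / 2) * L + 6)) := by
        simp [Fintype.card_prod, sq]
    _ ≤ _ := union_bound (J := 6) hLN hK (by omega) (by norm_num)

/-- The additional middle vertex costs a factor `N` in the union bound, and the additional selected
pair compensates for it up to a factor `K * L`. -/
lemma prob_tiny_dist (h0 : ∀ e, 0 ≤ w e) (h1 : ∀ e, w e ≤ 1)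
    (hκ : ∀ e, w e ≤ K * L / Fintype.card V) (hκ1 : K * L / Fintype.card V ≤ 1)
    (hK : 1 ≤ K * L) (hD : 1 ≤ D)
    (hLN : Real.exp L = Fintype.card V)
    (hdeg : ∀ v, L ≤ ∑ u ∈ Finset.univ.erase v, w s(v, u))
    (hY : ∀ v, γ * L ≤ ∑ u ∈ Y v, w s(v, u)) (hτ : 0 ≤ τ)
    (hγ : 2 * (τ * a) - (1 - Real.exp (-τ)) * (L + γ * L) ≤ -(1 + γ / 2) * L) :
    prob w (fun x => ∃ p ∈ (Finset.univ : Finset (V × V × V)), (p.1 ≠ p.2.1 ∧ p.2.1 ≠ p.2.2 ∧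
      p.1 ≠ p.2.2) ∧ Tiny a x p.1 ∧ Atypical Y a x p.2.2 ∧ x s(p.1, p.2.1) = true ∧
        x s(p.2.1, p.2.2) = true) ≤
        (K * L) ^ (2 * D) * Real.exp (-(γ / 2) * L + 6) := by
  classical
  have hκ0 : 0 ≤ K * L / Fintype.card V :=
    div_nonneg (zero_le_one.trans hK) (Nat.cast_nonneg _)
  have hp : ∀ p ∈ (Finset.univ : Finset (V × V × V)), prob w (fun x => (p.1 ≠ p.2.1 ∧
      p.2.1 ≠ p.2.2 ∧ p.1 ≠ p.2.2) ∧ Tiny a x p.1 ∧ Atypical Y a x p.2.2 ∧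
        x s(p.1, p.2.1) = true ∧ x s(p.2.1, p.2.2) = true) ≤
        (K * L / Fintype.card V) ^ 2 * Real.exp (-(1 + γ / 2) * L + 6) := by
    rintro ⟨s, u, s'⟩ -
    by_cases hne : s ≠ u ∧ u ≠ s' ∧ s ≠ s'
    swap
    · refine le_trans (le_of_eq ?_) (by positivity : (0 : ℝ) ≤ _)
      simp [hne, prob, expect]
    obtain ⟨hsu, hus, hss⟩ := hne
    have h := prob_cluster_le h0 h1 hκ (C := {s, s', u}) (S := {s, s'})
      (by intro v; simp only [Finset.mem_insert, Finset.mem_singleton]; tauto)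
      (E₀ := {s(s, u), s(u, s')}) (by simp) (fun v => if v = s then Finset.univ.erase v else Y v)
      (a := a) hτ (μ := fun v => if v = s then L else γ * L) (fun v _ => by
        by_cases hv : v = s
        · simpa [hv] using hdeg s
        · simpa [hv] using hY v)
    refine (prob_mono h0 h1 fun x hx => ?_).trans (h.trans ?_)
    · refine ⟨by simpa using hx.2.2.2, fun v hv => ?_⟩
      rcases Finset.mem_insert.1 hv with rfl | hv
      · simpa [Tiny] using hx.2.1
      · rw [Finset.mem_singleton.1 hv, if_neg (Ne.symm hss)]
        exact hx.2.2.1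
    · have hE : s(s, u) ≠ s(u, s') := by
        rw [Ne, Sym2.eq_iff]; tauto
      rw [Finset.card_pair hE, Finset.card_pair hss, Finset.sum_pair hss, if_pos rfl,
        if_neg (Ne.symm hss), Finset.card_eq_three.2 ⟨s, s', u, hss, hsu, hus.symm, rfl⟩]
      refine mul_le_mul_of_nonneg_left (Real.exp_le_exp.2 ?_) (by positivity)
      push_cast
      linarith
  calc _ ≤ ∑ p : V × V × V, _ := prob_exists_le h0 h1 _ _
    _ ≤ ∑ _p : V × V × V, (K * L / Fintype.card V) ^ 2 * Real.exp (-(1 + γ / 2) * L + 6) :=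
        Finset.sum_le_sum hp
    _ = (Fintype.card V : ℝ) ^ (2 + 1) *
        ((K * L / Fintype.card V) ^ 2 * Real.exp (-(1 + γ / 2) * L + 6)) := by
        rw [Finset.sum_const, Finset.card_univ, Fintype.card_prod, Fintype.card_prod,
          nsmul_eq_mul]
        push_cast
        ring
    _ ≤ _ := union_bound (J := 6) hLN hK (by omega) (by norm_num)

end estimates

end RandomSubset

/-! ### Typical structure, continued: crowds of atypical vertices -/

namespace RandomSubset

lemma prob_eq_zero {E : Type*} [Fintype E] [DecidableEq E] (w : E → ℝ) {P : (E → Bool) → Prop}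
    (h : ∀ x, ¬ P x) : prob w P = 0 := by
  simp [prob, expect, h]

variable {V : Type*} [Fintype V] [DecidableEq V]

section estimates

variable {w : Sym2 V → ℝ} {Y : V → Finset V} {γ τ L a K : ℝ} {D : ℕ}

/-- One atypical vertex only costs a small power of `N`, but by `hγ` a number `D` of them costs more
than `N`. The `D` selected pairs pay for the choices of the neighbours. -/
lemma prob_few_adj (h0 : ∀ e, 0 ≤ w e) (h1 : ∀ e, w e ≤ 1)
    (hκ : ∀ e, w e ≤ K * L / Fintype.card V) (hκ1 : K * L / Fintype.card V ≤ 1)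
    (hK : 1 ≤ K * L) (hLN : Real.exp L = Fintype.card V)
    (hY : ∀ v, γ * L ≤ ∑ u ∈ Y v, w s(v, u)) (hτ : 0 ≤ τ)
    (hγ : D * (τ * a - (1 - Real.exp (-τ)) * (γ * L)) ≤ -(1 + γ / 2) * L) :
    prob w (fun x => ∃ p ∈ (Finset.univ : Finset V) ×ˢ Finset.powersetCard D Finset.univ,
      p.1 ∉ p.2 ∧ ∀ s ∈ p.2, Atypical Y a x s ∧ x s(p.1, s) = true) ≤
        (K * L) ^ (2 * D) * Real.exp (-(γ / 2) * L + (D * (2 * D + 1) : ℕ)) := by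
  classical
  have hκ0 : 0 ≤ K * L / Fintype.card V := by positivity
  have hp : ∀ p ∈ (Finset.univ : Finset V) ×ˢ Finset.powersetCard D Finset.univ,
      prob w (fun x => p.1 ∉ p.2 ∧ ∀ s ∈ p.2, Atypical Y a x s ∧ x s(p.1, s) = true) ≤
        (K * L / Fintype.card V) ^ D *
          Real.exp (-(1 + γ / 2) * L + (D * (2 * D + 1) : ℕ)) := by
    rintro ⟨v, T⟩ hT
    have hTD : T.card = D := by simpa using hT
    by_cases hv : v ∈ T
    · exact (prob_eq_zero w fun x hx => hx.1 hv).le.trans (by positivity)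
    have h := prob_cluster_le h0 h1 hκ (C := insert v T) (S := T) (Finset.subset_insert _ _)
      (E₀ := T.image fun s => s(v, s)) (by
        intro e he u hu
        obtain ⟨s, hs, rfl⟩ := Finset.mem_image.1 he
        rcases Sym2.mem_iff.1 hu with rfl | rfl <;> simp [hs]) Y (a := a) hτ
      (μ := fun _ => γ * L) (fun s _ => hY s)
    have hcard : (T.image fun s => s(v, s)).card = D := by
      rw [Finset.card_image_of_injective _ fun s s' h => Sym2.congr_right.1 h, hTD]
    refine (prob_mono h0 h1 fun x hx => ?_).trans (h.trans ?_)
    · refine ⟨fun e he => ?_, fun s hs => (hx.2 s hs).1⟩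
      obtain ⟨s, hs, rfl⟩ := Finset.mem_image.1 he
      exact (hx.2 s hs).2
    · rw [hcard, Finset.card_insert_of_notMem hv, hTD]
      refine mul_le_mul_of_nonneg_left (Real.exp_le_exp.2 ?_) (by positivity)
      rw [Finset.sum_const, hTD, nsmul_eq_mul]
      have : (D : ℝ) * ((D + 1 : ℕ) * (K * L / Fintype.card V)) ≤ (D * (2 * D + 1) : ℕ) := by
        push_cast
        calc (D : ℝ) * ((D + 1) * (K * L / Fintype.card V)) ≤ D * ((D + 1) * 1) := by gcongr
          _ ≤ D * (2 * D + 1) := by nlinarith [Nat.cast_nonneg (α := ℝ) D]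
      nlinarith
  calc _ ≤ ∑ p ∈ (Finset.univ : Finset V) ×ˢ Finset.powersetCard D Finset.univ, _ :=
        prob_exists_le h0 h1 _ _
    _ ≤ ∑ _p ∈ (Finset.univ : Finset V) ×ˢ Finset.powersetCard D Finset.univ,
        (K * L / Fintype.card V) ^ D * Real.exp (-(1 + γ / 2) * L + (D * (2 * D + 1) : ℕ)) :=
        Finset.sum_le_sum hp
    _ ≤ (Fintype.card V : ℝ) ^ (D + 1) * ((K * L / Fintype.card V) ^ D *
          Real.exp (-(1 + γ / 2) * L + (D * (2 * D + 1) : ℕ))) := by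
        rw [Finset.sum_const, nsmul_eq_mul]
        gcongr
        have : ((Finset.univ : Finset V) ×ˢ Finset.powersetCard D (Finset.univ : Finset V)).card
            ≤ Fintype.card V ^ (D + 1) := by
          rw [Finset.card_product, Finset.card_powersetCard, Finset.card_univ, pow_succ, mul_comm]
          exact Nat.mul_le_mul_right _ (Nat.choose_le_pow _ _)
        exact_mod_cast this
    _ ≤ _ := union_bound hLN hK (by omega) le_rfl

/-- The same count for `D` paths of length two from `v` to atypical vertices. Injectivity of `g` and
the avoidance of `v` make the `2 * D` pairs distinct, so they pay for the `2 * D` choices of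
vertices. -/
lemma prob_few_dist (h0 : ∀ e, 0 ≤ w e) (h1 : ∀ e, w e ≤ 1)
    (hκ : ∀ e, w e ≤ K * L / Fintype.card V) (hκ1 : K * L / Fintype.card V ≤ 1)
    (hK : 1 ≤ K * L) (hLN : Real.exp L = Fintype.card V)
    (hY : ∀ v, γ * L ≤ ∑ u ∈ Y v, w s(v, u)) (hτ : 0 ≤ τ)
    (hγ : D * (τ * a - (1 - Real.exp (-τ)) * (γ * L)) ≤ -(1 + γ / 2) * L) :
    prob w (fun x => ∃ p ∈ (Finset.univ : Finset (V × (Fin D ⊕ Fin D → V))),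
      (p.2.Injective ∧ ∀ i, p.2 i ≠ p.1) ∧ ∀ i, x s(p.1, p.2 (.inl i)) = true ∧
        x s(p.2 (.inl i), p.2 (.inr i)) = true ∧ Atypical Y a x (p.2 (.inr i))) ≤
        (K * L) ^ (2 * D) * Real.exp (-(γ / 2) * L + (D * (2 * D + 1) : ℕ)) := by
  classical
  have hκ0 : 0 ≤ K * L / Fintype.card V := by positivity
  have hp : ∀ p ∈ (Finset.univ : Finset (V × (Fin D ⊕ Fin D → V))),
      prob w (fun x => (p.2.Injective ∧ ∀ i, p.2 i ≠ p.1) ∧ ∀ i, x s(p.1, p.2 (.inl i)) = true ∧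
        x s(p.2 (.inl i), p.2 (.inr i)) = true ∧ Atypical Y a x (p.2 (.inr i))) ≤
        (K * L / Fintype.card V) ^ (2 * D) *
          Real.exp (-(1 + γ / 2) * L + (D * (2 * D + 1) : ℕ)) := by
    rintro ⟨v, g⟩ -
    by_cases hg : g.Injective ∧ ∀ i, g i ≠ v
    swap
    · exact (prob_eq_zero w fun x hx => hg hx.1).le.trans (by positivity)
    obtain ⟨hinj, hgv⟩ := hg
    let φ : Fin D ⊕ Fin D → Sym2 V :=
      Sum.elim (fun i => s(v, g (.inl i))) fun i => s(g (.inl i), g (.inr i))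
    have hφ : φ.Injective := by
      rintro (i | i) (j | j) hij
      · have := hinj (Sym2.congr_right.1 hij)
        simpa using this
      · have hm : v ∈ s(g (.inl j), g (.inr j)) := by
          have : v ∈ φ (.inl i) := Sym2.mem_mk_left _ _
          rwa [hij] at this
        rcases Sym2.mem_iff.1 hm with h | h
        · exact absurd h.symm (hgv _)
        · exact absurd h.symm (hgv _)
      · have hm : v ∈ s(g (.inl i), g (.inr i)) := by
          have : v ∈ φ (.inl j) := Sym2.mem_mk_left _ _
          rwa [← hij] at this
        rcases Sym2.mem_iff.1 hm with h | h
        · exact absurd h.symm (hgv _)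
        · exact absurd h.symm (hgv _)
      · have hij' : s(g (.inl i), g (.inr i)) = s(g (.inl j), g (.inr j)) := hij
        rw [Sym2.eq_iff] at hij'
        rcases hij' with h | h
        · simpa using hinj h.1
        · simpa using hinj h.1
    set R : Finset V := Finset.univ.image fun i => g (.inr i) with hR
    have hRcard : R.card = D := by
      rw [hR, Finset.card_image_of_injective _ fun i j h => Sum.inr_injective (hinj h)]; simp
    have hC : (insert v (Finset.univ.image g)).card = 2 * D + 1 := by
      rw [Finset.card_insert_of_notMem (by simpa using hgv), Finset.card_image_of_injective _ hinj]
      simp [two_mul]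
    have hE : (Finset.univ.image φ).card = 2 * D := by
      rw [Finset.card_image_of_injective _ hφ]; simp [two_mul]
    have h := prob_cluster_le h0 h1 hκ (C := insert v (Finset.univ.image g)) (S := R)
      (by
        intro u hu
        obtain ⟨i, -, rfl⟩ := Finset.mem_image.1 hu
        exact Finset.mem_insert_of_mem (Finset.mem_image_of_mem _ (Finset.mem_univ _)))
      (E₀ := Finset.univ.image φ) (by
        intro e he u hu
        obtain ⟨i | i, -, rfl⟩ := Finset.mem_image.1 he
        · rcases Sym2.mem_iff.1 hu with rfl | rfl <;> simp
        · rcases Sym2.mem_iff.1 hu with rfl | rfl <;> simp) Y (a := a) hτ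
      (μ := fun _ => γ * L) (fun s _ => hY s)
    refine (prob_mono h0 h1 fun x hx => ?_).trans (h.trans ?_)
    · refine ⟨fun e he => ?_, fun s hs => ?_⟩
      · obtain ⟨i | i, -, rfl⟩ := Finset.mem_image.1 he
        · exact (hx.2 i).1
        · exact (hx.2 i).2.1
      · obtain ⟨i, -, rfl⟩ := Finset.mem_image.1 hs
        exact (hx.2 i).2.2
    · rw [hE, hC, hRcard]
      refine mul_le_mul_of_nonneg_left (Real.exp_le_exp.2 ?_) (by positivity)
      rw [Finset.sum_const, hRcard, nsmul_eq_mul]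
      have : (D : ℝ) * ((2 * D + 1 : ℕ) * (K * L / Fintype.card V)) ≤ (D * (2 * D + 1) : ℕ) := by
        push_cast
        calc (D : ℝ) * ((2 * D + 1) * (K * L / Fintype.card V)) ≤ D * ((2 * D + 1) * 1) := by
              gcongr
          _ = D * (2 * D + 1) := by ring
      nlinarith
  calc _ ≤ ∑ p : V × (Fin D ⊕ Fin D → V), _ := prob_exists_le h0 h1 _ _
    _ ≤ ∑ _p : V × (Fin D ⊕ Fin D → V), (K * L / Fintype.card V) ^ (2 * D) *
          Real.exp (-(1 + γ / 2) * L + (D * (2 * D + 1) : ℕ)) :=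
        Finset.sum_le_sum hp
    _ = (Fintype.card V : ℝ) ^ (2 * D + 1) * ((K * L / Fintype.card V) ^ (2 * D) *
          Real.exp (-(1 + γ / 2) * L + (D * (2 * D + 1) : ℕ))) := by
        rw [Finset.sum_const, nsmul_eq_mul, Finset.card_univ, Fintype.card_prod,
          Fintype.card_fun, Fintype.card_sum, Fintype.card_fin, ← two_mul]
        push_cast
        ring
    _ ≤ _ := union_bound hLN hK le_rfl le_rfl

-- Markov's inequality: a vertex is atypical with probability at most `exp (-(γ / 2) * L + 1)`, a
-- power of `N` that absorbs the factor `L ^ 2`.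
open Classical in
lemma prob_few_atypical (h0 : ∀ e, 0 ≤ w e) (h1 : ∀ e, w e ≤ 1)
    (hκ : ∀ e, w e ≤ K * L / Fintype.card V) (hκ1 : K * L / Fintype.card V ≤ 1)
    (hK1 : 1 ≤ K) (hL : 1 ≤ L) (hD : 1 ≤ D) (hLN : Real.exp L = Fintype.card V)
    (hY : ∀ v, γ * L ≤ ∑ u ∈ Y v, w s(v, u)) (hτ : 0 ≤ τ)
    (hγ : τ * a - (1 - Real.exp (-τ)) * (γ * L) ≤ -(γ / 2) * L) :
    prob w (fun x => ((Fintype.card V : ℝ) / L ^ 2) <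
      ((Finset.univ.filter fun v => Atypical Y a x v).card : ℝ)) ≤
        (K * L) ^ (2 * D) * Real.exp (-(γ / 2) * L + 1) := by
  have hN0 : (0 : ℝ) < Fintype.card V := hLN ▸ Real.exp_pos _
  have hv : ∀ v : V, prob w (fun x => Atypical Y a x v) ≤ Real.exp (-(γ / 2) * L + 1) := by
    intro v
    have h := prob_cluster_le h0 h1 hκ (C := {v}) (S := {v}) subset_rfl (E₀ := ∅) (by simp)
      Y (a := a) hτ (μ := fun _ => γ * L) (fun s _ => hY s)
    refine (prob_mono h0 h1 fun x hx => ?_).trans (h.trans ?_)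
    · exact ⟨by simp, fun s hs => by rw [Finset.mem_singleton.1 hs]; exact hx⟩
    · simp only [Finset.card_empty, pow_zero, one_mul, Finset.card_singleton, Nat.cast_one,
        Finset.sum_singleton]
      exact Real.exp_le_exp.2 (by linarith)
  have hL2 : L ^ 2 ≤ (K * L) ^ (2 * D) := by
    have h3 : L ≤ K * L := by nlinarith
    calc L ^ 2 ≤ (K * L) ^ 2 := by gcongr
      _ ≤ (K * L) ^ (2 * D) := pow_le_pow_right₀ (by linarith) (by omega)
  calc _ ≤ expect w fun x => (L ^ 2 / Fintype.card V) *
        ∑ v : V, if Atypical Y a x v then 1 else 0 := by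
        refine prob_le_expect h0 h1 (fun x => ?_) fun x hx => ?_
        · exact mul_nonneg (by positivity)
            (Finset.sum_nonneg fun _ _ => by split_ifs <;> norm_num)
        · rw [Finset.sum_boole]
          have := mul_le_mul_of_nonneg_left hx.le
            (by positivity : 0 ≤ L ^ 2 / (Fintype.card V : ℝ))
          refine le_trans (le_of_eq ?_) this
          field_simp
    _ = (L ^ 2 / Fintype.card V) * ∑ v : V, prob w (fun x => Atypical Y a x v) := by
        rw [expect_const_mul, expect_sum]
        simp only [prob]
    _ ≤ (L ^ 2 / Fintype.card V) * ∑ _v : V, Real.exp (-(γ / 2) * L + 1) := by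
        gcongr with v; exact hv v
    _ = L ^ 2 * Real.exp (-(γ / 2) * L + 1) := by
        rw [Finset.sum_const, nsmul_eq_mul, Finset.card_univ]; field_simp
    _ ≤ _ := by gcongr

/-- Chernoff bound with base `z = exp ((K + 2) / θ)`. For `T.card ≤ N / z` the moment generating
function contributes at most `exp (K * L * T.card)`, against `exp (-(K + 2) * L * T.card)` from the
tail. What remains is `N ^ (-2)` per vertex of `T`, which is summable over all `T`. -/
lemma prob_sparse {θ : ℝ} (hθ : 0 < θ) (hK : 0 ≤ K) (h0 : ∀ e, 0 ≤ w e) (h1 : ∀ e, w e ≤ 1)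
    (hκ : ∀ e, w e ≤ K * L / Fintype.card V) (hL : 0 ≤ L) (hLN : Real.exp L = Fintype.card V) :
    prob w (fun x => ∃ T ∈ (Finset.univ.filter fun T : Finset V => T.Nonempty ∧
        (T.card : ℝ) ≤ Real.exp (-((K + 2) / θ)) * Fintype.card V),
      θ * L * T.card ≤ ((T.sym2.filter fun e => x e = true).card : ℝ)) ≤
        2 * Real.exp (-L) := by
  classical
  set N : ℝ := ((Fintype.card V : ℕ) : ℝ) with hN
  have hN0 : (0 : ℝ) < N := hLN ▸ Real.exp_pos _
  set z : ℝ := Real.exp ((K + 2) / θ) with hz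
  have hz1 : 1 ≤ z := Real.one_le_exp (by positivity)
  have hT : ∀ T ∈ (Finset.univ.filter fun T : Finset V => T.Nonempty ∧
        (T.card : ℝ) ≤ Real.exp (-((K + 2) / θ)) * N),
      prob w (fun x => θ * L * T.card ≤ ((T.sym2.filter fun e => x e = true).card : ℝ)) ≤
        Real.exp (-(2 * L)) ^ T.card := by
    intro T hT
    obtain ⟨-, -, hTt⟩ := Finset.mem_filter.1 hT
    refine (prob_le_card_le h0 h1 T.sym2 hz1).trans ?_
    have hsum : ∑ e ∈ T.sym2, w e ≤ T.card * T.card * (K * L / N) := by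
      calc ∑ e ∈ T.sym2, w e ≤ ∑ _e ∈ T.sym2, K * L / N := Finset.sum_le_sum fun e _ => hκ e
        _ = T.sym2.card * (K * L / N) := by simp
        _ ≤ _ := by
            gcongr
            have : T.sym2.card ≤ T.card * T.card := by
              rw [Finset.card_sym2, Nat.choose_two_right, Nat.add_sub_cancel]
              apply Nat.div_le_of_le_mul
              nlinarith [Nat.le_mul_self T.card]
            exact_mod_cast this
    have h2 : (z - 1) * ∑ e ∈ T.sym2, w e ≤ T.card * (K * L) := by
      have hzT : z * T.card ≤ N := by
        calc z * T.card ≤ z * (Real.exp (-((K + 2) / θ)) * N) := by gcongr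
          _ = N := by rw [hz, ← mul_assoc, ← Real.exp_add]; simp
      calc (z - 1) * ∑ e ∈ T.sym2, w e ≤ z * (T.card * T.card * (K * L / N)) := by
            refine mul_le_mul (by linarith) hsum (Finset.sum_nonneg fun e _ => h0 e)
              (by linarith)
        _ = (z * T.card) / N * (T.card * (K * L)) := by ring
        _ ≤ 1 * (T.card * (K * L)) := by
            gcongr
            exact div_le_one_of_le₀ hzT hN0.le
        _ = _ := one_mul _
    have h3 : z ^ (-(θ * L * T.card)) = Real.exp (-((K + 2) * L * T.card)) := by
      rw [hz, ← Real.exp_mul]; congr 1; field_simp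
    rw [h3, ← Real.exp_add, ← Real.exp_nat_mul]
    exact Real.exp_le_exp.2 (by nlinarith)
  calc _ ≤ ∑ T ∈ (Finset.univ.filter fun T : Finset V => T.Nonempty ∧
        (T.card : ℝ) ≤ Real.exp (-((K + 2) / θ)) * N), _ := prob_exists_le h0 h1 _ _
    _ ≤ ∑ T ∈ (Finset.univ.filter fun T : Finset V => T.Nonempty ∧
        (T.card : ℝ) ≤ Real.exp (-((K + 2) / θ)) * N), Real.exp (-(2 * L)) ^ T.card :=
        Finset.sum_le_sum hT
    _ ≤ ∑ T ∈ (Finset.univ : Finset (Finset V)).erase ∅, Real.exp (-(2 * L)) ^ T.card := by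
        refine Finset.sum_le_sum_of_subset_of_nonneg (fun T hT => ?_) fun _ _ _ => by positivity
        simp only [Finset.mem_filter] at hT
        exact Finset.mem_erase.2 ⟨hT.2.1.ne_empty, Finset.mem_univ _⟩
    _ = (1 + Real.exp (-(2 * L))) ^ Fintype.card V - 1 := by
        rw [Finset.sum_erase_eq_sub (Finset.mem_univ _)]
        have := Finset.sum_pow_mul_eq_add_pow (Real.exp (-(2 * L))) 1 (Finset.univ : Finset V)
        rw [Finset.powerset_univ] at this
        simp only [one_pow, mul_one, Finset.card_univ] at this
        rw [this, Finset.card_empty, pow_zero, add_comm]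
    _ ≤ Real.exp (Real.exp (-L)) - 1 := by
        have e1 : Real.exp (-L) = Fintype.card V * Real.exp (-(2 * L)) := by
          rw [← hN, ← hLN, ← Real.exp_add]; congr 1; ring
        rw [e1, Real.exp_nat_mul]
        have := Real.add_one_le_exp (Real.exp (-(2 * L)))
        gcongr
        linarith
    _ ≤ _ := by
        have h1 : |Real.exp (-L)| ≤ 1 := by
          rw [abs_of_pos (Real.exp_pos _)]; exact Real.exp_le_one_iff.2 (by linarith)
        have h2 := (abs_le.1 (Real.abs_exp_sub_one_le h1)).2
        rwa [abs_of_pos (Real.exp_pos _)] at h2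

end estimates

end RandomSubset

namespace RandomSubset

lemma eventually_pow_mul_exp_le (K c J : ℝ) (hc : 0 < c) (m : ℕ) {ε : ℝ} (hε : 0 < ε) :
    ∀ᶠ L : ℝ in atTop, (K * L) ^ m * Real.exp (-c * L + J) ≤ ε := by
  have h := (tendsto_rpow_mul_exp_neg_mul_atTop_nhds_zero m c hc).const_mul
    (K ^ m * Real.exp J)
  rw [mul_zero] at h
  filter_upwards [h.eventually_le_const hε, eventually_ge_atTop 0] with L hL hL0
  refine le_trans (le_of_eq ?_) hL
  rw [mul_pow, Real.exp_add, Real.rpow_natCast]; ring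

lemma eventually_exists_card {P : ℝ → Prop} (hP : ∀ᶠ L : ℝ in atTop, P L) :
    ∃ N₀ : ℕ, ∀ N : ℕ, N₀ ≤ N → P (Real.log N) := by
  have h : Tendsto (fun N : ℕ => Real.log N) atTop atTop :=
    Real.tendsto_log_atTop.comp tendsto_natCast_atTop_atTop
  exact eventually_atTop.1 (h.eventually hP)

/-- With high probability, a random graph with independent edges whose expected degrees are above
the threshold for minimum degree two is typical. -/
theorem exists_typical {K γ : ℝ} (hK : 1 ≤ K) (hγ0 : 0 < γ) (hγ1 : γ ≤ 1) :
    ∃ δ : ℝ, 0 < δ ∧ ∃ D : ℕ, 1 ≤ D ∧ ∀ θ : ℝ, 0 < θ → ∃ α : ℝ, 0 < α ∧ ∀ ε : ℝ, 0 < ε →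
      ∃ (N₀ : ℕ) (W₀ : ℝ), ∀ (V : Type) [Fintype V] [DecidableEq V] (w : Sym2 V → ℝ)
        (Y : V → Finset V), N₀ ≤ Fintype.card V → (∀ e, 0 ≤ w e) → (∀ e, w e ≤ 1) →
        (∀ e, w e ≤ K * Real.log (Fintype.card V) / Fintype.card V) →
        (∀ v, Real.log (Fintype.card V) + Real.log (Real.log (Fintype.card V)) + W₀ ≤
          ∑ u ∈ Finset.univ.erase v, w s(v, u)) →
        (∀ v, γ * Real.log (Fintype.card V) ≤ ∑ u ∈ Y v, w s(v, u)) →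
        prob w (fun x => ¬ Typical Y (δ * Real.log (Fintype.card V))
          (θ * Real.log (Fintype.card V)) (α * Fintype.card V)
          (Fintype.card V / Real.log (Fintype.card V) ^ 2) D x) ≤ ε := by
  -- With `exp (-τ) = γ / 8` and `τ * a = γ * L / 8`, the bound for a tiny vertex together with an
  -- atypical one still has exponent at most `-(1 + γ / 2) * L`, using `γ ≤ 1`.
  set τ : ℝ := Real.log (8 / γ) with hτ
  have h8 : 1 < 8 / γ := by rw [lt_div_iff₀ hγ0]; linarith
  have hτ0 : 0 < τ := Real.log_pos h8
  have hexp : Real.exp (-τ) = γ / 8 := by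
    rw [Real.exp_neg, hτ, Real.exp_log (by positivity), inv_div]
  -- A single atypical vertex has exponent at most `-(γ / 2) * L`, so `D` of them reach `-2 * L`,
  -- below the required `-(1 + γ / 2) * L`.
  set D : ℕ := ⌈4 / γ⌉₊ with hD
  have hD4 : 4 / γ ≤ D := Nat.le_ceil _
  have hD1 : 1 ≤ D := Nat.one_le_iff_ne_zero.2 (by
    rw [hD, Ne, Nat.ceil_eq_zero, not_le]; positivity)
  refine ⟨γ / (8 * τ), by positivity, D, hD1, fun θ hθ => ⟨Real.exp (-((K + 2) / θ)),
    Real.exp_pos _, fun ε hε => ?_⟩⟩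
  have hγ2 : 0 < γ / 2 := by positivity
  have hev : ∀ᶠ L : ℝ in atTop, 2 ≤ L ∧ K * L / Real.exp L ≤ 1 ∧
      (K * L) ^ (2 * D) * Real.exp (-(γ / 2) * L + 6) ≤ ε / 10 ∧
      (K * L) ^ (2 * D) * Real.exp (-(γ / 2) * L + (D * (2 * D + 1) : ℕ)) ≤ ε / 10 ∧
      (K * L) ^ (2 * D) * Real.exp (-(γ / 2) * L + 1) ≤ ε / 10 ∧
      2 * Real.exp (-L) ≤ ε / 10 := by
    have e1 := eventually_pow_mul_exp_le K 1 0 one_pos 1 one_pos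
    have e2 := eventually_pow_mul_exp_le 1 1 0 one_pos 0 (ε := ε / 20) (by positivity)
    filter_upwards [eventually_ge_atTop 2, e1, e2,
      eventually_pow_mul_exp_le K (γ / 2) 6 hγ2 (2 * D) (ε := ε / 10) (by positivity),
      eventually_pow_mul_exp_le K (γ / 2) (D * (2 * D + 1) : ℕ) hγ2 (2 * D) (ε := ε / 10)
        (by positivity),
      eventually_pow_mul_exp_le K (γ / 2) 1 hγ2 (2 * D) (ε := ε / 10) (by positivity)]
      with L h2 h3 h4 h5 h6 h7
    refine ⟨h2, ?_, h5, h6, h7, ?_⟩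
    · rw [div_eq_mul_inv, ← Real.exp_neg]; simpa using h3
    · simp only [pow_zero, one_mul, add_zero, neg_mul] at h4; linarith
  obtain ⟨N₀, hN₀⟩ := eventually_exists_card hev
  obtain ⟨W₀, hW₀0, hW₀⟩ : ∃ W₀ : ℝ, 0 ≤ W₀ ∧ Real.exp (3 - W₀ / 2) ≤ ε / 10 := by
    refine ⟨max 0 (2 * (3 - Real.log (ε / 10))), le_max_left _ _, ?_⟩
    rw [← Real.le_log_iff_exp_le (by positivity)]
    linarith [le_max_right 0 (2 * (3 - Real.log (ε / 10)))]
  refine ⟨max N₀ 1, W₀, fun V _ _ w Y hcard h0 h1 hκ hdeg hY => ?_⟩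
  classical
  obtain ⟨hL2, hκ1, hb1, hb2, hb3, hb4⟩ := hN₀ _ ((le_max_left _ _).trans hcard)
  have hNpos : (0 : ℝ) < Fintype.card V := by
    exact_mod_cast lt_of_lt_of_le one_pos ((le_max_right _ _).trans hcard)
  set L := Real.log (Fintype.card V) with hL
  have hLN : Real.exp L = Fintype.card V := Real.exp_log hNpos
  rw [hLN] at hκ1
  have hKL : 1 ≤ K * L := by nlinarith
  have hlogL : 0 ≤ Real.log L := Real.log_nonneg (by linarith)
  have hdeg' : ∀ v, L ≤ ∑ u ∈ Finset.univ.erase v, w s(v, u) := fun v => by linarith [hdeg v]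
  set a : ℝ := γ / (8 * τ) * L with ha
  have hτa : τ * a = γ / 8 * L := by rw [ha]; field_simp
  have c1 : τ * a - (1 - Real.exp (-τ)) * (γ * L) ≤ -(γ / 2) * L := by
    rw [hτa, hexp]
    nlinarith [mul_pos hγ0 (by linarith : (0 : ℝ) < L), mul_nonneg (mul_nonneg hγ0.le hγ0.le)
      (by linarith : (0 : ℝ) ≤ L), mul_le_mul_of_nonneg_left hγ1
      (mul_nonneg hγ0.le (by linarith : (0 : ℝ) ≤ L))]
  have hDL : 2 * L ≤ D * (γ / 2 * L) := by
    have : 4 / γ * γ = 4 := by field_simp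
    have := mul_le_mul_of_nonneg_right hD4 (by positivity : 0 ≤ γ * L)
    nlinarith
  have c2 : D * (τ * a - (1 - Real.exp (-τ)) * (γ * L)) ≤ -(1 + γ / 2) * L := by
    have := mul_le_mul_of_nonneg_left c1 (Nat.cast_nonneg (α := ℝ) D)
    nlinarith
  have c3 : 2 * (τ * a) - (1 - Real.exp (-τ)) * (L + γ * L) ≤ -(1 + γ / 2) * L := by
    rw [hτa, hexp]
    nlinarith [mul_pos hγ0 (by linarith : (0 : ℝ) < L), mul_le_mul_of_nonneg_left hγ1
      (mul_nonneg hγ0.le (by linarith : (0 : ℝ) ≤ L))]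
  have p1 := prob_degree_lt_two h0 h1 hκ hκ1 hL2 hLN hW₀0 hdeg
  have p2 := prob_tiny_adj h0 h1 hκ hκ1 hKL hD1 hLN hdeg' hY hτ0.le c3
  have p3 := prob_tiny_dist h0 h1 hκ hκ1 hKL hD1 hLN hdeg' hY hτ0.le c3
  have p4 := prob_few_adj h0 h1 hκ hκ1 hKL hLN hY hτ0.le c2
  have p5 := prob_few_dist h0 h1 hκ hκ1 hKL hLN hY hτ0.le c2
  have p6 := prob_sparse hθ (by linarith : 0 ≤ K) h0 h1 hκ (by linarith) hLN
  have p7 := prob_few_atypical h0 h1 hκ hκ1 hK (by linarith) hD1 hLN hY hτ0.le c1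
  refine (prob_mono h0 h1 fun x hx => ?_).trans <|
    (prob_or_le h0 h1 _ _).trans <| (add_le_add (p1.trans hW₀) <|
    (prob_or_le h0 h1 _ _).trans <| add_le_add (p2.trans hb1) <|
    (prob_or_le h0 h1 _ _).trans <| add_le_add (p3.trans hb1) <|
    (prob_or_le h0 h1 _ _).trans <| add_le_add (p4.trans hb2) <|
    (prob_or_le h0 h1 _ _).trans <| add_le_add (p5.trans hb2) <|
    (prob_or_le h0 h1 _ _).trans <| add_le_add (p6.trans hb4) (p7.trans hb3)).trans (by linarith)
  by_contra hcon
  simp only [not_or, not_exists, not_and] at hcon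
  obtain ⟨q1, q2, q3, q4, q5, q6, q7⟩ := hcon
  refine hx ⟨fun v => ?_, fun s s' hne hs hs' => ?_, fun s u s' h1 h2 h3 hs hs' hsu => ?_,
    fun v T hv hT => ?_, fun v g hg hgv => ?_, fun T hT hTt => ?_, ?_⟩
  · have := q1 v (Finset.mem_univ _); omega
  · simpa using q2 (s, s') (Finset.mem_univ _) hne hs hs'
  · simpa using q3 (s, u, s') (Finset.mem_univ _) ⟨h1, h2, h3⟩ hs hs' hsu
  · by_contra! hcon
    refine q4 (v, T) ?_ hv fun s hs => ⟨(hcon s hs).1, by simpa using (hcon s hs).2⟩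
    rw [Finset.mem_product, Finset.mem_powersetCard]
    exact ⟨Finset.mem_univ _, Finset.subset_univ _, hT⟩
  · by_contra! hcon
    exact q5 (v, g) (Finset.mem_univ _) ⟨hg, hgv⟩ hcon
  · exact not_le.1 (q6 T (by simp only [Finset.mem_filter, Finset.mem_univ, true_and]
                             exact ⟨hT, hTt⟩))
  · exact not_lt.1 q7

end RandomSubset

/-! ### Private neighbours of atypical vertices, and expansion -/

namespace RandomSubset

variable {V : Type*} [Fintype V] [DecidableEq V]

/-- Two private neighbours `g s false`, `g s true` outside `A` for every vertex `s` of `A`. -/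
structure Attached (A : Finset V) (x : Sym2 V → Bool) (g : V → Bool → V) : Prop where
  notMem : ∀ s ∈ A, ∀ b, g s b ∉ A
  adj : ∀ s ∈ A, ∀ b, x s(s, g s b) = true
  inj : ∀ s ∈ A, ∀ s' ∈ A, ∀ b b', g s b = g s' b' → s = s' ∧ b = b'

/-- The vertices of `A` together with their private neighbours. -/
def core (A : Finset V) (g : V → Bool → V) : Finset V :=
  A ∪ A.biUnion fun s => Finset.univ.image (g s)

omit [Fintype V] in
lemma mem_core {A : Finset V} {g : V → Bool → V} {u : V} :
    u ∈ core A g ↔ u ∈ A ∨ ∃ s ∈ A, ∃ b, g s b = u := by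
  simp only [core, Finset.mem_union, Finset.mem_biUnion, Finset.mem_image, Finset.mem_univ,
    true_and]

omit [Fintype V] in
lemma card_core_le (A : Finset V) (g : V → Bool → V) : (core A g).card ≤ 3 * A.card := by
  have h : (A.biUnion fun s => Finset.univ.image (g s)).card ≤ A.card * 2 :=
    Finset.card_biUnion_le_card_mul _ _ _ fun s _ => Finset.card_image_le
  have := Finset.card_union_le A (A.biUnion fun s => Finset.univ.image (g s))
  rw [core]; omega

open Classical in
/-- The set of atypical vertices. -/
noncomputable def atypical (Y : V → Finset V) (a : ℝ) (x : Sym2 V → Bool) : Finset V :=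
  Finset.univ.filter fun v => Atypical Y a x v

omit [DecidableEq V] in
@[simp] lemma mem_atypical {Y : V → Finset V} {a : ℝ} {x : Sym2 V → Bool} {v : V} :
    v ∈ atypical Y a x ↔ Atypical Y a x v := by
  simp [atypical]

section

variable {Y : V → Finset V} {a b t ρ : ℝ} {D : ℕ} {x : Sym2 V → Bool}

namespace Typical

lemma card_atypical_le (h : Typical Y a b t ρ D x) : ((atypical Y a x).card : ℝ) ≤ ρ := by
  have := h.few_atypical
  rw [atypical]; convert this

lemma card_adj_atypical_lt (h : Typical Y a b t ρ D x) (v : V) :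
    ((atypical Y a x).filter fun s => s ≠ v ∧ x s(v, s) = true).card < D := by
  by_contra! hcon
  obtain ⟨T, hT, hTD⟩ := Finset.exists_subset_card_eq hcon
  obtain ⟨s, hs, hs'⟩ := h.few_adj v T (fun hv => by simpa using hT hv) hTD
  have := hT hs
  simp only [Finset.mem_filter, mem_atypical] at this
  rw [hs' this.1] at this
  simp at this

/-- The neighbours of an atypical vertex that are not atypical. -/
lemma card_adj_not_atypical (h : Typical Y a b t ρ D x) (ha : 3 * (D : ℝ) ≤ a) {s : V}
    (hs : ¬ Tiny a x s) :
    2 * D ≤ (Finset.univ.filter fun u => u ∉ atypical Y a x ∧ u ≠ s ∧ x s(s, u) = true).card := by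
  have h1 := h.card_adj_atypical_lt s
  have h2 : a < degreeTo x (Finset.univ.erase s) s := not_le.1 hs
  have h3 : degreeTo x (Finset.univ.erase s) s ≤
      ((atypical Y a x).filter fun u => u ≠ s ∧ x s(s, u) = true).card +
      (Finset.univ.filter fun u => u ∉ atypical Y a x ∧ u ≠ s ∧ x s(s, u) = true).card := by
    refine le_trans (Finset.card_le_card fun u hu => ?_) (Finset.card_union_le _ _)
    simp only [Finset.mem_filter, Finset.mem_erase, Finset.mem_univ, and_true] at hu
    simp only [Finset.mem_union, Finset.mem_filter, Finset.mem_univ, true_and]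
    tauto
  have h4 : (3 * D : ℝ) < degreeTo x (Finset.univ.erase s) s := by linarith
  have h5 : 3 * D < degreeTo x (Finset.univ.erase s) s := by exact_mod_cast h4
  omega

/-- Hall's condition, with demand two, by fractional counting. A tiny vertex has at least two
neighbours, none of them atypical and none shared with another atypical vertex. An atypical vertex
that is not tiny has at least `2 * D` neighbours that are not atypical, and each of these is
adjacent to at most `D` atypical vertices. -/
lemma exists_attached (h : Typical Y a b t ρ D x) (hD : 1 ≤ D)
    (ha : 3 * (D : ℝ) ≤ a) : ∃ g, Attached (atypical Y a x) x g := by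
  classical
  set A := atypical Y a x with hA
  let nb : V → Finset V := fun s => Finset.univ.filter fun u => u ∉ A ∧ u ≠ s ∧ x s(s, u) = true
  have hnb : ∀ s u, u ∈ nb s ↔ u ∉ A ∧ u ≠ s ∧ x s(s, u) = true := fun s u => by simp [nb]
  have hall : ∀ S ⊆ A, 2 * S.card ≤ (S.biUnion nb).card := by
    intro S hS
    let d : V → ℕ := fun u => (S.filter fun s => u ∈ nb s).card
    have hdD : ∀ u, u ∉ A → d u ≤ D := by
      intro u hu
      refine le_trans (Finset.card_le_card fun s hs => ?_) (h.card_adj_atypical_lt u).le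
      obtain ⟨hs, hus⟩ := Finset.mem_filter.1 hs
      rw [hnb] at hus
      exact Finset.mem_filter.2 ⟨hS hs, fun h' => hus.2.1 h'.symm, by rw [Sym2.eq_swap]; exact hus.2.2⟩
    -- Each `u` divides a unit mass equally among the `d u` vertices of `S` to which it is adjacent;
    -- every `s` receives at least two.
    have key : ∀ s ∈ S, (2 : ℝ) ≤ ∑ u ∈ nb s, (d u : ℝ)⁻¹ := by
      intro s hs
      have hsA : Atypical Y a x s := mem_atypical.1 (hS hs)
      have hd1 : ∀ u ∈ nb s, 1 ≤ d u := fun u hu =>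
        Finset.card_pos.2 ⟨s, Finset.mem_filter.2 ⟨hs, hu⟩⟩
      by_cases htiny : Tiny a x s
      · have hd : ∀ u ∈ nb s, d u = 1 := by
          intro u hu
          refine le_antisymm (Finset.card_le_one.2 ?_) (hd1 u hu)
          have : ∀ s' ∈ S.filter fun s => u ∈ nb s, s' = s := by
            intro s' hs'
            obtain ⟨hs', hus'⟩ := Finset.mem_filter.1 hs'
            by_contra hne
            rw [hnb] at hu hus'
            have := h.tiny_dist s u s' hu.2.1.symm hus'.2.1 (Ne.symm hne) htiny
              (mem_atypical.1 (hS hs')) hu.2.2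
            rw [Sym2.eq_swap, hus'.2.2] at this
            exact absurd this (by simp)
          intro y hy z hz
          rw [this y hy, this z hz]
        rw [Finset.sum_congr rfl fun u hu => by rw [hd u hu, Nat.cast_one, inv_one]]
        rw [Finset.sum_const, nsmul_eq_mul, mul_one]
        have h2 := h.two_le_degree s
        have h3 : degreeTo x (Finset.univ.erase s) s ≤ (nb s).card := by
          refine Finset.card_le_card fun u hu => ?_
          simp only [Finset.mem_filter, Finset.mem_erase, Finset.mem_univ, and_true] at hu
          refine (hnb s u).2 ⟨fun huA => ?_, hu.1, hu.2⟩
          have := h.tiny_adj s u hu.1.symm htiny (mem_atypical.1 huA)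
          rw [hu.2] at this
          exact absurd this (by simp)
        exact_mod_cast h2.trans h3
      · have h2 := h.card_adj_not_atypical ha htiny
        calc (2 : ℝ) = (2 * D : ℕ) * (D : ℝ)⁻¹ := by
              have : (D : ℝ) ≠ 0 := by positivity
              push_cast; field_simp
          _ ≤ (nb s).card * (D : ℝ)⁻¹ := by gcongr
          _ = ∑ u ∈ nb s, (D : ℝ)⁻¹ := by rw [Finset.sum_const, nsmul_eq_mul]
          _ ≤ _ := by
            refine Finset.sum_le_sum fun u hu => ?_
            have h3 := hdD u ((hnb s u).1 hu).1
            have h4 := hd1 u hu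
            gcongr
    have h1 : (2 * S.card : ℝ) ≤ (S.biUnion nb).card := by
      calc (2 * S.card : ℝ) = ∑ s ∈ S, 2 := by simp [mul_comm]
        _ ≤ ∑ s ∈ S, ∑ u ∈ nb s, (d u : ℝ)⁻¹ := Finset.sum_le_sum key
        _ = ∑ u ∈ S.biUnion nb, ∑ s ∈ S.filter fun s => u ∈ nb s, (d u : ℝ)⁻¹ := by
            refine Finset.sum_comm' fun s u => ?_
            simp only [Finset.mem_filter, Finset.mem_biUnion]
            constructor
            · rintro ⟨h1, h2⟩; exact ⟨⟨h1, h2⟩, s, h1, h2⟩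
            · rintro ⟨h1, -⟩; exact h1
        _ = ∑ u ∈ S.biUnion nb, 1 := by
            refine Finset.sum_congr rfl fun u hu => ?_
            obtain ⟨s, hs, hus⟩ := Finset.mem_biUnion.1 hu
            have : 0 < d u := Finset.card_pos.2 ⟨s, Finset.mem_filter.2 ⟨hs, hus⟩⟩
            rw [Finset.sum_const, nsmul_eq_mul]
            exact mul_inv_cancel₀ (by positivity)
        _ = _ := by simp
    exact_mod_cast h1
  -- Doubling the index set to `A × Bool` turns the demand two into a system of distinct
  -- representatives.
  have hhall := (Finset.all_card_le_biUnion_card_iff_exists_injective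
    (fun p : A × Bool => nb p.1)).1 fun J => by
      have h1 : J.card ≤ (J.image fun p => (p.1 : V)).card * 2 := by
        refine (Finset.card_le_card_of_injOn (t := (J.image fun p => (p.1 : V)) ×ˢ
          (Finset.univ : Finset Bool)) (fun p => ((p.1 : V), p.2)) (fun p hp => ?_) ?_).trans ?_
        · simp only [Finset.coe_product, Set.mem_prod, Finset.mem_coe, Finset.mem_image,
            Finset.mem_univ, and_true]
          exact ⟨p, hp, rfl⟩
        · rintro ⟨s, b⟩ - ⟨s', b'⟩ - heq
          exact Prod.ext (Subtype.ext (congrArg Prod.fst heq)) (congrArg Prod.snd heq :)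
        · rw [Finset.card_product, Finset.card_univ, Fintype.card_bool]
      have h2 := hall (J.image fun p => (p.1 : V)) fun s hs => by
        obtain ⟨p, -, rfl⟩ := Finset.mem_image.1 hs
        exact p.1.2
      rw [Finset.image_biUnion] at h2
      omega
  obtain ⟨φ, hφ, hmem⟩ := hhall
  refine ⟨fun s b => if hs : s ∈ A then φ (⟨s, hs⟩, b) else s, fun s hs b => ?_,
    fun s hs b => ?_, fun s hs s' hs' b b' heq => ?_⟩
  · rw [dif_pos hs]; exact ((hnb _ _).1 (hmem (⟨s, hs⟩, b))).1
  · rw [dif_pos hs]; exact ((hnb _ _).1 (hmem (⟨s, hs⟩, b))).2.2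
  · rw [dif_pos hs, dif_pos hs'] at heq
    have := hφ heq
    simpa using this

variable {g : V → Bool → V}

/-- Core neighbours of `v` are atypical or private neighbours. The former are fewer than `D`. The
latter belong to fewer than `D` atypical vertices, since `D` of these would form the configuration
excluded by `few_dist`, and each owns two. -/
lemma card_adj_core_le (h : Typical Y a b t ρ D x) (hY : ∀ v, v ∉ Y v)
    (hg : Attached (atypical Y a x) x g) {v : V} (hv : v ∉ atypical Y a x) :
    ((Y v).filter fun u => x s(v, u) = true ∧ u ∈ core (atypical Y a x) g).card ≤ 3 * D := by
  classical
  set A := atypical Y a x with hA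
  set S := A.filter fun s => ∃ b, x s(v, g s b) = true ∧ g s b ≠ v with hS
  have h1 := h.card_adj_atypical_lt v
  have h2 : S.card < D := by
    by_contra! hcon
    obtain ⟨T, hT, hTD⟩ := Finset.exists_subset_card_eq hcon
    let e : Fin D ≃ T := (T.equivFinOfCardEq hTD).symm
    have hTA : ∀ i, (e i : V) ∈ A ∧ ∃ b, x s(v, g (e i) b) = true ∧ g (e i) b ≠ v := fun i => by
      simpa [hS] using hT (e i).2
    choose hmem c hc using hTA
    have hinj : (Sum.elim (fun i => g (e i) (c i)) fun i => (e i : V)).Injective := by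
      rintro (i | i) (j | j) hij
      · have := (hg.inj _ (hmem i) _ (hmem j) _ _ hij).1
        rw [e.injective (Subtype.ext this)]
      · simp only [Sum.elim_inl, Sum.elim_inr] at hij
        exact absurd (hij ▸ hmem j) (hg.notMem _ (hmem i) _)
      · simp only [Sum.elim_inl, Sum.elim_inr] at hij
        exact absurd (hij ▸ hmem i) (hg.notMem _ (hmem j) _)
      · simp only [Sum.elim_inr] at hij
        rw [e.injective (Subtype.ext hij)]
    obtain ⟨i, hi⟩ := h.few_dist v _ hinj <| by
      rintro (i | i)
      · exact (hc i).2
      · rintro rfl; exact hv (hmem i)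
    refine hi (hc i).1 ?_ (mem_atypical.1 (hmem i))
    rw [Sym2.eq_swap]; exact hg.adj _ (hmem i) _
  calc _ ≤ ((A.filter fun s => s ≠ v ∧ x s(v, s) = true) ∪
        S.biUnion fun s => Finset.univ.image (g s)).card := by
        refine Finset.card_le_card fun u hu => ?_
        obtain ⟨huY, hvu, hu⟩ := Finset.mem_filter.1 hu
        have hne : u ≠ v := fun h' => hY v (h' ▸ huY)
        rw [Finset.mem_union, Finset.mem_filter, Finset.mem_biUnion]
        rcases mem_core.1 hu with hu | ⟨s, hs, b, rfl⟩
        · exact Or.inl ⟨hu, hne, hvu⟩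
        · exact Or.inr ⟨s, Finset.mem_filter.2 ⟨hs, b, hvu, hne⟩,
            Finset.mem_image_of_mem _ (Finset.mem_univ _)⟩
    _ ≤ D + S.card * 2 := (Finset.card_union_le _ _).trans <| add_le_add h1.le <|
        Finset.card_biUnion_le_card_mul _ _ _ fun s _ => Finset.card_image_le
    _ ≤ 3 * D := by omega

/-- Expansion of sets without atypical vertices into the complement of a set `F` that contains
few additional vertices of every test set. -/
lemma expand (h : Typical Y a b t ρ D x) (hY : ∀ v, v ∉ Y v)
    (hg : Attached (atypical Y a x) x g) {F : Finset V} {j : ℕ}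
    (hF : ∀ v, (Y v ∩ (F \ core (atypical Y a x) g)).card ≤ j) (hab : 6 * b + 3 * D + j ≤ a)
    {S : Finset V} (hne : S.Nonempty) (hS : Disjoint S (atypical Y a x))
    (hSt : 3 * (S.card : ℝ) ≤ t) (P : V → V → Prop) (hP : ∀ v, ∀ u ∈ Y v, P v u)
    [DecidablePred fun u => u ∉ F ∧ u ∉ S ∧ ∃ v ∈ S, (graph x).Adj v u ∧ P v u] :
    2 * S.card < (Finset.univ.filter fun u =>
      u ∉ F ∧ u ∉ S ∧ ∃ v ∈ S, (graph x).Adj v u ∧ P v u).card := by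
  classical
  by_contra! hcon
  set A := atypical Y a x with hA
  set U := Finset.univ.filter fun u => u ∉ F ∧ u ∉ S ∧ ∃ v ∈ S, (graph x).Adj v u ∧ P v u with hU
  -- If the set of outer neighbours were small, `T` would have at most `3 * S.card` elements while
  -- every vertex of `S` has at least `6 * b` selected pairs into `T`. Each pair is counted at most
  -- twice, so `T` would contain at least `b * T.card` pairs, against sparsity.
  set T := S ∪ U with hT
  have hTcard : (T.card : ℝ) ≤ 3 * S.card := by
    have := Finset.card_union_le S U
    have : T.card ≤ 3 * S.card := by rw [hT]; omega
    exact_mod_cast this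
  have hsp := h.sparse T (hne.mono Finset.subset_union_left) (hTcard.trans hSt)
  set R : V → Finset V := fun v => (Y v).filter fun u => x s(v, u) = true ∧ u ∉ F with hR
  have hdeg : ∀ v ∈ S, 6 * b ≤ ((R v).card : ℝ) := by
    intro v hv
    have hvA : v ∉ A := Finset.disjoint_left.1 hS hv
    have h1 : a < degreeTo x (Y v) v := not_le.1 fun h' => hvA (mem_atypical.2 h')
    have h2 := h.card_adj_core_le hY hg hvA
    rw [← hA] at h2
    have h3 : degreeTo x (Y v) v ≤ (R v).card +
        (((Y v).filter fun u => x s(v, u) = true ∧ u ∈ core A g).card +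
          (Y v ∩ (F \ core A g)).card) := by
      refine le_trans (Finset.card_le_card fun u hu => ?_) ((Finset.card_union_le _ _).trans
        (Nat.add_le_add_left (Finset.card_union_le _ _) _))
      simp only [hR, Finset.mem_filter, Finset.mem_union, Finset.mem_inter, Finset.mem_sdiff] at hu ⊢
      tauto
    have h4 := hF v
    have h5 : (degreeTo x (Y v) v : ℝ) ≤ (R v).card + (3 * D + j) := by exact_mod_cast by omega
    linarith
  have hcount : ∑ v ∈ S, (R v).card ≤ 2 * (T.sym2.filter fun e => x e = true).card := by
    rw [← Finset.card_sigma]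
    refine Finset.card_le_mul_card_image_of_maps_to (f := fun p => s(p.1, p.2))
      (fun p hp => ?_) 2 fun e he => ?_
    · obtain ⟨hpS, hpR⟩ := Finset.mem_sigma.1 hp
      simp only [hR, Finset.mem_filter] at hpR
      simp only [Finset.mem_filter, Finset.mk_mem_sym2_iff]
      refine ⟨⟨Finset.mem_union_left _ hpS, ?_⟩, hpR.2.1⟩
      by_cases hpS' : p.2 ∈ S
      · exact Finset.mem_union_left _ hpS'
      · refine Finset.mem_union_right _ (Finset.mem_filter.2 ⟨Finset.mem_univ _, hpR.2.2, hpS', p.1,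
          hpS, graph_adj.2 ⟨hpR.2.1, fun h' => hY p.1 ?_⟩, hP _ _ hpR.1⟩)
        have := hpR.1
        rwa [← h'] at this
    · induction e with
      | h u v =>
        calc _ ≤ ({⟨u, v⟩, ⟨v, u⟩} : Finset (Σ _ : V, V)).card := by
              refine Finset.card_le_card fun p hp => ?_
              obtain ⟨y, z⟩ := p
              have := (Finset.mem_filter.1 hp).2
              rw [Sym2.eq_iff] at this
              rcases this with ⟨rfl, rfl⟩ | ⟨rfl, rfl⟩ <;> simp
          _ ≤ 2 := Finset.card_le_two
  have h1 : (S.card : ℝ) * (6 * b) ≤ 2 * ((T.sym2.filter fun e => x e = true).card : ℝ) := by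
    calc (S.card : ℝ) * (6 * b) = ∑ v ∈ S, 6 * b := by rw [Finset.sum_const, nsmul_eq_mul]
      _ ≤ ∑ v ∈ S, ((R v).card : ℝ) := Finset.sum_le_sum hdeg
      _ ≤ _ := by exact_mod_cast hcount
  have hS0 : (0 : ℝ) < S.card := by exact_mod_cast hne.card_pos
  have hT0 : (0 : ℝ) < T.card := by
    exact_mod_cast (hne.mono Finset.subset_union_left : T.Nonempty).card_pos
  have hb0 : 0 < b := by
    by_contra! hb
    have : b * T.card ≤ 0 := mul_nonpos_of_nonpos_of_nonneg hb hT0.le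
    have : (0 : ℝ) ≤ ((T.sym2.filter fun e => x e = true).card : ℝ) := by positivity
    linarith
  nlinarith

end Typical

end

end RandomSubset

/-! ### Merging paths in a two-sided host -/

namespace HamiltonPath

variable {V : Type*}

lemma mem_pathEdges_append {l₁ l₂ : List V} {e : Sym2 V} :
    e ∈ pathEdges (l₁ ++ l₂) ↔ e ∈ pathEdges l₁ ∨ e ∈ pathEdges l₂ ∨
      ∃ a b, l₁.getLast? = some a ∧ l₂.head? = some b ∧ e = s(a, b) := by
  induction l₁ with
  | nil => simp
  | cons x l ih =>
    cases l with
    | nil =>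
      cases l₂ with
      | nil => simp
      | cons y l₂ => simp [or_comm]
    | cons z l =>
      simp only [List.cons_append, pathEdges_cons_cons, List.mem_cons] at ih ⊢
      rw [ih]
      simp only [List.getLast?_cons_cons]
      tauto

lemma mem_pathEdges_flatten {L : List (List V)} {p : List V} (hp : p ∈ L) {e : Sym2 V}
    (he : e ∈ pathEdges p) : e ∈ pathEdges L.flatten := by
  induction L with
  | nil => simp at hp
  | cons q L ih =>
    rw [List.flatten_cons, mem_pathEdges_append]
    rcases List.mem_cons.1 hp with rfl | hp
    · exact Or.inl he
    · exact Or.inr (Or.inl (ih hp))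

section merge

variable {A : Type*} [AddCommGroup A]

/-- The sum of the values of `f` at the ends of a list. -/
def endSum (f : V → A) (l : List V) : A :=
  (l.head?.map f).getD 0 + (l.getLast?.map f).getD 0

lemma endSum_eq {f : V → A} {l : List V} {a b : V} (ha : l.head? = some a)
    (hb : l.getLast? = some b) : endSum f l = f a + f b := by
  simp [endSum, ha, hb]

lemma exists_ends {l : List V} (hl : l ≠ []) : ∃ a b, l.head? = some a ∧ l.getLast? = some b :=
  ⟨_, _, List.head?_eq_some_head hl, List.getLast?_eq_some_getLast hl⟩

/-- Lists whose ends balance can be merged into one list. -/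
lemma exists_merge {f : V → ℤ} (hf : ∀ v, f v = 1 ∨ f v = -1) (n : ℕ) (P : List (List V))
    (hn : P.length ≤ n) (hP : ∀ p ∈ P, p ≠ []) (hsum : (P.map (endSum f)).sum = 0) :
    ∃ l : List V, l.Perm P.flatten ∧ (∀ p ∈ P, ∀ e ∈ pathEdges p, e ∈ pathEdges l) ∧
      (∀ e ∈ pathEdges l, (∃ p ∈ P, e ∈ pathEdges p) ∨ pairSum f e = 0) ∧
      ∀ a b, l.head? = some a → l.getLast? = some b → f a = 1 ∧ f b = -1 := by
  induction n generalizing P with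
  | zero =>
    obtain rfl : P = [] := List.length_eq_zero_iff.1 (by omega)
    exact ⟨[], by simp⟩
  | succ n ih =>
    have hval : ∀ p ∈ P, endSum f p = 2 ∨ endSum f p = 0 ∨ endSum f p = -2 := by
      intro p hp
      obtain ⟨a, b, ha, hb⟩ := exists_ends (hP p hp)
      rw [endSum_eq ha hb]
      rcases hf a with h1 | h1 <;> rcases hf b with h2 | h2 <;> rw [h1, h2] <;> norm_num
    -- A list with both ends of value 1 followed by one with both ends of value -1: the junction is
    -- a host pair and the result has end sum zero, so the number of lists drops.
    have hmerge : ∀ p₁ p₂ rest, P.Perm (p₁ :: p₂ :: rest) → endSum f p₁ = 2 → endSum f p₂ = -2 →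
        ∃ l : List V, l.Perm P.flatten ∧ (∀ p ∈ P, ∀ e ∈ pathEdges p, e ∈ pathEdges l) ∧
          (∀ e ∈ pathEdges l, (∃ p ∈ P, e ∈ pathEdges p) ∨ pairSum f e = 0) ∧
          ∀ a b, l.head? = some a → l.getLast? = some b → f a = 1 ∧ f b = -1 := by
      intro p₁ p₂ rest hperm h1 h2
      have hlen := hperm.length_eq
      obtain ⟨a₁, b₁, ha₁, hb₁⟩ := exists_ends (hP p₁ (hperm.mem_iff.2 (by simp)))
      obtain ⟨a₂, b₂, ha₂, hb₂⟩ := exists_ends (hP p₂ (hperm.mem_iff.2 (by simp)))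
      have hz : endSum f (p₁ ++ p₂) = 0 := by
        rw [endSum_eq (a := a₁) (b := b₂) (by simp [List.head?_append, ha₁])
          (by simp [List.getLast?_append, hb₂])]
        rw [endSum_eq ha₁ hb₁] at h1
        rw [endSum_eq ha₂ hb₂] at h2
        have := hf a₁; have := hf b₁; have := hf a₂; have := hf b₂
        omega
      have hmid : f b₁ + f a₂ = 0 := by
        rw [endSum_eq ha₁ hb₁] at h1
        rw [endSum_eq ha₂ hb₂] at h2
        have := hf a₁; have := hf b₁; have := hf a₂; have := hf b₂
        omega
      obtain ⟨l, hl1, hl2, hl3, hl4⟩ := ih ((p₁ ++ p₂) :: rest)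
        (by simp only [List.length_cons] at hlen ⊢; omega)
        (by
          intro p hp
          rcases List.mem_cons.1 hp with rfl | hp
          · simp [hP p₁ (hperm.mem_iff.2 (by simp))]
          · exact hP p (hperm.mem_iff.2 (by simp [hp])))
        (by
          have := (hperm.map (endSum f)).sum_eq
          rw [hsum] at this
          simp only [List.map_cons, List.sum_cons, h1, h2] at this
          simp only [List.map_cons, List.sum_cons, hz]
          linarith)
      refine ⟨l, hl1.trans ?_, fun p hp e he => ?_, fun e he => ?_, hl4⟩
      · refine List.Perm.trans ?_ hperm.symm.flatten
        simp
      · rcases List.mem_cons.1 (hperm.mem_iff.1 hp) with rfl | hp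
        · exact hl2 (p ++ p₂) (by simp) e (mem_pathEdges_append.2 (Or.inl he))
        · rcases List.mem_cons.1 hp with rfl | hp
          · exact hl2 (p₁ ++ p) (by simp) e (mem_pathEdges_append.2 (Or.inr (Or.inl he)))
          · exact hl2 p (by simp [hp]) e he
      · rcases hl3 e he with ⟨p, hp, hep⟩ | h
        · rcases List.mem_cons.1 hp with rfl | hp
          · rcases mem_pathEdges_append.1 hep with h | h | ⟨a, b, ha, hb, rfl⟩
            · exact Or.inl ⟨p₁, hperm.mem_iff.2 (by simp), h⟩
            · exact Or.inl ⟨p₂, hperm.mem_iff.2 (by simp), h⟩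
            · rw [hb₁] at ha; rw [ha₂] at hb
              right; rw [pairSum_mk, ← Option.some.inj ha, ← Option.some.inj hb, hmid]
          · exact Or.inl ⟨p, hperm.mem_iff.2 (by simp [hp]), hep⟩
        · exact Or.inr h
    cases P with
    | nil => exact ⟨[], by simp⟩
    | cons p P =>
      -- As the end sums add up to zero, a list with end sum `2` or `-2` has a partner of the
      -- opposite kind.
      have hneg : ∀ c : ℤ, c ≠ 0 → endSum f p = c → (c = 2 ∨ c = -2) →
          ∃ p₂ rest, P.Perm (p₂ :: rest) ∧ endSum f p₂ = -c := by
        intro c hc hpc hc2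
        by_contra! hcon
        have hno : ∀ q ∈ P, endSum f q ≠ -c := fun q hq => by
          obtain ⟨l₁, l₂, h⟩ := List.append_of_mem hq
          exact hcon q (l₁ ++ l₂) (h ▸ List.perm_middle)
        simp only [List.map_cons, List.sum_cons, hpc] at hsum
        rcases hc2 with rfl | rfl
        · have : 0 ≤ (P.map (endSum f)).sum := List.sum_nonneg fun y hy => by
            obtain ⟨q, hq, rfl⟩ := List.mem_map.1 hy
            have h1 := hval q (List.mem_cons_of_mem _ hq)
            have h2 := hno q hq
            omega
          omega
        · have : 0 ≤ ((P.map (endSum f)).map fun y => -y).sum := List.sum_nonneg fun y hy => by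
            obtain ⟨z, hz, rfl⟩ := List.mem_map.1 hy
            obtain ⟨q, hq, rfl⟩ := List.mem_map.1 hz
            have h1 := hval q (List.mem_cons_of_mem _ hq)
            have h2 := hno q hq
            omega
          have h' : ∀ l : List ℤ, (l.map fun y => -y).sum = -l.sum := by
            intro l
            induction l with
            | nil => simp
            | cons y l ih => simp [ih]; ring
          rw [h'] at this
          omega
      rcases hval p (by simp) with h | h | h
      · obtain ⟨p₂, rest, hperm, h2⟩ := hneg 2 (by norm_num) h (Or.inl rfl)
        exact hmerge p p₂ rest (hperm.cons p) h h2
      · obtain ⟨l, hl1, hl2, hl3, hl4⟩ := ih P (by simpa using hn)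
          (fun q hq => hP q (by simp [hq])) (by simpa [h] using hsum)
        obtain ⟨a, b, ha, hb⟩ := exists_ends (hP p (by simp))
        rw [endSum_eq ha hb] at h
        -- A list with end sum zero is oriented from 1 to -1; followed by the merged list, which
        -- also starts at value 1, it has a host pair at the junction.
        have horient : ∃ p' : List V, p'.Perm p ∧ (∀ e, e ∈ pathEdges p' ↔ e ∈ pathEdges p) ∧
            ∃ a b, p'.head? = some a ∧ p'.getLast? = some b ∧ f a = 1 ∧ f b = -1 := by
          rcases hf a with h1 | h1
          · exact ⟨p, .refl _, fun _ => Iff.rfl, a, b, ha, hb, h1, by omega⟩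
          · exact ⟨p.reverse, List.reverse_perm p, fun e => by rw [pathEdges_reverse]; simp,
              b, a, by simpa using hb, by simpa using ha, by omega, h1⟩
        obtain ⟨p', hp'1, hp'2, a', b', ha', hb', hfa, hfb⟩ := horient
        refine ⟨p' ++ l, ?_, fun q hq e he => ?_, fun e he => ?_, fun u v hu hv => ?_⟩
        · rw [List.flatten_cons]; exact hp'1.append hl1
        · rw [mem_pathEdges_append]
          rcases List.mem_cons.1 hq with rfl | hq
          · exact Or.inl ((hp'2 e).2 he)
          · exact Or.inr (Or.inl (hl2 q hq e he))
        · rcases mem_pathEdges_append.1 he with h' | h' | ⟨u, v, hu, hv, rfl⟩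
          · exact Or.inl ⟨p, by simp, (hp'2 e).1 h'⟩
          · rcases hl3 e h' with ⟨q, hq, heq⟩ | h''
            · exact Or.inl ⟨q, by simp [hq], heq⟩
            · exact Or.inr h''
          · rw [hb'] at hu
            have hl : l ≠ [] := by rintro rfl; simp at hv
            obtain ⟨c, d, hc, hd⟩ := exists_ends hl
            have := (hl4 c d hc hd).1
            rw [hc] at hv
            right
            rw [pairSum_mk, ← Option.some.inj hu, ← Option.some.inj hv, hfb, this]
            norm_num
        · rw [List.head?_append, ha'] at hu
          simp only [Option.some_or, Option.some.injEq] at hu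
          subst hu
          refine ⟨hfa, ?_⟩
          by_cases hl : l = []
          · subst hl
            rw [List.append_nil, hb'] at hv
            rw [← Option.some.inj hv, hfb]
          · obtain ⟨c, d, hc, hd⟩ := exists_ends hl
            rw [List.getLast?_append, hd] at hv
            simp only [Option.some_or, Option.some.injEq] at hv
            rw [← hv]; exact (hl4 c d hc hd).2
      · obtain ⟨p₂, rest, hperm, h2⟩ := hneg (-2) (by norm_num) h (Or.inr rfl)
        refine hmerge p₂ p rest ?_ (by simpa using h2) h
        exact (hperm.cons p).trans (List.Perm.swap _ _ _)

end merge

end HamiltonPath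

/-! ### Initial admissible lists for the three hosts -/

namespace RandomSubset

open HamiltonPath

variable {V : Type*} [DecidableEq V]

/-- The lists `g s false, s, g s true` for `s` in `A`, and singletons for the other vertices
of `B`. -/
noncomputable def pieces (A : Finset V) (g : V → Bool → V) (B : Finset V) : List (List V) :=
  (A.toList.map fun s => [g s false, s, g s true]) ++ (B \ core A g).toList.map fun v => [v]

variable {A B : Finset V} {x : Sym2 V → Bool} {g : V → Bool → V}

lemma ne_nil_of_mem_pieces {p : List V} (hp : p ∈ pieces A g B) : p ≠ [] := by
  simp only [pieces, List.mem_append, List.mem_map] at hp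
  rcases hp with ⟨s, -, rfl⟩ | ⟨v, -, rfl⟩ <;> simp

lemma exists_of_mem_pieces {p : List V} (hp : p ∈ pieces A g B) {e : Sym2 V}
    (he : e ∈ pathEdges p) : ∃ s ∈ A, ∃ b, e = s(s, g s b) := by
  simp only [pieces, List.mem_append, List.mem_map] at hp
  rcases hp with ⟨s, hs, rfl⟩ | ⟨v, -, rfl⟩
  · simp only [pathEdges_cons_cons, pathEdges_singleton, List.mem_cons, List.not_mem_nil,
      or_false] at he
    refine ⟨s, by simpa using hs, ?_⟩
    rcases he with rfl | rfl
    · exact ⟨false, Sym2.eq_swap⟩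
    · exact ⟨true, rfl⟩
  · simp at he

lemma mem_pathEdges_pieces {s : V} (hs : s ∈ A) (b : Bool) :
    ∃ p ∈ pieces A g B, s(s, g s b) ∈ pathEdges p := by
  refine ⟨[g s false, s, g s true], ?_, ?_⟩
  · simp only [pieces, List.mem_append, List.mem_map]
    exact Or.inl ⟨s, by simpa using hs, rfl⟩
  · cases b <;> simp [Sym2.eq_swap]

lemma mem_flatten_pieces (hB : core A g ⊆ B) {v : V} : v ∈ (pieces A g B).flatten ↔ v ∈ B := by
  have h1 : v ∈ (pieces A g B).flatten ↔ v ∈ core A g ∨ v ∈ B \ core A g := by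
    rw [mem_core]
    simp only [pieces, List.flatten_append, List.mem_append, List.mem_flatten, List.mem_map,
      exists_exists_and_eq_and, Finset.mem_toList]
    refine or_congr ?_ (by simp)
    constructor
    · rintro ⟨s, hs, h⟩
      simp only [List.mem_cons, List.not_mem_nil, or_false] at h
      rcases h with rfl | rfl | rfl
      · exact Or.inr ⟨s, hs, _, rfl⟩
      · exact Or.inl hs
      · exact Or.inr ⟨s, hs, _, rfl⟩
    · rintro (h | ⟨s, hs, b, rfl⟩)
      · exact ⟨v, h, by simp⟩
      · exact ⟨s, hs, by cases b <;> simp⟩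
  rw [h1, Finset.mem_sdiff]
  have := @hB v
  tauto

lemma nodup_flatten_pieces (hg : Attached A x g) : (pieces A g B).flatten.Nodup := by
  rw [pieces, List.flatten_append, List.nodup_append]
  refine ⟨?_, ?_, ?_⟩
  · rw [List.nodup_flatten]
    constructor
    · intro l hl
      obtain ⟨s, hs, rfl⟩ := List.mem_map.1 hl
      rw [Finset.mem_toList] at hs
      have h1 : ∀ b, g s b ≠ s := fun b h => hg.notMem s hs b (h.symm ▸ hs)
      have h2 : g s false ≠ g s true := fun h => by simpa using (hg.inj s hs s hs _ _ h).2
      simp [h1, h2, (h1 true).symm]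
    · rw [List.pairwise_map]
      refine (Finset.nodup_toList A).imp_of_mem fun {s s'} hs hs' hne => ?_
      rw [Finset.mem_toList] at hs hs'
      have h1 : ∀ b b', g s b ≠ g s' b' := fun b b' h => hne (hg.inj s hs s' hs' _ _ h).1
      have h2 : ∀ b, g s b ≠ s' := fun b h => hg.notMem s hs b (h ▸ hs')
      have h3 : ∀ b, s ≠ g s' b := fun b h => hg.notMem s' hs' b (h ▸ hs)
      intro v hv hv'
      simp only [List.mem_cons, List.not_mem_nil, or_false] at hv hv'
      rcases hv with rfl | rfl | rfl <;> rcases hv' with h | h | h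
      exacts [h1 _ _ h, h2 _ h, h1 _ _ h, h3 _ h, hne h, h3 _ h, h1 _ _ h, h2 _ h, h1 _ _ h]
  · have : ((B \ core A g).toList.map fun v => [v]).flatten = (B \ core A g).toList := by
      induction (B \ core A g).toList with
      | nil => rfl
      | cons a l ih => simpa using ih
    rw [this]; exact Finset.nodup_toList _
  · intro u hu v hv huv
    subst huv
    simp only [List.mem_flatten, List.mem_map, exists_exists_and_eq_and, Finset.mem_toList,
      List.mem_singleton] at hu hv
    obtain ⟨v, hv, rfl⟩ := hv
    refine (Finset.mem_sdiff.1 hv).2 (mem_core.2 ?_)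
    obtain ⟨s, hs, h⟩ := hu
    simp only [List.mem_cons, List.not_mem_nil, or_false] at h
    rcases h with rfl | rfl | rfl
    · exact Or.inr ⟨s, hs, _, rfl⟩
    · exact Or.inl hs
    · exact Or.inr ⟨s, hs, _, rfl⟩

lemma sum_endSum_pieces {f : V → ℤ} : ((pieces A g B).map (endSum f)).sum =
    ∑ s ∈ A, (f (g s false) + f (g s true)) + 2 * ∑ v ∈ B \ core A g, f v := by
  rw [pieces, List.map_append, List.sum_append, List.map_map, List.map_map,
    Finset.sum_map_toList, Finset.sum_map_toList, Finset.mul_sum]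
  congr 1
  refine Finset.sum_congr rfl fun v _ => ?_
  simp [endSum, two_mul]

lemma sum_core {f : V → ℤ} (hg : Attached A x g) : ∑ v ∈ core A g, f v =
    ∑ s ∈ A, (f s + f (g s false) + f (g s true)) := by
  rw [core, Finset.sum_union, Finset.sum_biUnion]
  · rw [← Finset.sum_add_distrib]
    refine Finset.sum_congr rfl fun s hs => ?_
    rw [Finset.sum_image fun b _ b' _ h => (hg.inj s hs s hs _ _ h).2, Fintype.sum_bool]
    ring
  · intro s hs s' hs' hne
    rw [Function.onFun, Finset.disjoint_left]
    intro u hu hu'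
    obtain ⟨b, -, rfl⟩ := Finset.mem_image.1 hu
    obtain ⟨b', -, h⟩ := Finset.mem_image.1 hu'
    exact hne (hg.inj s hs s' hs' _ _ h.symm).1
  · rw [Finset.disjoint_left]
    intro u hu hu'
    obtain ⟨s, hs, hus⟩ := Finset.mem_biUnion.1 hu'
    obtain ⟨b, -, rfl⟩ := Finset.mem_image.1 hus
    exact hg.notMem s hs b hu

end RandomSubset

namespace RandomSubset

open HamiltonPath

variable {V : Type*} [Fintype V] [DecidableEq V] {A : Finset V} {x : Sym2 V → Bool}
  {g : V → Bool → V}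

/-- The pairs that join the vertices of `A` to their private neighbours. -/
def forced (A : Finset V) (g : V → Bool → V) : Finset (Sym2 V) :=
  A.biUnion fun s => Finset.univ.image fun b => s(s, g s b)

omit [Fintype V] in
lemma mem_forced {e : Sym2 V} : e ∈ forced A g ↔ ∃ s ∈ A, ∃ b, s(s, g s b) = e := by
  simp only [forced, Finset.mem_biUnion, Finset.mem_image, Finset.mem_univ, true_and]

open Classical in
/-- Sets without vertices of `A` expand into the complement of `F`. -/
def Expands {B : Type*} [AddCommGroup B] (f : V → B) (F A : Finset V) (m : ℕ)
    (Γ : SimpleGraph V) : Prop :=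
  ∀ S : Finset V, S.Nonempty → Disjoint S A → S.card ≤ m →
    2 * S.card <
      (Finset.univ.filter fun u => u ∉ F ∧ u ∉ S ∧ ∃ v ∈ S, Γ.Adj v u ∧ f v + f u = 0).card

section

variable {B : Type*} [AddCommGroup B] {f : V → B} {F : Finset V} {m : ℕ}
  {Γ : SimpleGraph V} {M : Finset (Sym2 V)} {l : List V}

/-- Collects what the three hosts have in common. Each vertex of `A` lies on two forced pairs, one
for each private neighbour; `M` holds the additional forced links or the balancing path. -/
lemma Attached.rotationSetup (hg : Attached A x g) (h3 : 3 ≤ Fintype.card V)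
    (hΓ : graph x ≤ Γ) (hM : ∀ e ∈ M, e ∈ Γ.edgeSet) (hMF : ∀ e ∈ M, ∀ v ∈ e, v ∈ F)
    (hl : l.Nodup) (hmem : ∀ v, v ∈ l) (hlg : ∀ s ∈ A, ∀ b, s(s, g s b) ∈ pathEdges l)
    (hlM : ∀ e ∈ M, e ∈ pathEdges l)
    (hhost : ∀ e ∈ pathEdges l, (∃ s ∈ A, ∃ b, e = s(s, g s b)) ∨ e ∈ M ∨ pairSum f e = 0)
    (hclose : ∀ a b, l.head? = some a → l.getLast? = some b → f a + f b = 0)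
    (hexp : Expands f (core A g ∪ F) A m Γ) :
    RotationSetup f (forced A g ∪ M) (core A g ∪ F) A l m Γ where
  three_le := h3
  admissible :=
    { nodup := hl
      mem := hmem
      subset := fun e he => by
        rcases Finset.mem_union.1 he with he | he
        · obtain ⟨s, hs, b, rfl⟩ := mem_forced.1 he
          exact hlg s hs b
        · exact hlM e he
      host := fun e he => by
        rw [Finset.mem_union]
        rcases hhost e he with ⟨s, hs, b, rfl⟩ | h | h
        · exact Or.inl (Or.inl (mem_forced.2 ⟨s, hs, b, rfl⟩))
        · exact Or.inl (Or.inr h)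
        · exact Or.inr h }
  closes := hclose
  touched := fun e he v hv => by
    rw [Finset.mem_union]
    rcases Finset.mem_union.1 he with he | he
    · obtain ⟨s, hs, b, rfl⟩ := mem_forced.1 he
      refine Or.inl (mem_core.2 ?_)
      rcases Sym2.mem_iff.1 hv with rfl | rfl
      · exact Or.inl hs
      · exact Or.inr ⟨s, hs, b, rfl⟩
    · exact Or.inr (hMF e he v hv)
  subset := fun e he => by
    rcases Finset.mem_union.1 he with he | he
    · obtain ⟨s, hs, b, rfl⟩ := mem_forced.1 he
      exact hΓ (graph_adj.2 ⟨hg.adj s hs b, fun h : s = g s b => hg.notMem s hs b (h ▸ hs)⟩)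
    · exact hM e he
  two_forced := fun s hs => by
    refine ⟨s(s, g s false), Finset.mem_union_left _ (mem_forced.2 ⟨s, hs, _, rfl⟩),
      s(s, g s true), Finset.mem_union_left _ (mem_forced.2 ⟨s, hs, _, rfl⟩), fun h => ?_,
      Sym2.mem_mk_left _ _, Sym2.mem_mk_left _ _⟩
    have := Sym2.congr_right.1 h
    simpa using (hg.inj s hs s hs _ _ this).2
  expand := hexp

/-- The rotation setup when all pairs may be used. -/
lemma Attached.exists_rotationSetup (hg : Attached A x g) (h3 : 3 ≤ Fintype.card V)
    (hf : ∀ v, f v = 0) (hexp : Expands f (core A g) A m (graph x)) :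
    ∃ M F l, RotationSetup f M F A l m (graph x) := by
  refine ⟨_, _, _, hg.rotationSetup (M := ∅) (F := ∅) (l := (pieces A g Finset.univ).flatten) h3
    le_rfl (by simp) (by simp) (nodup_flatten_pieces hg) (fun v => ?_) (fun s hs b => ?_)
    (by simp) (fun e _ => ?_) (fun a b _ _ => by simp [hf]) (by simpa using hexp)⟩
  · exact (mem_flatten_pieces (Finset.subset_univ _)).2 (Finset.mem_univ _)
  · obtain ⟨p, hp, he⟩ := mem_pathEdges_pieces (B := Finset.univ) hs b
    exact mem_pathEdges_flatten hp he
  · induction e with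
    | h u v => simp [hf]

end

/-- The rotation setup for two classes whose sizes are balanced by a path inside one class. -/
lemma Attached.exists_rotationSetup_of_path (hg : Attached A x g) (h3 : 3 ≤ Fintype.card V)
    {f : V → ℤ} (hf : ∀ v, f v = 1 ∨ f v = -1) {Γ : SimpleGraph V} (hΓ : graph x ≤ Γ)
    {Q : List V} (hQ : Q ≠ []) (hQn : Q.Nodup) (hQc : ∀ v ∈ Q, v ∉ core A g)
    (hQf : ∀ v ∈ Q, f v = -1) (hQΓ : ∀ e ∈ pathEdges Q, e ∈ Γ.edgeSet)
    (hlen : 2 * ((Q.length : ℤ) - 1) =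
      ∑ s ∈ A, (2 * f s + f (g s false) + f (g s true)) - 2 * ∑ v, f v) {m : ℕ}
    (hexp : Expands f (core A g ∪ Q.toFinset) A m Γ) :
    ∃ M F l, RotationSetup f M F A l m Γ := by
  classical
  set B : Finset V := Finset.univ \ Q.toFinset with hB
  have hcB : core A g ⊆ B := fun v hv => by
    simp only [hB, Finset.mem_sdiff, Finset.mem_univ, true_and, List.mem_toFinset]
    exact fun h => hQc v h hv
  obtain ⟨a, b, ha, hb⟩ := exists_ends hQ
  -- The path `Q` contributes -2 whatever its length, while its inner vertices are withdrawn from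
  -- the supply of singletons. The length condition says exactly that all end sums cancel.
  have hsum : ((Q :: pieces A g B).map (endSum f)).sum = 0 := by
    have hQsum : ∑ v ∈ Q.toFinset, f v = -Q.length := by
      rw [Finset.sum_congr rfl fun v hv => hQf v (by simpa using hv), Finset.sum_const,
        List.toFinset_card_of_nodup hQn]
      simp
    have h1 : ∑ v, f v = ∑ v ∈ B, f v + ∑ v ∈ Q.toFinset, f v :=
      (Finset.sum_sdiff (Finset.subset_univ _)).symm
    have h2 : ∑ v ∈ B, f v = ∑ v ∈ B \ core A g, f v + ∑ v ∈ core A g, f v :=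
      (Finset.sum_sdiff hcB).symm
    rw [List.map_cons, List.sum_cons, sum_endSum_pieces, endSum_eq ha hb,
      hQf a (List.mem_of_head? ha), hQf b (List.mem_of_getLast? hb)]
    rw [h1, h2, hQsum, sum_core hg] at hlen
    simp only [Finset.sum_add_distrib, ← Finset.mul_sum] at hlen ⊢
    linarith
  obtain ⟨l, hl1, hl2, hl3, hl4⟩ := exists_merge hf _ (Q :: pieces A g B) le_rfl (fun p hp => by
    rcases List.mem_cons.1 hp with rfl | hp
    · exact hQ
    · exact ne_nil_of_mem_pieces hp) hsum
  refine ⟨_, _, l, hg.rotationSetup (M := (pathEdges Q).toFinset) (F := Q.toFinset) h3 hΓ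
    (fun e he => hQΓ e (by simpa using he)) (fun e he v hv => ?_) ?_ (fun v => ?_)
    (fun s hs b => ?_) (fun e he => ?_) (fun e he => ?_) (fun u v hu hv => ?_) hexp⟩
  · exact List.mem_toFinset.2 (mem_of_mem_pathEdges (by simpa using he) hv)
  · rw [hl1.nodup_iff, List.flatten_cons, List.nodup_append]
    refine ⟨hQn, nodup_flatten_pieces hg, fun u hu v hv huv => ?_⟩
    subst huv
    have := (mem_flatten_pieces hcB).1 hv
    simp only [hB, Finset.mem_sdiff, List.mem_toFinset] at this
    exact this.2 hu
  · rw [hl1.mem_iff, List.flatten_cons, List.mem_append, mem_flatten_pieces hcB]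
    simp only [hB, Finset.mem_sdiff, Finset.mem_univ, true_and, List.mem_toFinset]
    tauto
  · obtain ⟨p, hp, he⟩ := mem_pathEdges_pieces (B := B) hs b
    exact hl2 p (List.mem_cons_of_mem _ hp) _ he
  · exact hl2 Q (by simp) e (by simpa using he)
  · rcases hl3 e he with ⟨p, hp, hep⟩ | h
    · rcases List.mem_cons.1 hp with rfl | hp
      · exact Or.inr (Or.inl (by simpa using hep))
      · exact Or.inl (exists_of_mem_pieces hp hep)
    · exact Or.inr (Or.inr h)
  · rw [(hl4 u v hu hv).1, (hl4 u v hu hv).2]; norm_num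

/-- The indicator of the class of a vertex, as a function whose sums vanish on the pairs inside
the classes. -/
def classIndicator {k : ℕ} (β : V → Fin k) (v : V) : Fin k → ZMod 2 := Pi.single (β v) 1

omit [Fintype V] [DecidableEq V] in
lemma classIndicator_add_eq_zero {k : ℕ} {β : V → Fin k} {u v : V} :
    classIndicator β u + classIndicator β v = 0 ↔ β u = β v := by
  constructor
  · intro h
    by_contra hne
    have := congrFun h (β u)
    simp [classIndicator, hne] at this
  · intro h
    rw [classIndicator, classIndicator, h, ← Pi.single_add]
    have : (1 + 1 : ZMod 2) = 0 := by decide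
    rw [this, Pi.single_zero]

omit [Fintype V] [DecidableEq V] in
lemma Attached.subset (hg : Attached A x g) {A' : Finset V} (hA : A' ⊆ A) : Attached A' x g where
  notMem s hs b h := hg.notMem s (hA hs) b (hA h)
  adj s hs := hg.adj s (hA hs)
  inj s hs s' hs' := hg.inj s (hA hs) s' (hA hs')

/-- The rotation setup for classes that are arranged in a cycle and joined by given links. -/
lemma Attached.exists_rotationSetup_of_links (hg : Attached A x g) (h3 : 3 ≤ Fintype.card V)
    {k : ℕ} {β : V → Fin (k + 1)} (hβg : ∀ s ∈ A, ∀ b, β (g s b) = β s) {Γ : SimpleGraph V}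
    (hΓ : graph x ≤ Γ) {a b : Fin (k + 1) → V} (ha : ∀ i, β (a i) = i) (hb : ∀ i, β (b i) = i)
    (hab : ∀ i, a i ≠ b i) (hac : ∀ i, a i ∉ core A g) (hbc : ∀ i, b i ∉ core A g)
    (hadj : ∀ i, Γ.Adj (b i) (a (i + 1))) {m : ℕ}
    (hexp : Expands (classIndicator β)
      (core A g ∪ (Finset.univ.image a ∪ Finset.univ.image b)) A m Γ) :
    ∃ M F l, RotationSetup (classIndicator β) M F A l m Γ := by
  classical
  set As : Fin (k + 1) → Finset V := fun i => A.filter fun s => β s = i with hAs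
  set Bs : Fin (k + 1) → Finset V :=
    fun i => Finset.univ.filter fun v => β v = i ∧ v ≠ a i ∧ v ≠ b i with hBs
  have hsub : ∀ i, core (As i) g ⊆ Bs i := by
    intro i v hv
    have hvc : v ∈ core A g := by
      rw [mem_core] at hv ⊢
      simp only [hAs, Finset.mem_filter] at hv
      rcases hv with hv | ⟨s, hs, c, rfl⟩
      · exact Or.inl hv.1
      · exact Or.inr ⟨s, hs.1, c, rfl⟩
    simp only [hBs, Finset.mem_filter, Finset.mem_univ, true_and]
    refine ⟨?_, fun h => hac i (h ▸ hvc), fun h => hbc i (h ▸ hvc)⟩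
    rw [mem_core] at hv
    simp only [hAs, Finset.mem_filter] at hv
    rcases hv with hv | ⟨s, hs, c, rfl⟩
    · exact hv.2
    · rw [hβg s hs.1, hs.2]
  have hgs : ∀ i, Attached (As i) x g := fun i => hg.subset (Finset.filter_subset _ _)
  set r : Fin (k + 1) → List V := fun i => (pieces (As i) g (Bs i)).flatten with hr
  have hmemr : ∀ i v, v ∈ r i ↔ β v = i ∧ v ≠ a i ∧ v ≠ b i := fun i v => by
    rw [hr, mem_flatten_pieces (hsub i)]; simp [hBs]
  -- Chunk `i` covers class `i` except for `a i` and then crosses to `a (i + 1)`. The concatenation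
  -- therefore starts in class 0 and ends with `a 0`, so its ends form a pair inside a class.
  set c : Fin (k + 1) → List V := fun i => r i ++ [b i, a (i + 1)] with hc
  have hmemc : ∀ i v, v ∈ c i ↔ (β v = i ∧ v ≠ a i) ∨ v = a (i + 1) := fun i v => by
    simp only [hc, List.mem_append, List.mem_cons, List.not_mem_nil, or_false, hmemr]
    constructor
    · rintro (h | rfl | h)
      · exact Or.inl ⟨h.1, h.2.1⟩
      · exact Or.inl ⟨hb i, (hab i).symm⟩
      · exact Or.inr h
    · rintro (h | h)
      · by_cases hv : v = b i
        · exact Or.inr (Or.inl hv)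
        · exact Or.inl ⟨h.1, h.2, hv⟩
      · exact Or.inr (Or.inr h)
  have hhead : ∀ i v, (c i).head? = some v → β v = i := by
    intro i v hv
    simp only [hc, List.head?_append] at hv
    cases hri : (r i).head? with
    | none => rw [hri] at hv; simp at hv; rw [← hv, hb]
    | some w =>
      rw [hri] at hv
      simp only [Option.some_or, Option.some.injEq] at hv
      subst hv
      exact ((hmemr i w).1 (List.mem_of_head? hri)).1
  have hlast : ∀ i, (c i).getLast? = some (a (i + 1)) := fun i => by simp [hc]
  have hcne : ∀ i, c i ≠ [] := fun i => by simp [hc]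
  set l : List V := ((List.finRange (k + 1)).map c).flatten with hl
  have hcl : ∀ i, c i ∈ (List.finRange (k + 1)).map c := fun i =>
    List.mem_map_of_mem (List.mem_finRange i)
  have hbe : ∀ i, s(b i, a (i + 1)) ∈ pathEdges l := fun i =>
    mem_pathEdges_flatten (hcl i) <| by
      rw [hc, mem_pathEdges_append]; right; left; simp
  have hinner : ∀ i, ∀ e ∈ pathEdges (c i), e = s(b i, a (i + 1)) ∨
      pairSum (classIndicator β) e = 0 := by
    intro i e he
    have h0 : ∀ u v, u ∈ r i ++ [b i] → v ∈ r i ++ [b i] →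
        pairSum (classIndicator β) s(u, v) = 0 := by
      intro u v hu hv
      have h1 : ∀ w, w ∈ r i ++ [b i] → β w = i := by
        intro w hw
        simp only [List.mem_append, List.mem_singleton, hmemr] at hw
        rcases hw with hw | rfl
        · exact hw.1
        · exact hb i
      rw [pairSum_mk, classIndicator_add_eq_zero, h1 u hu, h1 v hv]
    have h2 : c i = (r i ++ [b i]) ++ [a (i + 1)] := by simp [hc]
    rw [h2, mem_pathEdges_append] at he
    rcases he with he | he | ⟨u, v, hu, hv, rfl⟩
    · obtain ⟨l₁, u, v, l₂, h, rfl⟩ := exists_of_mem_pathEdges he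
      exact Or.inr (h0 u v (by rw [h]; simp) (by rw [h]; simp))
    · simp at he
    · left
      simp only [List.getLast?_append, List.getLast?_singleton, Option.some_or,
        Option.some.injEq, List.head?_cons] at hu hv
      rw [hu, hv]
  refine ⟨_, _, l, hg.rotationSetup
    (M := Finset.univ.image fun i => s(b i, a (i + 1)))
    (F := Finset.univ.image a ∪ Finset.univ.image b) h3 hΓ (fun e he => ?_)
    (fun e he v hv => ?_) ?_ (fun v => ?_) (fun s hs d => ?_) (fun e he => ?_) (fun e he => ?_)
    (fun u v hu hv => ?_) hexp⟩
  · obtain ⟨i, -, rfl⟩ := Finset.mem_image.1 he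
    exact hadj i
  · obtain ⟨i, -, rfl⟩ := Finset.mem_image.1 he
    rw [Finset.mem_union]
    rcases Sym2.mem_iff.1 hv with rfl | rfl
    · exact Or.inr (Finset.mem_image_of_mem _ (Finset.mem_univ _))
    · exact Or.inl (Finset.mem_image_of_mem _ (Finset.mem_univ _))
  · rw [hl, List.nodup_flatten]
    constructor
    · intro p hp
      obtain ⟨i, -, rfl⟩ := List.mem_map.1 hp
      have hai : a (i + 1) ∉ r i := fun h => by
        have h1 := (hmemr i _).1 h
        have h2 := h1.1
        rw [ha] at h2
        rw [h2] at h1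
        exact h1.2.1 rfl
      have hba : b i ≠ a (i + 1) := (hadj i).ne
      have hbi : b i ∉ r i := fun h => ((hmemr i _).1 h).2.2 rfl
      simp only [hc]
      rw [List.nodup_append]
      refine ⟨nodup_flatten_pieces (hgs i), by simpa using hba, fun u hu v hv huv => ?_⟩
      subst huv
      simp only [List.mem_cons, List.not_mem_nil, or_false] at hv
      rcases hv with rfl | rfl
      · exact hbi hu
      · exact hai hu
    · rw [List.pairwise_map]
      refine (List.nodup_finRange (k + 1)).imp fun {i j} hij => ?_
      intro v hv hv'
      rw [hmemc] at hv hv'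
      rcases hv with ⟨h1, h2⟩ | rfl
      · rcases hv' with ⟨h3, h4⟩ | rfl
        · exact hij (h1.symm.trans h3)
        · rw [ha] at h1; rw [h1] at h2; exact h2 rfl
      · rcases hv' with ⟨h3, h4⟩ | h
        · rw [ha] at h3; rw [h3] at h4; exact h4 rfl
        · have := congrArg β h
          rw [ha, ha] at this
          exact hij (add_right_cancel this)
  · rw [hl, List.mem_flatten]
    -- The entry vertex of a class belongs to the preceding chunk, cyclically.
    by_cases hv : v = a (β v)
    · exact ⟨_, hcl (β v - 1), (hmemc _ _).2 (Or.inr (by rw [sub_add_cancel]; exact hv))⟩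
    · exact ⟨_, hcl (β v), (hmemc _ _).2 (Or.inl ⟨rfl, hv⟩)⟩
  · have hs' : s ∈ As (β s) := Finset.mem_filter.2 ⟨hs, rfl⟩
    obtain ⟨p, hp, he⟩ := mem_pathEdges_pieces (B := Bs (β s)) hs' d
    refine mem_pathEdges_flatten (hcl (β s)) ?_
    rw [hc, mem_pathEdges_append]
    exact Or.inl (mem_pathEdges_flatten hp he)
  · obtain ⟨i, -, rfl⟩ := Finset.mem_image.1 he
    exact hbe i
  · right
    have key : ∀ e ∈ pathEdges l, e ∈ (Finset.univ.image fun i => s(b i, a (i + 1))) ∨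
        pairSum (classIndicator β) e = 0 := by
      rw [hl]
      have hchain : ∀ (n j : ℕ) (hj : n + j = k + 1), ∀ e ∈ pathEdges
          (((List.finRange (k + 1)).drop j).map c).flatten,
          e ∈ (Finset.univ.image fun i => s(b i, a (i + 1))) ∨
          pairSum (classIndicator β) e = 0 := by
        intro n
        induction n with
        | zero => intro j hj e he; rw [List.drop_of_length_le (by simp; omega)] at he; simp at he
        | succ n ih =>
          intro j hj e he
          have hjk : j < k + 1 := by omega
          rw [List.drop_eq_getElem_cons (by simpa using hjk), List.map_cons, List.flatten_cons,
            mem_pathEdges_append] at he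
          simp only [List.getElem_finRange] at he
          rcases he with he | he | ⟨u, v, hu, hv, rfl⟩
          · rcases hinner _ e he with rfl | h
            · exact Or.inl (Finset.mem_image_of_mem (fun i => s(b i, a (i + 1)))
                (Finset.mem_univ _))
            · exact Or.inr h
          · exact ih (j + 1) (by omega) e he
          · right
            rw [hlast] at hu
            rw [pairSum_mk, classIndicator_add_eq_zero, ← Option.some.inj hu, ha]
            by_cases hj1 : j + 1 < k + 1
            · rw [List.drop_eq_getElem_cons (by simpa using hj1), List.map_cons,
                List.flatten_cons, List.head?_append_of_ne_nil _ (hcne _)] at hv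
              rw [hhead _ _ hv]
              ext
              simp only [List.getElem_finRange, Fin.val_cast]
              rw [Fin.val_add_one_of_lt]
              · rfl
              · exact Fin.lt_last_iff_ne_last.2 fun h => by
                  have := congrArg Fin.val h; simp at this; omega
            · rw [List.drop_of_length_le (by simp; omega)] at hv; simp at hv
      exact hchain (k + 1) 0 rfl
    exact key e he
  · rw [classIndicator_add_eq_zero]
    have h1 : β u = 0 := by
      rw [hl, List.finRange_succ, List.map_cons, List.flatten_cons,
        List.head?_append_of_ne_nil _ (hcne _)] at hu
      exact hhead _ _ hu
    have h2 : v = a 0 := by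
      rw [hl, List.finRange_succ_last, List.map_append, List.flatten_append] at hv
      simp only [List.map_cons, List.map_nil, List.flatten_cons, List.flatten_nil,
        List.append_nil] at hv
      rw [List.getLast?_append_of_ne_nil _ (hcne _), hlast, Fin.last_add_one] at hv
      exact (Option.some.inj hv).symm
    rw [h1, h2, ha]

end RandomSubset

/-! ### Long paths by depth first search -/

namespace HamiltonPath

variable {V : Type*}

lemma isChain_of_forall_pathEdges {P : Sym2 V → Prop} {l : List V} :
    l.IsChain (fun a b => P s(a, b)) ↔ ∀ e ∈ pathEdges l, P e := by
  induction l with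
  | nil => simp
  | cons a l ih =>
    cases l with
    | nil => simp
    | cons b l => simp only [List.isChain_cons_cons, ih, pathEdges_cons_cons, List.forall_mem_cons]

lemma mem_pathEdges_of_take {l : List V} {n : ℕ} {e : Sym2 V} (he : e ∈ pathEdges (l.take n)) :
    e ∈ pathEdges l := by
  rw [← List.take_append_drop n l, mem_pathEdges_append]
  exact Or.inl he

variable [DecidableEq V]

/-- Depth first search, stopped when as many vertices have been discarded as are unexplored. -/
lemma exists_depth_first_search {R : V → V → Prop} (hR : ∀ u v, R u v → R v u) (n : ℕ)
    {S T : Finset V} {l : List V} (hn : 2 * T.card + l.length ≤ n) (hl : l.Nodup)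
    (hc : l.IsChain R) (hST : Disjoint S T) (hS : ∀ v ∈ l, v ∉ S) (hT : ∀ v ∈ l, v ∉ T)
    (hno : ∀ u ∈ S, ∀ v ∈ T, ¬ R u v) (hle : S.card ≤ T.card) :
    ∃ (S' T' : Finset V) (l' : List V), l'.Nodup ∧ l'.IsChain R ∧ Disjoint S' T' ∧
      (∀ v ∈ l', v ∉ S') ∧ (∀ v ∈ l', v ∉ T') ∧ (∀ u ∈ S', ∀ v ∈ T', ¬ R u v) ∧
      S'.card = T'.card ∧ S' ∪ T' ∪ l'.toFinset = S ∪ T ∪ l.toFinset := by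
  -- Both moves, from `T` to the stack and from the stack to `S`, lower `2 * T.card + l.length` by
  -- one. They also lower `T.card - S.card` by one, so equality is reached.
  induction n generalizing S T l with
  | zero =>
    have : T.card = 0 := by omega
    exact ⟨S, T, l, hl, hc, hST, hS, hT, hno, by omega, rfl⟩
  | succ n ih =>
    by_cases heq : S.card = T.card
    · exact ⟨S, T, l, hl, hc, hST, hS, hT, hno, heq, rfl⟩
    have hpush : ∀ u ∈ T, (u :: l).IsChain R → ∃ (S' T' : Finset V) (l' : List V), l'.Nodup ∧
        l'.IsChain R ∧ Disjoint S' T' ∧ (∀ v ∈ l', v ∉ S') ∧ (∀ v ∈ l', v ∉ T') ∧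
        (∀ u ∈ S', ∀ v ∈ T', ¬ R u v) ∧ S'.card = T'.card ∧
        S' ∪ T' ∪ l'.toFinset = S ∪ T ∪ l.toFinset := by
      intro u hu hchain
      have hcard := Finset.card_erase_of_mem hu
      have hpos : 0 < T.card := Finset.card_pos.2 ⟨u, hu⟩
      obtain ⟨S', T', l', h⟩ := ih (S := S) (T := T.erase u) (l := u :: l)
        (by rw [hcard, List.length_cons]; omega)
        (List.nodup_cons.2 ⟨fun h => hT u h hu, hl⟩) hchain
        (hST.mono_right (Finset.erase_subset _ _))
        (fun v hv => by
          rcases List.mem_cons.1 hv with rfl | hv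
          · exact Finset.disjoint_right.1 hST hu
          · exact hS v hv)
        (fun v hv => by
          rcases List.mem_cons.1 hv with rfl | hv
          · simp
          · exact fun h => hT v hv (Finset.mem_of_mem_erase h))
        (fun a ha b hb => hno a ha b (Finset.mem_of_mem_erase hb)) (by omega)
      refine ⟨S', T', l', h.1, h.2.1, h.2.2.1, h.2.2.2.1, h.2.2.2.2.1, h.2.2.2.2.2.1,
        h.2.2.2.2.2.2.1, h.2.2.2.2.2.2.2.trans ?_⟩
      ext v
      simp only [Finset.mem_union, Finset.mem_erase, List.mem_toFinset, List.mem_cons]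
      by_cases hv : v = u
      · subst hv; simp [hu]
      · simp [hv]
    cases l with
    | nil =>
      obtain ⟨u, hu⟩ : T.Nonempty := Finset.card_pos.1 (by omega)
      exact hpush u hu (by simp)
    | cons v l =>
      by_cases hv : ∃ u ∈ T, R u v
      · obtain ⟨u, hu, huv⟩ := hv
        exact hpush u hu (List.isChain_cons_cons.2 ⟨huv, hc⟩)
      · push Not at hv
        have hvS : v ∉ S := hS v (by simp)
        obtain ⟨S', T', l', h⟩ := ih (S := insert v S) (T := T) (l := l)
          (by simp only [List.length_cons] at hn; omega) hl.of_cons hc.of_cons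
          (by rw [Finset.disjoint_insert_left]; exact ⟨hT v (by simp), hST⟩)
          (fun u hu => by
            rw [Finset.mem_insert, not_or]
            exact ⟨fun h => (List.nodup_cons.1 hl).1 (h ▸ hu), hS u (by simp [hu])⟩)
          (fun u hu => hT u (by simp [hu]))
          (fun a ha b hb => by
            rcases Finset.mem_insert.1 ha with rfl | ha
            · exact fun h => hv b hb (hR _ _ h)
            · exact hno a ha b hb)
          (by rw [Finset.card_insert_of_notMem hvS]; omega)
        refine ⟨S', T', l', h.1, h.2.1, h.2.2.1, h.2.2.2.1, h.2.2.2.2.1, h.2.2.2.2.2.1,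
          h.2.2.2.2.2.2.1, h.2.2.2.2.2.2.2.trans ?_⟩
        ext u
        simp only [Finset.mem_union, Finset.mem_insert, List.mem_toFinset, List.mem_cons]
        tauto

/-- An alternating list meets the two sets equally often or with one surplus on the side of its
head, which is why the head is kept in the induction. -/
lemma count_alternating {Z Z' : Finset V} (hZ : Disjoint Z Z') {l : List V}
    (hl : l.IsChain fun u v => u ∈ Z ∧ v ∈ Z' ∨ u ∈ Z' ∧ v ∈ Z) (hn : l.Nodup)
    (hmem : ∀ v ∈ l, v ∈ Z ∪ Z') :
    (l.head?.any (· ∈ Z) → (Z ∩ l.toFinset).card = (Z' ∩ l.toFinset).card ∨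
      (Z ∩ l.toFinset).card = (Z' ∩ l.toFinset).card + 1) ∧
    (l.head?.any (· ∈ Z') → (Z ∩ l.toFinset).card = (Z' ∩ l.toFinset).card ∨
      (Z ∩ l.toFinset).card + 1 = (Z' ∩ l.toFinset).card) := by
  induction l with
  | nil => simp
  | cons a l ih =>
    have ih' := ih hl.of_cons hn.of_cons fun v hv => hmem v (by simp [hv])
    have ha : a ∉ l := (List.nodup_cons.1 hn).1
    have h1 : ∀ Y : Finset V, (Y ∩ (a :: l).toFinset).card =
        (Y ∩ l.toFinset).card + if a ∈ Y then 1 else 0 := by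
      intro Y
      rw [List.toFinset_cons]
      split_ifs with h
      · rw [Finset.inter_insert_of_mem h, Finset.card_insert_of_notMem (by simp [ha])]
      · rw [Finset.inter_insert_of_notMem h, add_zero]
    have hdis : ∀ v, v ∈ Z → v ∉ Z' := fun v h h' => Finset.disjoint_left.1 hZ h h'
    rw [h1, h1]
    simp only [List.head?_cons, Option.any_some, decide_eq_true_eq]
    cases l with
    | nil =>
      constructor
      · intro h; simp [h, hdis a h]
      · intro h; have : a ∉ Z := fun h' => hdis a h' h
        simp [h, this]
    | cons b l =>
      have hab := (List.isChain_cons_cons.1 hl).1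
      simp only [List.head?_cons, Option.any_some, decide_eq_true_eq] at ih'
      constructor
      · intro h
        have hb : b ∈ Z' := by
          rcases hab with h' | h'
          · exact h'.2
          · exact absurd h'.1 (hdis a h)
        have := ih'.2 hb
        rw [if_pos h, if_neg (hdis a h)]; omega
      · intro h
        have ha' : a ∉ Z := fun h' => hdis a h' h
        have hb : b ∈ Z := by
          rcases hab with h' | h'
          · exact absurd h'.1 ha'
          · exact h'.2
        have := ih'.1 hb
        rw [if_pos h, if_neg ha']; omega

/-- Two sets of equal size all of whose subsets of size `m` are joined by an edge contain a long
alternating path. -/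
lemma exists_long_path {Γ : SimpleGraph V} {Z Z' : Finset V} (hZ : Disjoint Z Z')
    (hcard : Z.card = Z'.card) {m : ℕ}
    (hjoin : ∀ S ⊆ Z, ∀ T ⊆ Z', S.card = m → T.card = m → ∃ u ∈ S, ∃ v ∈ T, Γ.Adj u v) :
    ∃ l : List V, l.Nodup ∧ (∀ v ∈ l, v ∈ Z ∪ Z') ∧ (∀ e ∈ pathEdges l, e ∈ Γ.edgeSet) ∧
      2 * Z.card ≤ l.length + 4 * m := by
  classical
  let R : V → V → Prop := fun u v => Γ.Adj u v ∧ (u ∈ Z ∧ v ∈ Z' ∨ u ∈ Z' ∧ v ∈ Z)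
  obtain ⟨S, T, l, hl, hc, hST, hS, hT, hno, heq, hun⟩ := exists_depth_first_search (R := R)
    (fun u v h => ⟨h.1.symm, h.2.symm.imp And.symm And.symm⟩) _ (S := ∅) (T := Z ∪ Z') (l := [])
    le_rfl (by simp) (by simp) (by simp) (by simp) (by simp) (by simp) (by simp)
  simp only [Finset.empty_union, List.toFinset_nil, Finset.union_empty] at hun
  have hlZ : ∀ v ∈ l, v ∈ Z ∪ Z' := fun v hv => by
    rw [← hun]; exact Finset.mem_union_right _ (List.mem_toFinset.2 hv)
  refine ⟨l, hl, hlZ, isChain_of_forall_pathEdges.1 (hc.imp fun u v h => h.1), ?_⟩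
  have hjoin' : ∀ S' ⊆ Z, ∀ T' ⊆ Z', (∀ u ∈ S', ∀ v ∈ T', ¬ Γ.Adj u v) →
      S'.card < m ∨ T'.card < m := by
    intro S' hS' T' hT' h
    by_contra! hcon
    obtain ⟨S'', h1, h2⟩ := Finset.exists_subset_card_eq hcon.1
    obtain ⟨T'', h3, h4⟩ := Finset.exists_subset_card_eq hcon.2
    obtain ⟨u, hu, v, hv, huv⟩ := hjoin S'' (h1.trans hS') T'' (h3.trans hT') h2 h4
    exact h u (h1 hu) v (h3 hv) huv
  -- No edge runs between `S` and `T`, so at least two of the four parts of `S` and `T` in `Z` and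
  -- `Z'` have fewer than `m` elements. The equalities of sizes and the alternation of the path, up
  -- to one vertex, bound the other two.
  have j1 := hjoin' (Z ∩ S) Finset.inter_subset_left (Z' ∩ T) Finset.inter_subset_left
    fun u hu v hv huv => hno u (Finset.mem_inter.1 hu).2 v (Finset.mem_inter.1 hv).2
      ⟨huv, Or.inl ⟨(Finset.mem_inter.1 hu).1, (Finset.mem_inter.1 hv).1⟩⟩
  have j2 := hjoin' (Z ∩ T) Finset.inter_subset_left (Z' ∩ S) Finset.inter_subset_left
    fun u hu v hv huv => hno v (Finset.mem_inter.1 hv).2 u (Finset.mem_inter.1 hu).2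
      ⟨huv.symm, Or.inr ⟨(Finset.mem_inter.1 hv).1, (Finset.mem_inter.1 hu).1⟩⟩
  have hsplit : ∀ Y ⊆ Z ∪ Z', Y.card = (Y ∩ S).card + (Y ∩ T).card + (Y ∩ l.toFinset).card := by
    intro Y hY
    have h1 : Y = (Y ∩ S ∪ Y ∩ T) ∪ Y ∩ l.toFinset := by
      rw [← Finset.inter_union_distrib_left, ← Finset.inter_union_distrib_left, hun,
        Finset.inter_eq_left.2 hY]
    conv_lhs => rw [h1]
    rw [Finset.card_union_of_disjoint, Finset.card_union_of_disjoint]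
    · exact hST.mono Finset.inter_subset_right Finset.inter_subset_right
    · rw [← Finset.inter_union_distrib_left]
      refine Disjoint.mono Finset.inter_subset_right Finset.inter_subset_right ?_
      rw [Finset.disjoint_right]
      intro v hv
      rw [List.mem_toFinset] at hv
      simp [hS v hv, hT v hv]
  have hpart : ∀ Y ⊆ Z ∪ Z', Y.card = (Z ∩ Y).card + (Z' ∩ Y).card := by
    intro Y hY
    rw [← Finset.card_union_of_disjoint (hZ.mono Finset.inter_subset_left Finset.inter_subset_left),
      ← Finset.union_inter_distrib_right, Finset.inter_eq_right.2 hY]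
  have hSsub : S ⊆ Z ∪ Z' := fun v hv => by rw [← hun]; simp [hv]
  have hTsub : T ⊆ Z ∪ Z' := fun v hv => by rw [← hun]; simp [hv]
  have e1 := hsplit Z Finset.subset_union_left
  have e2 := hsplit Z' Finset.subset_union_right
  have e3 := hpart S hSsub
  have e4 := hpart T hTsub
  have e5 := hpart l.toFinset fun v hv => hlZ v (List.mem_toFinset.1 hv)
  rw [List.toFinset_card_of_nodup hl] at e5
  have halt := count_alternating hZ (hc.imp fun u v h => h.2) hl hlZ
  have hdiff : (Z ∩ l.toFinset).card ≤ (Z' ∩ l.toFinset).card + 1 ∧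
      (Z' ∩ l.toFinset).card ≤ (Z ∩ l.toFinset).card + 1 := by
    cases l with
    | nil => simp
    | cons a l =>
      simp only [List.head?_cons, Option.any_some, decide_eq_true_eq] at halt
      rcases Finset.mem_union.1 (hlZ a (by simp)) with h | h
      · have := halt.1 h; omega
      · have := halt.2 h; omega
  omega

end HamiltonPath

/-! ### Edges between large sets -/

namespace RandomSubset

variable {V : Type*} [Fintype V] [DecidableEq V]

lemma prob_no_edge_le {w : Sym2 V → ℝ} (h0 : ∀ e, 0 ≤ w e) (h1 : ∀ e, w e ≤ 1) {S T : Finset V}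
    (hST : Disjoint S T) :
    prob w (fun x => ∀ u ∈ S, ∀ v ∈ T, x s(u, v) = false) ≤
      Real.exp (-∑ u ∈ S, ∑ v ∈ T, w s(u, v)) := by
  have h := prob_present_absent_le h0 h1
    (Finset.disjoint_empty_left ((S ×ˢ T).image fun p => s(p.1, p.2)))
  rw [Finset.sum_image, Finset.prod_empty, one_mul, Finset.sum_product] at h
  · refine le_trans (prob_mono h0 h1 fun x hx => ?_) h
    refine ⟨by simp, fun e he => ?_⟩
    obtain ⟨p, hp, rfl⟩ := Finset.mem_image.1 he
    rw [Finset.mem_product] at hp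
    exact hx _ hp.1 _ hp.2
  · rintro ⟨u, v⟩ hp ⟨u', v'⟩ hp' heq
    simp only [Finset.coe_product, Set.mem_prod, Finset.mem_coe] at hp hp'
    rcases Sym2.eq_iff.1 heq with ⟨h1, h2⟩ | ⟨h1, h2⟩
    · exact Prod.ext h1 h2
    · exact absurd hp'.2 (Finset.disjoint_left.1 hST ((show u = v' from h1) ▸ hp.1))

/-- All pairs of subsets of size `m` of two disjoint sets are joined, with high probability. -/
lemma prob_not_joined_le {w : Sym2 V → ℝ} (h0 : ∀ e, 0 ≤ w e) (h1 : ∀ e, w e ≤ 1)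
    {Z Z' : Finset V} (hZ : Disjoint Z Z') {r : ℝ} (hr : ∀ u ∈ Z, ∀ v ∈ Z', r ≤ w s(u, v))
    (m : ℕ) :
    prob w (fun x => ¬ ∀ S ⊆ Z, ∀ T ⊆ Z', S.card = m → T.card = m →
      ∃ u ∈ S, ∃ v ∈ T, (graph x).Adj u v) ≤ 4 ^ Fintype.card V * Real.exp (-(r * m ^ 2)) := by
  classical
  have h := prob_exists_le h0 h1 ((Finset.univ : Finset (Finset V × Finset V)).filter fun p =>
    p.1 ⊆ Z ∧ p.2 ⊆ Z' ∧ p.1.card = m ∧ p.2.card = m)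
    (fun p x => ∀ u ∈ p.1, ∀ v ∈ p.2, x s(u, v) = false)
  refine (prob_mono h0 h1 fun x hx => ?_).trans (h.trans ?_)
  · push Not at hx
    obtain ⟨S, hS, T, hT, hSm, hTm, hno⟩ := hx
    refine ⟨(S, T), by simp [hS, hT, hSm, hTm], fun u hu v hv => ?_⟩
    have hne : u ≠ v := fun h' => Finset.disjoint_left.1 hZ (hS hu) (h' ▸ hT hv)
    have := hno u hu v hv
    rw [graph_adj] at this
    simpa [hne] using this
  · calc _ ≤ ∑ _p ∈ ((Finset.univ : Finset (Finset V × Finset V)).filter fun p =>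
          p.1 ⊆ Z ∧ p.2 ⊆ Z' ∧ p.1.card = m ∧ p.2.card = m), Real.exp (-(r * m ^ 2)) := by
          refine Finset.sum_le_sum fun p hp => ?_
          obtain ⟨-, hS, hT, hSm, hTm⟩ := Finset.mem_filter.1 hp
          refine (prob_no_edge_le h0 h1 (hZ.mono hS hT)).trans (Real.exp_le_exp.2 (neg_le_neg ?_))
          calc r * (m : ℝ) ^ 2 = ∑ u ∈ p.1, ∑ v ∈ p.2, r := by
                simp only [Finset.sum_const, nsmul_eq_mul, hSm, hTm]; ring
            _ ≤ _ := Finset.sum_le_sum fun u hu => Finset.sum_le_sum fun v hv =>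
                hr u (hS hu) v (hT hv)
      _ ≤ _ := by
          rw [Finset.sum_const, nsmul_eq_mul]
          refine mul_le_mul_of_nonneg_right ?_ (Real.exp_pos _).le
          have : ((Finset.univ : Finset (Finset V × Finset V)).filter fun p =>
              p.1 ⊆ Z ∧ p.2 ⊆ Z' ∧ p.1.card = m ∧ p.2.card = m).card ≤ 4 ^ Fintype.card V := by
            refine (Finset.card_filter_le _ _).trans ?_
            rw [Finset.card_univ, Fintype.card_prod, Fintype.card_finset, ← mul_pow]
            norm_num
          exact_mod_cast this

end RandomSubset

/-! ### Three layers: structure, links, sprinkling -/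

namespace RandomSubset

open HamiltonPath

/-- With about `α N / 6` as a lower bound for the floor, the exponent is at most `N (log C + 1 - C
α² / 72)`. The term linear in `C` dominates the logarithm, and the constants 144 and 288 leave at
most `-N`. -/
lemma exists_sprinkling_constant {α : ℝ} (hα : 0 < α) : ∃ C : ℝ, 1 ≤ C ∧ ∀ ε : ℝ, 0 < ε →
    ∃ N₀ : ℕ, ∀ N : ℕ, N₀ ≤ N → C ≤ N ∧
      C ^ N * Real.exp (N - C * (⌊α * N / 3⌋₊ : ℝ) ^ 2 / (2 * N)) ≤ ε := by
  have hlog : Tendsto (fun C : ℝ => Real.log C / C) atTop (𝓝 0) := by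
    simpa using Real.isLittleO_log_id_atTop.tendsto_div_nhds_zero
  obtain ⟨C, hC1, hC2, hC3⟩ := ((eventually_ge_atTop (1 : ℝ)).and <|
    (hlog.eventually_le_const (by positivity : (0 : ℝ) < α ^ 2 / 144)).and
    (eventually_ge_atTop (288 / α ^ 2))).exists
  refine ⟨C, hC1, fun ε hε => ?_⟩
  have hexp : ∀ᶠ N : ℕ in atTop, Real.exp (-(N : ℝ)) ≤ ε := by
    have : Tendsto (fun N : ℕ => Real.exp (-(N : ℝ))) atTop (𝓝 0) :=
      Real.tendsto_exp_neg_atTop_nhds_zero.comp tendsto_natCast_atTop_atTop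
    exact this.eventually_le_const hε
  have hbig := tendsto_natCast_atTop_atTop.eventually_ge_atTop (max C (6 / α))
  obtain ⟨N₀, hN₀⟩ := eventually_atTop.1 (hexp.and hbig)
  refine ⟨N₀, fun N hN => ?_⟩
  obtain ⟨h1, h2⟩ := hN₀ N hN
  have hCN : C ≤ N := (le_max_left _ _).trans h2
  have hN0 : (0 : ℝ) < N := by linarith
  refine ⟨hCN, le_trans ?_ h1⟩
  have h3 : 6 ≤ α * N := by
    have := (div_le_iff₀ hα).1 ((le_max_right _ _).trans h2)
    linarith
  have hm : α * N / 6 ≤ (⌊α * N / 3⌋₊ : ℝ) := by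
    have := Nat.lt_floor_add_one (α * N / 3)
    linarith
  have hC0 : 0 < C := by linarith
  rw [← Real.exp_log (pow_pos hC0 N), ← Real.exp_add, Real.log_pow]
  refine Real.exp_le_exp.2 ?_
  have h4 : α ^ 2 * N / 72 * C ≤ C * (⌊α * N / 3⌋₊ : ℝ) ^ 2 / (2 * N) := by
    rw [le_div_iff₀ (by positivity)]
    calc α ^ 2 * N / 72 * C * (2 * N) = C * (α * N / 6) ^ 2 := by ring
      _ ≤ _ := by gcongr
  have h5 : Real.log C ≤ α ^ 2 / 144 * C := (div_le_iff₀ hC0).1 hC2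
  have h6 : 288 ≤ C * α ^ 2 := (div_le_iff₀ (by positivity)).1 hC3
  nlinarith

/-- Lets the selected pairs of the structure layer be assumed to lie in its support, which decides
where private neighbours can be. -/
lemma prob_not_supported {E : Type*} [Fintype E] [DecidableEq E] {w : E → ℝ}
    (h0 : ∀ e, 0 ≤ w e) (h1 : ∀ e, w e ≤ 1) :
    prob w (fun x => ¬ ∀ e, x e = true → w e ≠ 0) = 0 := by
  refine le_antisymm ?_ (prob_nonneg h0 h1 _)
  have h := prob_exists_le h0 h1 (Finset.univ.filter fun e => w e = 0) fun e x => x e = true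
  refine (prob_mono h0 h1 fun x hx => ?_).trans (h.trans ?_)
  · push Not at hx
    obtain ⟨e, he, hw⟩ := hx
    exact ⟨e, by simpa using hw, he⟩
  · refine Finset.sum_nonpos fun e he => ?_
    have := prob_present_absent_le h0 h1 (Finset.disjoint_empty_right {e})
    simpa [(Finset.mem_filter.1 he).2] using this

variable {V : Type*} [Fintype V] [DecidableEq V]

lemma Expands.mono {B : Type*} [AddCommGroup B] {f : V → B} {F A : Finset V} {m : ℕ}
    {Γ Γ' : SimpleGraph V} (h : Expands f F A m Γ) (hle : Γ ≤ Γ') : Expands f F A m Γ' := by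
  intro S hS hd hm
  refine (h S hS hd hm).trans_le (Finset.card_le_card fun u hu => ?_)
  simp only [Finset.mem_filter, Finset.mem_univ, true_and] at hu ⊢
  obtain ⟨h1, h2, v, hv, hvu, h0⟩ := hu
  exact ⟨h1, h2, v, hv, hle hvu, h0⟩

/-- The outcome `y` of the linking layer provides a rotation setup for the outcome `x` of the
structure layer, once sets avoiding `A` expand outside a suitable set `F`. -/
def Linkable {B : Type*} [AddCommGroup B] (f : V → B) (Y : V → Finset V) (j : ℕ) (A : Finset V)
    (g : V → Bool → V) (x y : Sym2 V → Bool) : Prop :=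
  ∃ F : Finset V, (∀ v, (Y v ∩ (F \ core A g)).card ≤ j) ∧
    ∀ m, Expands f F A m (graph (x ⊔ y)) →
      ∃ M F' l, RotationSetup f M F' A l m (graph (x ⊔ y))

/-- Hamiltonicity of a random graph with independent edges, from a layer that is used for the
structure, a layer that provides links and a sprinkled layer. -/
theorem exists_prob_not_isHamiltonian_le {K γ : ℝ} (hK : 1 ≤ K) (hγ0 : 0 < γ) (hγ1 : γ ≤ 1) :
    ∃ C : ℝ, 1 ≤ C ∧ ∀ (j : ℕ) (ε : ℝ), 0 < ε → ∃ (N₀ : ℕ) (W₀ : ℝ),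
      ∀ (V : Type) [Fintype V] [DecidableEq V] (B : Type) [AddCommGroup B] (f : V → B)
        (Y : V → Finset V) (w wa wb : Sym2 V → ℝ), N₀ ≤ Fintype.card V →
        (∀ e, 0 ≤ wa e) → (∀ e, 0 ≤ wb e) → (∀ e, w e ≤ 1) →
        (∀ e, wa e + wb e + hostWeight f (C / Fintype.card V) e ≤ w e) →
        (∀ e, wa e ≤ K * Real.log (Fintype.card V) / Fintype.card V) →
        (∀ v, Real.log (Fintype.card V) + Real.log (Real.log (Fintype.card V)) + W₀ ≤
          ∑ u ∈ Finset.univ.erase v, wa s(v, u)) →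
        (∀ v, γ * Real.log (Fintype.card V) ≤ ∑ u ∈ Y v, wa s(v, u)) →
        (∀ v, v ∉ Y v) → (∀ v, ∀ u ∈ Y v, f v + f u = 0) →
        (∀ x A g, (∀ e, x e = true → wa e ≠ 0) → Attached A x g →
          (A.card : ℝ) ≤ Fintype.card V / Real.log (Fintype.card V) ^ 2 →
          prob wb (fun y => ¬ Linkable f Y j A g x y) ≤ ε) →
        prob w (fun x => ¬ (graph x).IsHamiltonian) ≤ 3 * ε := by
  obtain ⟨δ, hδ, D, hD, hδD⟩ := exists_typical hK hγ0 hγ1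
  -- With `θ = δ / 12` the density argument uses up half of the degree `δ * L`; the other half
  -- covers the bounded losses `3 * D + j`.
  obtain ⟨α, hα, hαε⟩ := hδD (δ / 12) (by positivity)
  obtain ⟨C, hC, hCε⟩ := exists_sprinkling_constant hα
  refine ⟨C, hC, fun j ε hε => ?_⟩
  obtain ⟨N₁, W₀, htyp⟩ := hαε ε hε
  obtain ⟨N₂, hspr⟩ := hCε ε hε
  obtain ⟨N₃, hN₃⟩ := eventually_exists_card
    (eventually_ge_atTop (max ((6 * D + 2 * j) / δ) (3 * D / δ)))
  refine ⟨max (max N₁ N₂) N₃, W₀, ?_⟩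
  intro V _ _ B _ f Y w wa wb hN ha0 hb0 hw1 hsum hκ hdeg hYdeg hY hYf hlink
  obtain ⟨hCN, hspr⟩ := hspr _ ((le_max_right _ _).trans ((le_max_left _ _).trans hN))
  have hbig := hN₃ _ ((le_max_right _ _).trans hN)
  set N : ℝ := ((Fintype.card V : ℕ) : ℝ) with hNdef
  set L := Real.log N with hL
  have hN0 : 0 < N := by linarith
  have hr0 : 0 ≤ C / N := by positivity
  have hc0 := hostWeight_nonneg (f := f) hr0
  have ha1 : ∀ e, wa e ≤ 1 := fun e => by linarith [hb0 e, hc0 e, hsum e, hw1 e]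
  have hb1 : ∀ e, wb e ≤ 1 := fun e => by linarith [ha0 e, hc0 e, hsum e, hw1 e]
  have hbc1 : ∀ e, wb e + hostWeight f (C / N) e ≤ 1 := fun e => by
    linarith [ha0 e, hsum e, hw1 e]
  have hL1 : 3 * (D : ℝ) ≤ δ * L := by
    have := (div_le_iff₀ hδ).1 ((le_max_right _ _).trans hbig)
    linarith
  have hL2 : 6 * (δ / 12 * L) + 3 * D + j ≤ δ * L := by
    have := (div_le_iff₀ hδ).1 ((le_max_left _ _).trans hbig)
    linarith
  have hT := htyp V wa Y ((le_max_left _ _).trans ((le_max_left _ _).trans hN)) ha0 ha1 hκ hdeg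
    hYdeg
  have hQ : prob wa (fun x => ¬ (Typical Y (δ * L) (δ / 12 * L) (α * N) (N / L ^ 2) D x ∧
      ∀ e, x e = true → wa e ≠ 0)) ≤ ε := by
    have h1 := prob_or_le ha0 ha1
      (fun x => ¬ Typical Y (δ * L) (δ / 12 * L) (α * N) (N / L ^ 2) D x)
      (fun x => ¬ ∀ e, x e = true → wa e ≠ 0)
    rw [prob_not_supported ha0 ha1, add_zero] at h1
    exact (prob_mono ha0 ha1 fun x hx => not_and_or.1 hx).trans (h1.trans hT)
  have h3 : 3 * ε = ε + (ε + ε) := by ring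
  rw [h3]
  -- The structure layer is exposed first. Once `x` and the private neighbours are fixed, the
  -- linking layer and then the sprinkled layer are fresh.
  refine prob_not_le_of_two_layers (w₁ := wa) (w₂ := fun e => wb e + hostWeight f (C / N) e)
    (P := fun x => (graph x).IsHamiltonian) ha0
    (fun e => add_nonneg (hb0 e) (hc0 e)) (fun e => by linarith [hsum e]) hw1
    monotone_isHamiltonian (by positivity) hQ fun x hx => ?_
  obtain ⟨hx, hsupp⟩ := hx
  obtain ⟨g, hg⟩ := hx.exists_attached hD hL1
  set A := atypical Y (δ * L) x with hA
  refine prob_not_le_of_two_layers (w₁ := wb) (w₂ := hostWeight f (C / N))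
    (P := fun y => (graph (x ⊔ y)).IsHamiltonian) hb0 hc0 (fun e => le_rfl) hbc1
    (fun y y' hyy' => monotone_isHamiltonian (sup_le_sup_left hyy' x)) hε.le
    (hlink x A g hsupp hg hx.card_atypical_le) fun y hy => ?_
  obtain ⟨F, hF, hset⟩ := hy
  have hexp : Expands f F A ⌊α * N / 3⌋₊ (graph (x ⊔ y)) := by
    refine Expands.mono (Γ := graph x) ?_ (graph_mono le_sup_left)
    classical
    intro S hS hSA hSm
    have hSm' : (S.card : ℝ) ≤ α * N / 3 :=
      le_trans (by exact_mod_cast hSm) (Nat.floor_le (by positivity))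
    convert hx.expand hY hg hF hL2 hS hSA (by linarith) (fun v u => f v + f u = 0) hYf
  obtain ⟨M, F', l, hR⟩ := hset _ hexp
  have hfin := prob_not_isHamiltonian_le hR hC hCN
  refine le_trans (le_of_eq ?_) (hfin.trans hspr)
  refine prob_congr _ fun z => ?_
  rw [← sup_assoc, graph_sup (x ⊔ y) z]

end RandomSubset

/-! ### Hosts without bipartition: all pairs, and pairs inside linked classes -/

namespace RandomSubset

open HamiltonPath

lemma Attached.sup {V : Type*} {A : Finset V} {x : Sym2 V → Bool} {g : V → Bool → V}
    (hg : Attached A x g) (y : Sym2 V → Bool) : Attached A (x ⊔ y) g where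
  notMem := hg.notMem
  adj s hs b := by simp [hg.adj s hs b]
  inj := hg.inj

/-- Hamiltonicity when all pairs have probability at least `C / N`. -/
theorem exists_prob_not_isHamiltonian_le_of_complete {K : ℝ} (hK : 1 ≤ K) :
    ∃ C : ℝ, 1 ≤ C ∧ ∀ ε : ℝ, 0 < ε → ∃ (N₀ : ℕ) (W₀ : ℝ),
      ∀ (V : Type) [Fintype V] [DecidableEq V] (w : Sym2 V → ℝ), N₀ ≤ Fintype.card V →
        (∀ e, 0 ≤ w e) → (∀ e, w e ≤ 1) → (∀ e, ¬ e.IsDiag → C / Fintype.card V ≤ w e) →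
        (∀ e, w e ≤ K * Real.log (Fintype.card V) / Fintype.card V) →
        (∀ v, Real.log (Fintype.card V) + Real.log (Real.log (Fintype.card V)) + W₀ ≤
          ∑ u ∈ Finset.univ.erase v, w s(v, u)) →
        prob w (fun x => ¬ (graph x).IsHamiltonian) ≤ ε := by
  obtain ⟨C, hC, hmain⟩ := exists_prob_not_isHamiltonian_le hK one_pos le_rfl
  refine ⟨C, hC, fun ε hε => ?_⟩
  obtain ⟨N₁, W₁, hmain⟩ := hmain 0 (ε / 3) (by positivity)
  obtain ⟨N₂, hN₂⟩ := eventually_exists_card (eventually_ge_atTop (1 : ℝ))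
  -- Setting aside `C / N` for sprinkling lowers each expected degree by at most `C`.
  refine ⟨max (max N₁ N₂) 3, max W₁ 0 + C, fun V _ _ w hN h0 h1 hr hκ hdeg => ?_⟩
  have hL1 := hN₂ _ ((le_max_right _ _).trans ((le_max_left _ _).trans hN))
  have hN3 : 3 ≤ Fintype.card V := (le_max_right _ _).trans hN
  set N : ℝ := ((Fintype.card V : ℕ) : ℝ) with hNdef
  have hN0 : 0 < N := by rw [hNdef]; exact_mod_cast (by omega : 0 < Fintype.card V)
  have hr0 : 0 ≤ C / N := by positivity
  set f : V → ℤ := fun _ => 0 with hf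
  have hle : ∀ e, hostWeight f (C / N) e ≤ w e := by
    intro e
    rw [hostWeight]
    split_ifs with h
    · exact hr e h.1
    · exact h0 e
  have hsum : ∀ v, ∑ u ∈ Finset.univ.erase v, w s(v, u) - C ≤
      ∑ u ∈ Finset.univ.erase v, (w s(v, u) - hostWeight f (C / N) s(v, u)) := by
    intro v
    rw [Finset.sum_sub_distrib, sub_le_sub_iff_left]
    calc _ ≤ ∑ u ∈ Finset.univ.erase v, C / N :=
          Finset.sum_le_sum fun u _ => hostWeight_le hr0 _
      _ = ((Finset.univ.erase v).card : ℝ) * (C / N) := by rw [Finset.sum_const, nsmul_eq_mul]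
      _ ≤ N * (C / N) := by
          refine mul_le_mul_of_nonneg_right ?_ hr0
          rw [hNdef]
          exact_mod_cast (Finset.card_erase_le.trans_eq Finset.card_univ)
      _ = C := by field_simp
  have hlog := Real.log_nonneg hL1
  have h := hmain V ℤ f (fun v => Finset.univ.erase v) w
    (fun e => w e - hostWeight f (C / N) e) (fun _ => 0)
    ((le_max_left _ _).trans ((le_max_left _ _).trans hN)) (fun e => by linarith [hle e])
    (fun _ => le_rfl) h1 (fun e => by rw [← hNdef]; linarith)
    (fun e => by linarith [hκ e, hostWeight_nonneg (f := f) hr0 e])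
    (fun v => by linarith [hdeg v, hsum v, le_max_left W₁ 0])
    (fun v => by linarith [hdeg v, hsum v, le_max_right W₁ 0]) (fun v => by simp)
    (fun v u _ => by simp [hf]) fun x A g _ hg _ => by
      rw [prob_eq_zero _ fun y hy => hy ⟨core A g, by simp, fun m hexp =>
        (hg.sup y).exists_rotationSetup hN3 (fun _ => rfl) hexp⟩]
      positivity
  linarith

lemma exists_disjoint_subsets {V : Type*} [DecidableEq V] {S : Finset V} {m : ℕ}
    (h : 2 * m ≤ S.card) : ∃ T T' : Finset V, T ⊆ S ∧ T' ⊆ S ∧ Disjoint T T' ∧ T.card = m ∧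
      T'.card = m := by
  obtain ⟨T, hT, hTm⟩ := Finset.exists_subset_card_eq (show m ≤ S.card by omega)
  obtain ⟨T', hT', hTm'⟩ := Finset.exists_subset_card_eq
    (show m ≤ (S \ T).card by rw [Finset.card_sdiff_of_subset hT]; omega)
  exact ⟨T, T', hT, hT'.trans Finset.sdiff_subset,
    Finset.disjoint_of_subset_right hT' Finset.disjoint_sdiff, hTm, hTm'⟩

/-- The links between the classes exist with high probability. -/
lemma prob_not_linkable_le {V : Type*} [Fintype V] [DecidableEq V] (h3 : 3 ≤ Fintype.card V)
    {k : ℕ} (hk : 1 ≤ k) {β : V → Fin (k + 1)} {A : Finset V} {x : Sym2 V → Bool}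
    {g : V → Bool → V} (hg : Attached A x g) (hβg : ∀ s ∈ A, ∀ b, β (g s b) = β s) {m : ℕ}
    (hm : ∀ i, 2 * m + (core A g).card ≤ (Finset.univ.filter fun v => β v = i).card)
    {w : Sym2 V → ℝ} (h0 : ∀ e, 0 ≤ w e) (h1 : ∀ e, w e ≤ 1) {q : ℝ}
    (hq : ∀ u v, β u ≠ β v → q ≤ w s(u, v)) (Y : V → Finset V) :
    prob w (fun y => ¬ Linkable (classIndicator β) Y (2 * (k + 1)) A g x y) ≤
      (k + 1) * Real.exp (-(q * m ^ 2)) := by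
  classical
  -- Link `i` runs from the pool `T i` to the pool `T' (i + 1)`. The two pools of a class are
  -- disjoint, so its entry and exit vertices differ, and they avoid the core, so no link interferes
  -- with the forced paths.
  have hpools : ∀ i, ∃ T T' : Finset V, (∀ v ∈ T, β v = i ∧ v ∉ core A g) ∧
      (∀ v ∈ T', β v = i ∧ v ∉ core A g) ∧ Disjoint T T' ∧ T.card = m ∧ T'.card = m := by
    intro i
    obtain ⟨T, T', hT, hT', hd, hTm, hTm'⟩ := exists_disjoint_subsets
      (S := (Finset.univ.filter fun v => β v = i) \ core A g) (m := m)
      (by have := Finset.le_card_sdiff (core A g) (Finset.univ.filter fun v => β v = i)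
          have := hm i
          omega)
    exact ⟨T, T', fun v hv => by simpa using hT hv, fun v hv => by simpa using hT' hv, hd, hTm,
      hTm'⟩
  choose T T' hT hT' hd hTm hTm' using hpools
  have hne : ∀ i : Fin (k + 1), i ≠ i + 1 := fun i h => by
    have h1 : (1 : Fin (k + 1)) = 0 := by simpa using h.symm
    have := congrArg Fin.val h1
    rw [Fin.val_one', Fin.val_zero, Nat.mod_eq_of_lt (by omega)] at this
    exact one_ne_zero this
  have hbound := prob_exists_le h0 h1 (Finset.univ : Finset (Fin (k + 1)))
    (fun i y => ∀ u ∈ T i, ∀ v ∈ T' (i + 1), y s(u, v) = false)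
  refine (prob_mono h0 h1 fun y hy => ?_).trans (hbound.trans ?_)
  · by_contra! hcon
    refine hy ?_
    have hlink : ∀ i, ∃ u ∈ T i, ∃ v ∈ T' (i + 1), y s(u, v) = true := fun i => by
      obtain ⟨u, hu, v, hv, h⟩ := hcon i (Finset.mem_univ _)
      exact ⟨u, hu, v, hv, by simpa using h⟩
    choose b hb a ha hab using hlink
    have ha' : ∀ i, a (i - 1) ∈ T' i := fun i => by simpa using ha (i - 1)
    refine ⟨core A g ∪ (Finset.univ.image (fun i => a (i - 1)) ∪ Finset.univ.image b),
      fun v => ?_, fun m hexp => hg.exists_rotationSetup_of_links h3 hβg (a := fun i => a (i - 1))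
        (b := b) (graph_mono le_sup_left) (fun i => (hT' i _ (ha' i)).1) (fun i => (hT i _ (hb i)).1)
        (fun i h => ?_) (fun i => (hT' i _ (ha' i)).2) (fun i => (hT i _ (hb i)).2)
        (fun i => ?_) hexp⟩
    · have e1 : (Finset.univ.image fun i => a (i - 1)).card ≤ k + 1 := by
        simpa using (Finset.card_image_le (s := Finset.univ) (f := fun i => a (i - 1)))
      have e2 : (Finset.univ.image b).card ≤ k + 1 := by
        simpa using (Finset.card_image_le (s := Finset.univ) (f := b))
      have e3 := Finset.card_union_le (Finset.univ.image fun i => a (i - 1)) (Finset.univ.image b)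
      refine (Finset.card_le_card (t := (Finset.univ.image fun i => a (i - 1)) ∪
        Finset.univ.image b) fun u hu => ?_).trans (by omega)
      simp only [Finset.mem_inter, Finset.mem_sdiff, Finset.mem_union] at hu ⊢
      tauto
    · exact Finset.disjoint_left.1 (hd i) (hb i) (h ▸ ha' i)
    · rw [graph_adj]
      simp only [add_sub_cancel_right]
      exact ⟨by simp [hab i], fun h => hne i <|
        (hT i _ (hb i)).1.symm.trans ((congrArg β h).trans (hT' _ _ (ha i)).1)⟩
  · calc _ ≤ ∑ _i : Fin (k + 1), Real.exp (-(q * m ^ 2)) := by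
          refine Finset.sum_le_sum fun i _ => ?_
          have hdis : Disjoint (T i) (T' (i + 1)) := Finset.disjoint_left.2 fun v hv hv' =>
            hne i ((hT i v hv).1.symm.trans (hT' _ v hv').1)
          refine (prob_no_edge_le h0 h1 hdis).trans (Real.exp_le_exp.2 (neg_le_neg ?_))
          calc q * (m : ℝ) ^ 2 = ∑ u ∈ T i, ∑ v ∈ T' (i + 1), q := by
                simp only [Finset.sum_const, nsmul_eq_mul, hTm, hTm']; ring
            _ ≤ _ := Finset.sum_le_sum fun u hu => Finset.sum_le_sum fun v hv => hq u v (by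
                rw [(hT i u hu).1, (hT' _ v hv).1]; exact hne i)
      _ = _ := by simp

/-- Hamiltonicity when the random graphs inside the classes have large minimum degree and the
expected number of edges between the classes is large. -/
theorem exists_prob_not_isHamiltonian_le_of_links {K c : ℝ} (hK : 1 ≤ K) (hc : 0 < c) {k : ℕ}
    (hk : 1 ≤ k) :
    ∃ C : ℝ, 1 ≤ C ∧ ∀ ε : ℝ, 0 < ε → ∃ (N₀ : ℕ) (W₀ Q₀ : ℝ),
      ∀ (V : Type) [Fintype V] [DecidableEq V] (w : Sym2 V → ℝ) (β : V → Fin (k + 1)) (p q : ℝ),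
        N₀ ≤ Fintype.card V → (∀ e, 0 ≤ w e) → (∀ e, w e ≤ 1) → 0 ≤ q →
        (∀ u v, u ≠ v → β u = β v → p ≤ w s(u, v)) → (∀ u v, β u ≠ β v → q ≤ w s(u, v)) →
        C / Fintype.card V ≤ p → p ≤ K * Real.log (Fintype.card V) / Fintype.card V → p ≤ 1 →
        (∀ i, c * Fintype.card V ≤ (Finset.univ.filter fun v => β v = i).card) →
        (∀ i, Real.log (Fintype.card V) + Real.log (Real.log (Fintype.card V)) + W₀ ≤
          p * (Finset.univ.filter fun v => β v = i).card) →
        Q₀ ≤ q * (Fintype.card V) ^ 2 →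
        prob w (fun x => ¬ (graph x).IsHamiltonian) ≤ ε := by
  obtain ⟨C, hC, hmain⟩ := exists_prob_not_isHamiltonian_le hK one_pos le_rfl
  refine ⟨C, hC, fun ε hε => ?_⟩
  obtain ⟨N₁, W₁, hmain⟩ := hmain (2 * (k + 1)) (ε / 3) (by positivity)
  obtain ⟨N₂, hN₂⟩ := eventually_exists_card ((eventually_ge_atTop (1 : ℝ)).and
    ((tendsto_pow_atTop (two_ne_zero)).eventually_ge_atTop (12 / c)))
  obtain ⟨N₃, hN₃⟩ := eventually_atTop.1
    (tendsto_natCast_atTop_atTop.eventually_ge_atTop (8 / c))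
  have hexp : ∀ᶠ Q : ℝ in atTop, (k + 1) * Real.exp (-(Q * (c ^ 2 / 64))) ≤ ε / 3 := by
    have h1 : Tendsto (fun Q : ℝ => Q * (c ^ 2 / 64)) atTop atTop :=
      tendsto_id.atTop_mul_const (by positivity)
    have h2 := (Real.tendsto_exp_neg_atTop_nhds_zero.comp h1).const_mul ((k : ℝ) + 1)
    rw [mul_zero] at h2
    exact h2.eventually_le_const (by positivity)
  obtain ⟨Q₀, hQ₀⟩ := hexp.exists
  -- A vertex loses `C` to sprinkling and at most `p ≤ 1` because it is not its own neighbour.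
  refine ⟨max (max N₁ N₂) (max N₃ 3), max W₁ 0 + C + 1, Q₀, ?_⟩
  intro V _ _ w β p q hN h0 h1 hq0 hp hq hCp hκ hp1 hc' hdeg hQ
  classical
  obtain ⟨hL1, hL2⟩ := hN₂ _ ((le_max_right _ _).trans ((le_max_left _ _).trans hN))
  have hN3 : 3 ≤ Fintype.card V := (le_max_right _ _).trans ((le_max_right _ _).trans hN)
  have hNc := hN₃ _ ((le_max_left _ _).trans ((le_max_right _ _).trans hN))
  set N : ℝ := ((Fintype.card V : ℕ) : ℝ) with hNdef
  have hN0 : 0 < N := by rw [hNdef]; exact_mod_cast (by omega : 0 < Fintype.card V)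
  have hr0 : 0 ≤ C / N := by positivity
  have hlog := Real.log_nonneg hL1
  set f := classIndicator β with hf
  have hfβ : ∀ u v, f u + f v = 0 ↔ β u = β v := fun u v => classIndicator_add_eq_zero
  set Y : V → Finset V := fun v => (Finset.univ.filter fun u => β u = β v).erase v with hY
  have hmemY : ∀ v u, u ∈ Y v ↔ u ≠ v ∧ β u = β v := fun v u => by simp [hY]
  have hpC : 0 ≤ p - C / N := by linarith
  have hsumY : ∀ v, Real.log N + Real.log (Real.log N) + max W₁ 0 ≤
      ∑ u ∈ Y v, hostWeight f (p - C / N) s(v, u) := by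
    intro v
    have e1 : ∀ u ∈ Y v, hostWeight f (p - C / N) s(v, u) = p - C / N := fun u hu => by
      rw [hmemY] at hu
      refine hostWeight_of ⟨?_, ?_⟩
      · rw [Sym2.mk_isDiag_iff]; exact hu.1.symm
      · rw [pairSum_mk, hfβ]; exact hu.2.symm
    rw [Finset.sum_congr rfl e1, Finset.sum_const, nsmul_eq_mul]
    have e2 : ((Y v).card : ℝ) = (Finset.univ.filter fun u => β u = β v).card - 1 := by
      rw [hY, Finset.card_erase_of_mem (by simp), Nat.cast_sub, Nat.cast_one]
      exact Finset.card_pos.2 ⟨v, by simp⟩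
    have e3 : ((Finset.univ.filter fun u => β u = β v).card : ℝ) ≤ N := by
      rw [hNdef]; exact_mod_cast Finset.card_le_univ _
    have e4 : ((Finset.univ.filter fun u => β u = β v).card : ℝ) * (C / N) ≤ C := by
      calc _ ≤ N * (C / N) := mul_le_mul_of_nonneg_right e3 hr0
        _ = C := by field_simp
    rw [e2]
    nlinarith [hdeg (β v)]
  have hwb0 : ∀ e, 0 ≤ (if pairSum f e = 0 then (0 : ℝ) else q) := fun e => by
    split_ifs <;> simp [hq0]
  have hle : ∀ e, hostWeight f (p - C / N) e + (if pairSum f e = 0 then (0 : ℝ) else q) +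
      hostWeight f (C / N) e ≤ w e := by
    intro e
    induction e with
    | h u v =>
      simp only [hostWeight, pairSum_mk, Sym2.mk_isDiag_iff, hfβ]
      by_cases h1 : u = v
      · simp [h1, h0]
      · by_cases h2 : β u = β v
        · simpa [h1, h2] using hp u v h1 h2
        · simpa [h1, h2] using hq u v h2
  have h := hmain V _ f Y w (hostWeight f (p - C / N))
    (fun e => if pairSum f e = 0 then (0 : ℝ) else q)
    ((le_max_left _ _).trans ((le_max_left _ _).trans hN)) (hostWeight_nonneg hpC)
    hwb0 h1 hle (fun e => (hostWeight_le hpC e).trans (by linarith))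
    (fun v => by
      refine le_trans ?_ ((hsumY v).trans (Finset.sum_le_sum_of_subset_of_nonneg
        (fun u hu => Finset.mem_erase.2 ⟨((hmemY v u).1 hu).1, Finset.mem_univ _⟩)
        fun u _ _ => hostWeight_nonneg hpC _))
      linarith [le_max_left W₁ 0])
    (fun v => by linarith [hsumY v, le_max_right W₁ 0])
    (fun v h => ((hmemY v v).1 h).1 rfl)
    (fun v u hu => (hfβ v u).2 ((hmemY v u).1 hu).2.symm) ?_
  · linarith
  intro x A g hsupp hg hA
  set m : ℕ := ⌊c * N / 4⌋₊ with hm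
  have hm1 : (m : ℝ) ≤ c * N / 4 := Nat.floor_le (by positivity)
  have hm2 : c * N / 4 < m + 1 := Nat.lt_floor_add_one _
  have hcN : 8 ≤ c * N := by
    have := (div_le_iff₀ hc).1 hNc; linarith
  have hAc : 3 * (A.card : ℝ) ≤ c * N / 4 := by
    have : 12 ≤ Real.log N ^ 2 * c := (div_le_iff₀ hc).1 hL2
    have hL0 : 0 < Real.log N ^ 2 := by positivity
    rw [le_div_iff₀ hL0] at hA
    nlinarith
  refine (prob_not_linkable_le hN3 hk hg (fun s hs b => ?_) (m := m) (fun i => ?_) hwb0 (fun e => ?_)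
    (q := q) (fun u v huv => ?_) Y).trans (le_trans ?_ hQ₀)
  -- The structure layer only selects pairs inside classes, so a private neighbour is in the class
  -- of its owner.
  · have := hsupp _ (hg.adj s hs b)
    rw [hostWeight] at this
    simp only [ne_eq, ite_eq_right_iff, not_forall, pairSum_mk, hfβ] at this
    exact this.1.2.symm
  · have e1 := hc' i
    have e2 : ((core A g).card : ℝ) ≤ 3 * A.card := by exact_mod_cast card_core_le A g
    have : (2 * m + (core A g).card : ℝ) ≤ (Finset.univ.filter fun v => β v = i).card := by
      linarith
    exact_mod_cast this
  · linarith [hle e, h1 e, hostWeight_nonneg (f := f) hpC e, hostWeight_nonneg (f := f) hr0 e]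
  · simp [hfβ, huv]
  · have e1 : c * N / 8 ≤ m := by linarith
    have e2 : Q₀ * (c ^ 2 / 64) ≤ q * m ^ 2 := by
      calc Q₀ * (c ^ 2 / 64) ≤ q * N ^ 2 * (c ^ 2 / 64) := by gcongr
        _ = q * (c * N / 8) ^ 2 := by ring
        _ ≤ _ := by gcongr
    gcongr

end RandomSubset

/-! ### The two-sided host and balancing paths -/

namespace HamiltonPath

/-- The group-valued function matters only through the pairs at which it sums to zero. -/
lemma RotationSetup.congr {V : Type*} [Fintype V] [DecidableEq V] {B B' : Type*} [AddCommGroup B]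
    [AddCommGroup B'] {f : V → B} {f' : V → B'} {M : Finset (Sym2 V)} {F D : Finset V}
    {l₀ : List V} {m : ℕ} {Γ : SimpleGraph V} (h : RotationSetup f M F D l₀ m Γ)
    (hff : ∀ u v, f u + f v = 0 ↔ f' u + f' v = 0) : RotationSetup f' M F D l₀ m Γ where
  three_le := h.three_le
  admissible :=
    { nodup := h.admissible.nodup
      mem := h.admissible.mem
      subset := h.admissible.subset
      host := fun e he => by
        refine (h.admissible.host e he).imp id fun h => ?_
        induction e with
        | h u v => rw [pairSum_mk] at h ⊢; exact (hff u v).1 h }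
  closes a b ha hb := (hff a b).1 (h.closes a b ha hb)
  touched := h.touched
  subset := h.subset
  two_forced := h.two_forced
  expand S h1 h2 h3 := (h.expand S h1 h2 h3).trans_le <| Finset.card_le_card fun u hu => by
    simp only [Finset.mem_filter, Finset.mem_univ, true_and] at hu ⊢
    obtain ⟨h1, h2, v, hv, hvu, h0⟩ := hu
    exact ⟨h1, h2, v, hv, hvu, (hff v u).1 h0⟩

end HamiltonPath

namespace RandomSubset

open HamiltonPath

/-- Twice the difference of the numbers of edges inside the two classes that a Hamilton cycle
through the forced edges has to contain in addition to these. -/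
def imbalance {V : Type*} [Fintype V] (f : V → ℤ) (A : Finset V) (g : V → Bool → V) : ℤ :=
  ∑ s ∈ A, (2 * f s + f (g s false) + f (g s true)) - 2 * ∑ v, f v

lemma even_imbalance {V : Type*} [Fintype V] {f : V → ℤ} (hf : ∀ v, f v = 1 ∨ f v = -1)
    (A : Finset V) (g : V → Bool → V) : Even (imbalance f A g) := by
  refine Even.sub (Finset.even_sum _ fun s _ => ?_) (even_two_mul _)
  have h1 := hf (g s false)
  have h2 := hf (g s true)
  rw [Int.even_iff]; omega

variable {V : Type*} [Fintype V] [DecidableEq V]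

/-- The sign change `-(ς * f)` gives the vertices of the path the value -1 and leaves the host
unchanged, so the two sides are treated at once. -/
lemma linkable_of_path (h3 : 3 ≤ Fintype.card V) {f : V → ℤ} (hf : ∀ v, f v = 1 ∨ f v = -1)
    {A : Finset V} {x y : Sym2 V → Bool} {g : V → Bool → V} (hg : Attached A x g) {ς : ℤ}
    (hς : ς = 1 ∨ ς = -1) {Q : List V} (hQ : Q ≠ []) (hQn : Q.Nodup)
    (hQc : ∀ v ∈ Q, v ∉ core A g) (hQf : ∀ v ∈ Q, f v = ς)
    (hQΓ : ∀ e ∈ pathEdges Q, e ∈ (graph y).edgeSet)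
    (hlen : 2 * ((Q.length : ℤ) - 1) = -(ς * imbalance f A g)) {Y : V → Finset V} {j : ℕ}
    (hYQ : ∀ v, (Y v ∩ Q.toFinset).card ≤ j) : Linkable f Y j A g x y := by
  refine ⟨core A g ∪ Q.toFinset, fun v => (Finset.card_le_card ?_).trans (hYQ v),
    fun m hexp => ?_⟩
  · intro u hu
    simp only [Finset.mem_inter, Finset.mem_sdiff, Finset.mem_union] at hu ⊢
    tauto
  have hzero : ∀ u v, -(ς * f u) + -(ς * f v) = 0 ↔ f u + f v = 0 := by
    intro u v
    rcases hς with rfl | rfl <;> constructor <;> intro h <;> linarith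
  have hexp' : Expands (fun v => -(ς * f v)) (core A g ∪ Q.toFinset) A m (graph (x ⊔ y)) := by
    intro S h1 h2 h3
    refine (hexp S h1 h2 h3).trans_le (Finset.card_le_card fun u hu => ?_)
    simp only [Finset.mem_filter, Finset.mem_univ, true_and] at hu ⊢
    obtain ⟨h1, h2, v, hv, hvu, h0⟩ := hu
    exact ⟨h1, h2, v, hv, hvu, (hzero v u).2 h0⟩
  obtain ⟨M, F, l, hR⟩ := hg.exists_rotationSetup_of_path h3 (f := fun v => -(ς * f v))
    (fun v => by rcases hς with rfl | rfl <;> rcases hf v with h | h <;> rw [h] <;> norm_num)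
    (graph_mono (le_sup_left : x ≤ x ⊔ y)) hQ hQn hQc
    (fun v hv => by rw [hQf v hv]; rcases hς with rfl | rfl <;> norm_num)
    (fun e he => SimpleGraph.edgeSet_mono (graph_mono le_sup_right) (hQΓ e he)) (by
      rw [hlen, imbalance]
      rcases hς with rfl | rfl
      · simp only [one_mul, Finset.sum_neg_distrib, neg_sub, mul_neg, ← neg_add,
          sub_neg_eq_add]
        ring
      · simp) hexp'
  exact ⟨M, F, l, hR.congr hzero⟩

/-- A single vertex outside the core serves as a balancing path without edges. -/
lemma linkable_of_imbalance_eq_zero (h3 : 3 ≤ Fintype.card V) {f : V → ℤ}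
    (hf : ∀ v, f v = 1 ∨ f v = -1) {A : Finset V} {x y : Sym2 V → Bool} {g : V → Bool → V}
    (hg : Attached A x g) (h0 : imbalance f A g = 0)
    (hcard : (core A g).card < (Finset.univ.filter fun v => f v = -1).card)
    (Y : V → Finset V) : Linkable f Y 1 A g x y := by
  obtain ⟨v, hv, hvc⟩ := Finset.exists_mem_notMem_of_card_lt_card hcard
  refine linkable_of_path h3 hf hg (Or.inr rfl) (Q := [v]) (by simp) (by simp) (by simpa using hvc)
    (by simpa using hv) (by simp) (by simp [h0]) fun u => ?_
  refine (Finset.card_le_card Finset.inter_subset_right).trans (by simp)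

/-- A long path inside one class balances the two classes with high probability. -/
lemma prob_not_linkable_le_of_pools (h3 : 3 ≤ Fintype.card V) {f : V → ℤ}
    (hf : ∀ v, f v = 1 ∨ f v = -1) {A : Finset V} {x : Sym2 V → Bool} {g : V → Bool → V}
    (hg : Attached A x g) {ς : ℤ} (hς : ς = 1 ∨ ς = -1) {Z Z' : Finset V} (hZ : Disjoint Z Z')
    (hZf : ∀ v ∈ Z ∪ Z', f v = ς) {z m : ℕ} (hz : z ≤ Z.card) (hz' : z ≤ Z'.card)
    (hpos : 0 ≤ -(ς * imbalance f A g))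
    (hlen : -(ς * imbalance f A g) + 2 + 4 * (core A g).card + 8 * m ≤ 4 * z)
    {Y : V → Finset V} (hY : ∀ v, Disjoint (Y v) (Z ∪ Z')) {w : Sym2 V → ℝ}
    (h0 : ∀ e, 0 ≤ w e) (h1 : ∀ e, w e ≤ 1) {r : ℝ} (hr : ∀ u ∈ Z, ∀ v ∈ Z', r ≤ w s(u, v)) :
    prob w (fun y => ¬ Linkable f Y 1 A g x y) ≤
      4 ^ Fintype.card V * Real.exp (-(r * m ^ 2)) := by
  classical
  have hsub : ∀ X : Finset V, z ≤ X.card → ∃ T ⊆ X \ core A g, T.card = z - (core A g).card := by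
    intro X hX
    refine Finset.exists_subset_card_eq ?_
    have := Finset.le_card_sdiff (core A g) X
    omega
  obtain ⟨T, hT, hTz⟩ := hsub Z hz
  obtain ⟨T', hT', hTz'⟩ := hsub Z' hz'
  have hTZ : T ⊆ Z := hT.trans Finset.sdiff_subset
  have hTZ' : T' ⊆ Z' := hT'.trans Finset.sdiff_subset
  have hdisj : Disjoint T T' := hZ.mono hTZ hTZ'
  refine (prob_mono h0 h1 fun y hy hjoin => hy ?_).trans
    (prob_not_joined_le h0 h1 hdisj (fun u hu v hv => hr u (hTZ hu) v (hTZ' hv)) m)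
  obtain ⟨l, hl, hlm, hle, hlen'⟩ := exists_long_path hdisj (hTz.trans hTz'.symm) hjoin
  obtain ⟨e, he⟩ := even_imbalance hf A g
  obtain ⟨d, hd⟩ : ∃ d : ℕ, -(ς * imbalance f A g) = 2 * d := by
    rcases hς with rfl | rfl
    · exact ⟨(-e).toNat, by omega⟩
    · exact ⟨e.toNat, by omega⟩
  -- Outside the core each pool still has `z - (core A g).card` vertices, so the long path is long
  -- enough for an initial segment with exactly `d` edges. Here `2 * d` is the even number to be
  -- balanced.
  have hd1 : d + 1 ≤ l.length := by omega
  have hlZ : ∀ v ∈ l.take (d + 1), v ∈ T ∪ T' := fun v hv => hlm v (List.mem_of_mem_take hv)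
  have hlen2 : (l.take (d + 1)).length = d + 1 := by rw [List.length_take]; omega
  refine linkable_of_path h3 hf hg hς (Q := l.take (d + 1)) (fun h => ?_) (hl.take)
    (fun v hv => ?_) (fun v hv => hZf v (Finset.union_subset_union hTZ hTZ' (hlZ v hv)))
    (fun e he => hle e (mem_pathEdges_of_take he)) (by rw [hd, hlen2]; push_cast; ring) fun v => ?_
  · rw [h] at hlen2; simp at hlen2
  · rcases Finset.mem_union.1 (hlZ v hv) with h | h
    · exact (Finset.mem_sdiff.1 (hT h)).2
    · exact (Finset.mem_sdiff.1 (hT' h)).2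
  · rw [Finset.disjoint_iff_inter_eq_empty.1 ((hY v).mono_right (?_ : _ ⊆ Z ∪ Z'))]
    · simp
    · intro u hu
      exact Finset.union_subset_union hTZ hTZ' (hlZ u (List.mem_toFinset.1 hu))

/-- Hamiltonicity for two classes whose pairs are all in the host, when pools inside one class
allow to balance the classes. -/
theorem exists_prob_not_isHamiltonian_le_of_pools {K γ c : ℝ} (hK : 1 ≤ K) (hγ0 : 0 < γ)
    (hγ1 : γ ≤ 1) (hc : 0 < c) :
    ∃ C : ℝ, 1 ≤ C ∧ ∀ ε : ℝ, 0 < ε → ∃ (N₀ : ℕ) (W₀ : ℝ),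
      ∀ (V : Type) [Fintype V] [DecidableEq V] (f : V → ℤ)
        (Y : V → Finset V) (w wa wb : Sym2 V → ℝ), N₀ ≤ Fintype.card V →
        (∀ v, f v = 1 ∨ f v = -1) →
        c * Fintype.card V ≤ (Finset.univ.filter fun v => f v = -1).card →
        (∀ e, 0 ≤ wa e) → (∀ e, 0 ≤ wb e) → (∀ e, w e ≤ 1) →
        (∀ e, wa e + wb e + hostWeight f (C / Fintype.card V) e ≤ w e) →
        (∀ e, wa e ≤ K * Real.log (Fintype.card V) / Fintype.card V) →
        (∀ v, Real.log (Fintype.card V) + Real.log (Real.log (Fintype.card V)) + W₀ ≤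
          ∑ u ∈ Finset.univ.erase v, wa s(v, u)) →
        (∀ v, γ * Real.log (Fintype.card V) ≤ ∑ u ∈ Y v, wa s(v, u)) →
        (∀ v, v ∉ Y v) → (∀ v, ∀ u ∈ Y v, f v + f u = 0) →
        (∀ x A g, (∀ e, x e = true → wa e ≠ 0) → Attached A x g →
          (A.card : ℝ) ≤ Fintype.card V / Real.log (Fintype.card V) ^ 2 →
          imbalance f A g = 0 ∨ ∃ (ς : ℤ) (Z Z' : Finset V), (ς = 1 ∨ ς = -1) ∧ Disjoint Z Z' ∧
            Z.card = Z'.card ∧ (∀ v ∈ Z ∪ Z', f v = ς) ∧ (∀ v, Disjoint (Y v) (Z ∪ Z')) ∧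
            (∀ u ∈ Z, ∀ v ∈ Z', C / Fintype.card V ≤ wb s(u, v)) ∧
            0 ≤ -(ς * imbalance f A g) ∧
            ((-(ς * imbalance f A g) : ℤ) : ℝ) + c * Fintype.card V ≤ 4 * Z.card) →
        prob w (fun x => ¬ (graph x).IsHamiltonian) ≤ ε := by
  obtain ⟨C, hC, hmain⟩ := exists_prob_not_isHamiltonian_le hK hγ0 hγ1
  -- Since `m ≥ c * N / 32`, this makes `C₁ / N * m ^ 2 ≥ 3 * N`, which beats the factor `4 ^ N ≤
  -- exp (2 * N)`.
  set C₁ : ℝ := max C (3 * 1024 / c ^ 2) with hC₁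
  refine ⟨C₁, hC.trans (le_max_left _ _), fun ε hε => ?_⟩
  obtain ⟨N₁, W₁, hmain⟩ := hmain 1 (ε / 3) (by positivity)
  obtain ⟨N₂, hN₂⟩ := eventually_exists_card ((eventually_ge_atTop (1 : ℝ)).and
    ((tendsto_pow_atTop (two_ne_zero)).eventually_ge_atTop (48 / c)))
  have hexp : ∀ᶠ N : ℕ in atTop, Real.exp (-(N : ℝ)) ≤ ε / 3 := by
    have : Tendsto (fun N : ℕ => Real.exp (-(N : ℝ))) atTop (𝓝 0) :=
      Real.tendsto_exp_neg_atTop_nhds_zero.comp tendsto_natCast_atTop_atTop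
    exact this.eventually_le_const (by positivity)
  obtain ⟨N₃, hN₃⟩ := eventually_atTop.1
    ((tendsto_natCast_atTop_atTop.eventually_ge_atTop (32 / c)).and hexp)
  refine ⟨max (max N₁ N₂) (max N₃ 3), W₁, ?_⟩
  intro V _ _ f Y w wa wb hN hf hfc ha0 hb0 h1 hsum hκ hdeg hγ hYv hYf hpool
  classical
  obtain ⟨hL1, hL2⟩ := hN₂ _ ((le_max_right _ _).trans ((le_max_left _ _).trans hN))
  have hN3 : 3 ≤ Fintype.card V := (le_max_right _ _).trans ((le_max_right _ _).trans hN)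
  obtain ⟨hNc, hNε⟩ := hN₃ _ ((le_max_left _ _).trans ((le_max_right _ _).trans hN))
  set N : ℝ := ((Fintype.card V : ℕ) : ℝ) with hNdef
  have hN0 : 0 < N := by rw [hNdef]; exact_mod_cast (by omega : 0 < Fintype.card V)
  have hCC : C / N ≤ C₁ / N := by gcongr; exact le_max_left _ _
  have hCN : 0 ≤ C / N := by positivity
  have hhost : ∀ e, hostWeight f (C / N) e ≤ hostWeight f (C₁ / N) e := by
    intro e; rw [hostWeight, hostWeight]; split_ifs <;> simp [hCC]
  have hc0 := hostWeight_nonneg (f := f) hCN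
  have hb1 : ∀ e, wb e ≤ 1 := fun e => by linarith [ha0 e, hc0 e, hhost e, hsum e, h1 e]
  have h := hmain V ℤ f Y w wa wb ((le_max_left _ _).trans ((le_max_left _ _).trans hN)) ha0 hb0 h1
    (fun e => by rw [← hNdef]; linarith [hsum e, hhost e]) hκ hdeg hγ hYv hYf ?_
  · linarith
  intro x A g hsupp hg hA
  have hcN : 32 ≤ c * N := by
    have := (div_le_iff₀ hc).1 hNc; linarith
  have hAc : 48 * (A.card : ℝ) ≤ c * N := by
    have : 48 ≤ Real.log N ^ 2 * c := (div_le_iff₀ hc).1 hL2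
    have hL0 : 0 < Real.log N ^ 2 := by positivity
    rw [le_div_iff₀ hL0] at hA
    nlinarith
  have hcore : ((core A g).card : ℝ) ≤ 3 * A.card := by exact_mod_cast card_core_le A g
  rcases hpool x A g hsupp hg hA with h0 | ⟨ς, Z, Z', hς, hZ, hZZ, hZf, hZY, hZw, hpos, hlen⟩
  · have hlt : ((core A g).card : ℝ) < (Finset.univ.filter fun v => f v = -1).card := by linarith
    rw [prob_eq_zero _ fun y hy => hy (linkable_of_imbalance_eq_zero hN3 hf hg h0
      (by exact_mod_cast hlt) Y)]
    positivity
  · set m : ℕ := ⌊c * N / 16⌋₊ with hm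
    have hm1 : (m : ℝ) ≤ c * N / 16 := Nat.floor_le (by positivity)
    have hm2 : c * N / 16 < m + 1 := Nat.lt_floor_add_one _
    refine (prob_not_linkable_le_of_pools hN3 hf hg hς hZ hZf (m := m) le_rfl hZZ.le hpos ?_ hZY
      hb0 hb1 hZw).trans (le_trans ?_ hNε)
    · have : ((-(ς * imbalance f A g) : ℤ) : ℝ) + 2 + 4 * (core A g).card + 8 * m ≤
          4 * Z.card := by linarith
      exact_mod_cast this
    · have hm3 : c * N / 32 ≤ m := by linarith
      have h4 : (4 : ℝ) ^ Fintype.card V ≤ Real.exp (2 * N) := by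
        have h4' : (4 : ℝ) ≤ Real.exp 2 := by
          have h2 : Real.exp 2 = Real.exp 1 ^ 2 := by rw [← Real.exp_nat_mul]; norm_num
          have := Real.exp_one_gt_d9
          rw [h2]; nlinarith
        calc (4 : ℝ) ^ Fintype.card V ≤ Real.exp 2 ^ Fintype.card V := by gcongr
          _ = Real.exp (2 * N) := by rw [← Real.exp_nat_mul, mul_comm, hNdef]
      have h5 : 3 * N ≤ C₁ / N * (m : ℝ) ^ 2 := by
        calc 3 * N = (3 * 1024 / c ^ 2) / N * (c * N / 32) ^ 2 := by field_simp; ring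
          _ ≤ C₁ / N * (m : ℝ) ^ 2 := by
            gcongr
            exact le_max_right _ _
      calc _ ≤ Real.exp (2 * N) * Real.exp (-(3 * N)) := by gcongr
        _ = Real.exp (-N) := by rw [← Real.exp_add]; ring_nf

end RandomSubset

/-! ### Dividing the blocks into two sides -/

namespace RandomSubset

open HamiltonPath

/-- A choice of some of several numbers, each at most half of the total, with sum close to
half of the total. -/
lemma exists_balanced_subset {k : ℕ} {n : Fin k → ℕ} {N : ℕ} (hN : ∑ i, n i = N) (hN0 : 0 < N)
    (hn : ∀ i, 2 * n i ≤ N) (hn0 : ∀ i, 0 < n i) {η : ℝ} (hη0 : 0 ≤ η) (hη : ∀ i, η ≤ n i) :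
    ∃ J : Finset (Fin k), J.Nonempty ∧ 2 * ∑ i ∈ J, n i ≤ N ∧
      (∀ j ∉ J, (N : ℝ) - 2 * (∑ i ∈ J, n i : ℕ) ≤ n j) ∧
      ((∃ i, J = {i} ∧ (N : ℝ) - 2 * (∑ i ∈ J, n i : ℕ) ≤ η ∧
          (2 * ∑ i ∈ J, n i = N ∨ ∃ j ∉ J, ∃ j' ∉ J, j ≠ j')) ∨
        ((∃ j ∉ J, ∃ j' ∉ J, j ≠ j') ∧ ((∃ i ∈ J, ∃ i' ∈ J, i ≠ i') ∨
          η < (N : ℝ) - 2 * (∑ i ∈ J, n i : ℕ)))) := by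
  classical
  have hk : Nonempty (Fin k) := by
    by_contra h
    rw [not_nonempty_iff] at h
    simp at hN; omega
  have hcompl : ∀ J : Finset (Fin k), ∑ i ∈ J, n i + ∑ i ∈ Jᶜ, n i = N := fun J => by
    rw [Finset.sum_add_sum_compl, hN]
  have htwo : ∀ J : Finset (Fin k), 2 * ∑ i ∈ J, n i < N → ∃ j ∉ J, ∃ j' ∉ J, j ≠ j' := by
    intro J hI
    have h1 := hcompl J
    have hcard : 1 < (Jᶜ).card := by
      by_contra! hle
      rcases Finset.card_le_one_iff_subset_singleton.1 hle with ⟨j, hj⟩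
      have h2 : ∑ i ∈ Jᶜ, n i ≤ ∑ i ∈ ({j} : Finset (Fin k)), n i :=
        Finset.sum_le_sum_of_subset hj
      rw [Finset.sum_singleton] at h2
      have := hn j
      omega
    obtain ⟨j, hj, j', hj', hne⟩ := Finset.one_lt_card.1 hcard
    exact ⟨j, Finset.mem_compl.1 hj, j', Finset.mem_compl.1 hj', hne⟩
  -- A block with almost half of the vertices is made a side of its own. No balancing path fits
  -- inside a single block, so the difference must then be balanced on the other side.
  by_cases hcase : ∃ i, (N : ℝ) - 2 * n i ≤ η
  · obtain ⟨i, hi⟩ := hcase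
    refine ⟨{i}, by simp, by simpa using hn i, fun j _ => ?_, Or.inl ⟨i, rfl, by simpa using hi, ?_⟩⟩
    · rw [Finset.sum_singleton]; exact hi.trans (hη j)
    · rw [Finset.sum_singleton]
      by_cases h : 2 * n i = N
      · exact Or.inl h
      · exact Or.inr (htwo {i} (by rw [Finset.sum_singleton]; have := hn i; omega))
  · push Not at hcase
    obtain ⟨J, hI, hmax⟩ := Finset.exists_max_image
      ((Finset.univ : Finset (Finset (Fin k))).filter fun J => 2 * ∑ i ∈ J, n i ≤ N)
      (fun J => ∑ i ∈ J, n i) ⟨∅, by simp⟩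
    simp only [Finset.mem_filter, Finset.mem_univ, true_and] at hI hmax
    -- If adding `j` exceeds one half, the complement of `insert j J` is below one half, and the
    -- maximality of `J` bounds it by the sum over `J`.
    have hlarge : ∀ j ∉ J, N ≤ 2 * ∑ i ∈ J, n i + n j := by
      intro j hj
      by_cases h : 2 * (∑ i ∈ insert j J, n i) ≤ N
      · have := hmax _ h
        rw [Finset.sum_insert hj] at this
        have := hn0 j
        omega
      · have h1 := hcompl (insert j J)
        have h2 := hmax (insert j J)ᶜ (by omega)
        rw [Finset.sum_insert hj] at h h1
        omega
    refine ⟨J, ?_, hI, fun j hj => ?_, Or.inr ⟨?_, ?_⟩⟩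
    · rw [Finset.nonempty_iff_ne_empty]
      rintro rfl
      obtain ⟨i⟩ := hk
      have := hmax {i} (by simpa using hn i)
      have := hn0 i
      simp at *
      omega
    · have : (N : ℝ) ≤ 2 * (∑ i ∈ J, n i : ℕ) + n j := by exact_mod_cast hlarge j hj
      linarith
    · rcases hI.lt_or_eq with h | h
      · exact htwo J h
      · have hcard : 1 < (Jᶜ).card := by
          by_contra! hle
          rcases Finset.card_le_one_iff_subset_singleton.1 hle with ⟨j, hj⟩
          have h1 := hcompl J
          have h2 : ∑ i ∈ Jᶜ, n i ≤ ∑ i ∈ ({j} : Finset (Fin k)), n i :=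
            Finset.sum_le_sum_of_subset hj
          rw [Finset.sum_singleton] at h2
          have h3 := hn j
          have h4 := hcase j
          have h5 : (N : ℝ) = 2 * n j := by exact_mod_cast (by omega : N = 2 * n j)
          linarith
        obtain ⟨j, hj, j', hj', hne⟩ := Finset.one_lt_card.1 hcard
        exact ⟨j, Finset.mem_compl.1 hj, j', Finset.mem_compl.1 hj', hne⟩
    · by_cases h : ∃ i ∈ J, ∃ i' ∈ J, i ≠ i'
      · exact Or.inl h
      · right
        push Not at h
        have hle : J.card ≤ 1 := Finset.card_le_one.2 fun i hi i' hi' => h i hi i' hi'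
        rcases Finset.card_le_one_iff_subset_singleton.1 hle with ⟨j, hj⟩
        have h2 : ∑ i ∈ J, n i ≤ ∑ i ∈ ({j} : Finset (Fin k)), n i :=
          Finset.sum_le_sum_of_subset hj
        rw [Finset.sum_singleton] at h2
        have h4 := hcase j
        have h5 : ((∑ i ∈ J, n i : ℕ) : ℝ) ≤ n j := by exact_mod_cast h2
        linarith

variable {V : Type*} [Fintype V] [DecidableEq V]

/-- The two sides of a partition into unions of blocks, and pools on both sides for balancing
paths. -/
lemma exists_sides_and_pools {k : ℕ} {β : V → Fin k} {c η : ℝ} (hc : 0 < c)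
    (hN : 32 ≤ c * Fintype.card V) (hη0 : 0 ≤ η) (hη : η ≤ c * Fintype.card V)
    (hlow : ∀ i, c * Fintype.card V ≤ (Finset.univ.filter fun v => β v = i).card)
    (hup : ∀ i, 2 * (Finset.univ.filter fun v => β v = i).card ≤ Fintype.card V) :
    ∃ (J : Finset (Fin k)) (Z Z' : Bool → Finset V) (U : ℕ),
      U = (Finset.univ.filter fun v => β v ∈ J).card ∧ 2 * U ≤ Fintype.card V ∧
      c * Fintype.card V ≤ U ∧ (∀ b, ∀ v ∈ Z b ∪ Z' b, (β v ∈ J ↔ b = true)) ∧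
      (∀ b, ∀ u ∈ Z b, ∀ v ∈ Z' b, β u ≠ β v) ∧ (∀ b, (Z b).card = (Z' b).card) ∧
      c * Fintype.card V / 4 + 2 * (Z true).card ≤ U ∧
      c * Fintype.card V / 4 + 2 * (Z false).card ≤ (Fintype.card V : ℝ) - U ∧
      ((∃ i, J = {i} ∧ (Fintype.card V : ℝ) - 2 * U ≤ η ∧ (2 * U = Fintype.card V ∨
          2 * ((Fintype.card V : ℝ) - 2 * U) + c * Fintype.card V / 2 ≤ 4 * (Z false).card)) ∨
        (2 * ((Fintype.card V : ℝ) - 2 * U) + c * Fintype.card V / 2 ≤ 4 * (Z false).card ∧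
          (η < (Fintype.card V : ℝ) - 2 * U ∨
            c * Fintype.card V / 2 ≤ 4 * (Z true).card))) := by
  classical
  set N : ℝ := ((Fintype.card V : ℕ) : ℝ) with hNdef
  set n : Fin k → ℕ := fun i => (Finset.univ.filter fun v => β v = i).card with hn
  have hfib : ∀ J : Finset (Fin k), (Finset.univ.filter fun v => β v ∈ J).card = ∑ i ∈ J, n i := by
    intro J
    rw [Finset.card_eq_sum_card_fiberwise (f := β) (t := J) (fun v hv => by simpa using hv)]
    refine Finset.sum_congr rfl fun i hi => ?_
    congr 1
    ext v
    simp only [Finset.mem_filter, Finset.mem_univ, true_and]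
    constructor
    · exact fun h => h.2
    · exact fun h => ⟨h ▸ hi, h⟩
  have hNsum : ∑ i, n i = Fintype.card V := by
    rw [← hfib Finset.univ]; simp
  have hN0 : 0 < N := by
    by_contra! h
    have := mul_nonpos_of_nonneg_of_nonpos hc.le h
    linarith
  have hN0' : 0 < Fintype.card V := by rw [hNdef] at hN0; exact_mod_cast hN0
  have hn0 : ∀ i, 0 < n i := fun i => by
    have h1 := hlow i
    have : (0 : ℝ) < n i := by linarith
    exact_mod_cast this
  obtain ⟨J, hIne, hI2, hIj, hmode⟩ := exists_balanced_subset hNsum hN0' hup hn0 hη0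
    (fun i => hη.trans (hlow i))
  set U := ∑ i ∈ J, n i with hU
  have hUc : c * N ≤ U := by
    obtain ⟨i, hi⟩ := hIne
    have : n i ≤ U := Finset.single_le_sum (f := n) (fun _ _ => Nat.zero_le _) hi
    exact (hlow i).trans (by exact_mod_cast this)
  have hUN : 2 * (U : ℝ) ≤ N := by rw [hNdef]; exact_mod_cast hI2
  have hpool : ∀ (j j' : Fin k) (z : ℕ), j ≠ j' → z ≤ n j → z ≤ n j' → ∃ T T' : Finset V,
      (∀ v ∈ T, β v = j) ∧ (∀ v ∈ T', β v = j') ∧ T.card = z ∧ T'.card = z := by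
    intro j j' z _ hz hz'
    obtain ⟨T, hT, hTz⟩ := Finset.exists_subset_card_eq hz
    obtain ⟨T', hT', hTz'⟩ := Finset.exists_subset_card_eq hz'
    exact ⟨T, T', fun v hv => by simpa using hT hv, fun v hv => by simpa using hT' hv, hTz, hTz'⟩
  have hWpool : ∃ T T' : Finset V, (∀ v ∈ T ∪ T', β v ∉ J) ∧ (∀ u ∈ T, ∀ v ∈ T', β u ≠ β v) ∧
      T.card = T'.card ∧ c * N / 4 + 2 * T.card ≤ N - U ∧
      ((∃ j ∉ J, ∃ j' ∉ J, j ≠ j') → 2 * (N - 2 * U) + c * N / 2 ≤ 4 * T.card) := by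
    by_cases h : ∃ j ∉ J, ∃ j' ∉ J, j ≠ j'
    · obtain ⟨j, hj, j', hj', hne⟩ := h
      -- Two pools of this size hold a path of the length required by the difference of the sides,
      -- with a linear surplus. Each block outside `J` is large enough by `hIj`.
      set z := ⌈(N - 2 * U) / 2 + c * N / 8⌉₊ with hz
      have hz1 : (N - 2 * U) / 2 + c * N / 8 ≤ z := Nat.le_ceil _
      have hz2 : (z : ℝ) < (N - 2 * U) / 2 + c * N / 8 + 1 :=
        Nat.ceil_lt_add_one (by linarith)
      have hzj : ∀ j ∉ J, z ≤ n j := fun j hj => by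
        have h1 := hIj j hj
        have h2 := hlow j
        have : (z : ℝ) ≤ n j := by
          simp only [hn]; simp only [hn, ← hNdef] at h1; linarith
        exact_mod_cast this
      obtain ⟨T, T', hT, hT', hTz, hTz'⟩ := hpool j j' z hne (hzj j hj) (hzj j' hj')
      refine ⟨T, T', fun v hv => ?_, fun u hu v hv => ?_, hTz.trans hTz'.symm, ?_, fun _ => ?_⟩
      · rcases Finset.mem_union.1 hv with hv | hv
        · rw [hT v hv]; exact hj
        · rw [hT' v hv]; exact hj'
      · rw [hT u hu, hT' v hv]; exact hne
      · rw [hTz]; linarith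
      · rw [hTz]; linarith
    · exact ⟨∅, ∅, by simp, by simp, rfl, by simp; linarith, fun h' => absurd h' h⟩
  have hUpool : ∃ T T' : Finset V, (∀ v ∈ T ∪ T', β v ∈ J) ∧ (∀ u ∈ T, ∀ v ∈ T', β u ≠ β v) ∧
      T.card = T'.card ∧ c * N / 4 + 2 * T.card ≤ U ∧
      ((∃ j ∈ J, ∃ j' ∈ J, j ≠ j') → c * N / 2 ≤ 4 * T.card) := by
    by_cases h : ∃ j ∈ J, ∃ j' ∈ J, j ≠ j'
    · obtain ⟨j, hj, j', hj', hne⟩ := h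
      set z := ⌈c * N / 8⌉₊ with hz
      have hz1 : c * N / 8 ≤ z := Nat.le_ceil _
      have hz2 : (z : ℝ) < c * N / 8 + 1 := Nat.ceil_lt_add_one (by linarith)
      have hzj : ∀ j, z ≤ n j := fun j => by
        have h2 := hlow j
        have : (z : ℝ) ≤ n j := by simp only [hn]; linarith
        exact_mod_cast this
      obtain ⟨T, T', hT, hT', hTz, hTz'⟩ := hpool j j' z hne (hzj j) (hzj j')
      refine ⟨T, T', fun v hv => ?_, fun u hu v hv => ?_, hTz.trans hTz'.symm, ?_, fun _ => ?_⟩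
      · rcases Finset.mem_union.1 hv with hv | hv
        · rw [hT v hv]; exact hj
        · rw [hT' v hv]; exact hj'
      · rw [hT u hu, hT' v hv]; exact hne
      · rw [hTz]; linarith
      · rw [hTz]; linarith
    · exact ⟨∅, ∅, by simp, by simp, rfl, by simp; linarith, fun h' => absurd h' h⟩
  obtain ⟨W, W', hW1, hW2, hW3, hW4, hW5⟩ := hWpool
  obtain ⟨T, T', hT1, hT2, hT3, hT4, hT5⟩ := hUpool
  refine ⟨J, fun b => if b then T else W, fun b => if b then T' else W', U, (hfib J).symm, hI2,
    hUc, fun b v hv => ?_, fun b => ?_, fun b => ?_, by simpa using hT4, by simpa using hW4, ?_⟩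
  · cases b
    · simpa using hW1 v (by simpa using hv)
    · simpa using hT1 v (by simpa using hv)
  · cases b
    · simpa using hW2
    · simpa using hT2
  · cases b
    · simpa using hW3
    · simpa using hT3
  · simp only [Bool.false_eq_true, if_false, if_true]
    rcases hmode with ⟨i, hi, h1, h2⟩ | ⟨h1, h2⟩
    · exact Or.inl ⟨i, hi, h1, h2.imp id hW5⟩
    · exact Or.inr ⟨hW5 h1, h2.symm.imp id hT5⟩

end RandomSubset

/-! ### Multipartite random graphs -/

namespace RandomSubset

open HamiltonPath

set_option maxHeartbeats 1000000 in
/-- Hamiltonicity of random multipartite graphs whose blocks contain at most half of the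
vertices. -/
theorem exists_prob_not_isHamiltonian_le_of_multipartite {K c : ℝ} (hK : 1 ≤ K) (hc : 0 < c)
    {k : ℕ} {ε : ℝ} (hε : 0 < ε) : ∃ (N₀ : ℕ) (W₀ : ℝ),
      ∀ (V : Type) [Fintype V] [DecidableEq V] (w : Sym2 V → ℝ) (β : V → Fin k) (q : ℝ),
        N₀ ≤ Fintype.card V → (∀ e, 0 ≤ w e) → (∀ e, w e ≤ 1) →
        (∀ u v, β u ≠ β v → q ≤ w s(u, v)) →
        0 ≤ q → q ≤ K * Real.log (Fintype.card V) / Fintype.card V →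
        (∀ i, c * Fintype.card V ≤ (Finset.univ.filter fun v => β v = i).card) →
        (∀ i, 2 * (Finset.univ.filter fun v => β v = i).card ≤ Fintype.card V) →
        (∀ i, Real.log (Fintype.card V) + Real.log (Real.log (Fintype.card V)) + W₀ ≤
          q * (Fintype.card V - (Finset.univ.filter fun v => β v = i).card)) →
        prob w (fun x => ¬ (graph x).IsHamiltonian) ≤ ε := by
  obtain ⟨C, hC, hmain⟩ := exists_prob_not_isHamiltonian_le_of_pools (γ := min 1 (c / 8))
    (c := c / 4) hK (lt_min one_pos (by positivity)) (min_le_left _ _) (by positivity)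
  obtain ⟨N₁, W₁, hmain⟩ := hmain ε hε
  obtain ⟨N₂, hN₂⟩ := eventually_exists_card ((eventually_ge_atTop (max (max 1 (4 * C)) (2 * K))).and
    ((tendsto_pow_atTop (two_ne_zero)).eventually_ge_atTop (16 / c)))
  obtain ⟨N₃, hN₃⟩ := eventually_atTop.1
    (tendsto_natCast_atTop_atTop.eventually_ge_atTop (32 / c))
  -- The linking and sprinkled layers take `C` each from the expected degrees; the 1 covers the
  -- pairs inside the larger side when only pairs between the sides are used.
  refine ⟨max (max N₁ N₂) (max N₃ 3), max W₁ 0 + 2 * C + 1, ?_⟩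
  intro V _ _ w β q hN h0 h1 hq hq0 hκ hlow hup hdeg
  classical
  obtain ⟨hL, hL2⟩ := hN₂ _ ((le_max_right _ _).trans ((le_max_left _ _).trans hN))
  have hN3 : 3 ≤ Fintype.card V := (le_max_right _ _).trans ((le_max_right _ _).trans hN)
  have hNc := hN₃ _ ((le_max_left _ _).trans ((le_max_right _ _).trans hN))
  set N : ℝ := ((Fintype.card V : ℕ) : ℝ) with hNdef
  have hN0 : 0 < N := by rw [hNdef]; exact_mod_cast (by omega : 0 < Fintype.card V)
  set L := Real.log N with hLdef
  have hL1 : 1 ≤ L := (le_max_left _ _).trans ((le_max_left _ _).trans hL)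
  have hLC : 4 * C ≤ L := (le_max_right _ _).trans ((le_max_left _ _).trans hL)
  have hLK : 2 * K ≤ L := (le_max_right _ _).trans hL
  have hlog := Real.log_nonneg hL1
  have hcN : 32 ≤ c * N := by have := (div_le_iff₀ hc).1 hNc; linarith
  have hL2' : 16 ≤ L ^ 2 * c := (div_le_iff₀ hc).1 hL2
  have hLpos : 0 < L ^ 2 := by positivity
  -- The forced paths change the balance by at most `4 * A.card ≤ 2 * η`. So a difference of the
  -- sides above `η`, which enters the imbalance with factor two, determines the sign.
  set η : ℝ := 2 * (N / L ^ 2) with hη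
  have hη0 : 0 ≤ η := by positivity
  have hηc : 8 * η ≤ c * N := by
    have : N / L ^ 2 ≤ c * N / 16 := by
      rw [div_le_iff₀ hLpos]; nlinarith
    linarith
  obtain ⟨J, Z, Z', U, hU, hU2, hUc, hZJ, hZβ, hZcard, hZU, hZW, hmode⟩ :=
    exists_sides_and_pools (β := β) hc hcN hη0 (by linarith) hlow hup
  rw [← hNdef] at hUc hZU hZW hmode
  have hUN : 2 * (U : ℝ) ≤ N := by rw [hNdef]; exact_mod_cast hU2
  set f : V → ℤ := fun v => if β v ∈ J then 1 else -1 with hf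
  have hf1 : ∀ v, f v = 1 ∨ f v = -1 := fun v => by simp only [hf]; split_ifs <;> simp
  have hfJ : ∀ v, f v = 1 ↔ β v ∈ J := fun v => by simp only [hf]; split_ifs <;> simp [*]
  have hfJ' : ∀ v, f v = -1 ↔ β v ∉ J := fun v => by simp only [hf]; split_ifs <;> simp [*]
  have hcardW : ((Finset.univ.filter fun v => β v ∉ J).card : ℝ) = N - U := by
    have := Finset.card_filter_add_card_filter_not (s := (Finset.univ : Finset V))
      (fun v => β v ∈ J)
    rw [← hU, Finset.card_univ] at this
    rw [hNdef, ← this]; push_cast; ring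
  have hfsum : ((∑ v, f v : ℤ) : ℝ) = 2 * U - N := by
    have : (∑ v, f v : ℤ) = U - (Finset.univ.filter fun v => β v ∉ J).card := by
      simp only [hf]
      rw [Finset.sum_ite, Finset.sum_const, Finset.sum_const, ← hU]; simp [sub_eq_add_neg]
    rw [this]; push_cast; rw [hcardW]; ring
  have hcross : ∀ u v, f u + f v = 0 → β u ≠ β v := fun u v huv hβ => by
    have h1 : f u = f v := by simp only [hf, hβ]
    have := hf1 u
    omega
  set a : ℝ := q - 2 * (C / N) with ha
  have hJne : J.Nonempty := by
    rw [Finset.nonempty_iff_ne_empty]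
    rintro rfl
    simp only [Finset.notMem_empty, Finset.filter_false, Finset.card_empty] at hU
    rw [hU] at hUc; norm_num at hUc; linarith
  obtain ⟨i₀, hi₀⟩ := hJne
  have hqN : L ≤ q * N := by
    have h2 := hdeg i₀
    have h3 : 0 ≤ q * ((Finset.univ.filter fun v => β v = i₀).card : ℝ) := by positivity
    have := le_max_right W₁ 0
    linarith
  have haN : L / 2 ≤ a * N := by
    have : a * N = q * N - 2 * C := by rw [ha]; field_simp
    linarith
  have ha0 : 0 ≤ a := by
    by_contra! h
    have := mul_neg_of_neg_of_pos h hN0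
    linarith
  -- The test sets avoid all pools, so the balancing path takes no vertex from them;
  -- `exists_sides_and_pools` leaves linearly many vertices on each side.
  set Y : V → Finset V := fun v => Finset.univ.filter fun u =>
    f v + f u = 0 ∧ ∀ b, u ∉ Z b ∪ Z' b with hY
  have hYmem : ∀ v u, u ∈ Y v ↔ f v + f u = 0 ∧ ∀ b, u ∉ Z b ∪ Z' b := fun v u => by simp [hY]
  have hYcard : ∀ v, c * N / 4 ≤ (Y v).card := by
    intro v
    have key : ∀ (b : Bool) (X : Finset V), (∀ u ∈ X, f v + f u = 0 ∧ (β u ∈ J ↔ b = true)) →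
        (X.card : ℝ) ≤ (Y v).card + 2 * (Z b).card := by
      intro b X hX
      have h2 : X.card ≤ (Y v).card + (Z b ∪ Z' b).card := by
        refine (Finset.card_le_card fun u hu => ?_).trans (Finset.card_union_le _ _)
        rw [Finset.mem_union, hYmem]
        by_cases hub : u ∈ Z b ∪ Z' b
        · exact Or.inr hub
        · refine Or.inl ⟨(hX u hu).1, fun b' hb' => ?_⟩
          have e1 := (hX u hu).2
          have e2 := hZJ b' u hb'
          exact hub (Bool.eq_iff_iff.2 (e1.symm.trans e2) ▸ hb')
      have h3 := Finset.card_union_le (Z b) (Z' b)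
      rw [← hZcard b] at h3
      have : X.card ≤ (Y v).card + 2 * (Z b).card := by omega
      exact_mod_cast this
    rcases hf1 v with hv | hv
    · have := key false (Finset.univ.filter fun v => β v ∉ J) fun u hu => by
        have : β u ∉ J := by simpa using hu
        exact ⟨by rw [hv, (hfJ' u).2 this]; norm_num, by simpa using this⟩
      rw [hcardW] at this
      linarith
    · have := key true (Finset.univ.filter fun v => β v ∈ J) fun u hu => by
        have : β u ∈ J := by simpa using hu
        exact ⟨by rw [hv, (hfJ u).2 this]; norm_num, by simpa using this⟩
      rw [← hU] at this
      linarith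
  have hCN : 0 ≤ C / N := by positivity
  set wb : Sym2 V → ℝ := fun e => if pairSum (classIndicator β) e = 0 then 0 else C / N with hwb
  have hwb' : ∀ u v, wb s(u, v) = if β u = β v then 0 else C / N := fun u v => by
    simp only [hwb, pairSum_mk, classIndicator_add_eq_zero]
  -- the bound for a structure layer with suitable degrees and balance
  have key : ∀ wa : Sym2 V → ℝ, (∀ u v, 0 ≤ wa s(u, v)) →
      (∀ u v, wa s(u, v) ≤ if β u = β v then 0 else a) →
      (∀ u v, f u + f v = 0 → wa s(u, v) = a) →
      (∀ v, ∃ T : Finset V, v ∉ T ∧ (∀ u ∈ T, wa s(v, u) = a) ∧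
        L + Real.log L + max W₁ 0 + 2 * C ≤ q * T.card) →
      (∀ x A g, (∀ e, x e = true → wa e ≠ 0) → Attached A x g → (A.card : ℝ) ≤ N / L ^ 2 →
        imbalance f A g = 0 ∨
        (0 ≤ imbalance f A g ∧ (imbalance f A g : ℝ) + c / 4 * N ≤ 4 * (Z false).card) ∨
        (imbalance f A g ≤ 0 ∧ -(imbalance f A g : ℝ) + c / 4 * N ≤ 4 * (Z true).card)) →
      prob w (fun x => ¬ (graph x).IsHamiltonian) ≤ ε := by
    intro wa hwa0 hwaβ hwaf hwad hwap
    have hwa0' : ∀ e, 0 ≤ wa e := fun e => by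
      induction e with
      | h u v => exact hwa0 u v
    refine hmain V f Y w wa wb ((le_max_left _ _).trans ((le_max_left _ _).trans hN)) hf1 ?_ hwa0'
      (fun e => ?_) h1 (fun e => ?_) (fun e => ?_) (fun v => ?_) (fun v => ?_) (fun v hv => ?_)
      (fun v u hu => ((hYmem v u).1 hu).1) fun x A g hs hg hA => ?_
    · rw [Finset.filter_congr fun v _ => hfJ' v, hcardW, ← hNdef]
      linarith
    · simp only [hwb]; split_ifs <;> simp [hCN]
    · induction e with
      | h u v =>
        have e1 := hwaβ u v
        rw [hwb']
        by_cases hβ : β u = β v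
        · have e2 : hostWeight f (C / N) s(u, v) = 0 := by
            rw [hostWeight, if_neg]
            rintro ⟨-, h⟩
            exact hcross u v h hβ
          rw [if_pos hβ] at e1 ⊢
          rw [← hNdef, e2]; linarith [h0 s(u, v)]
        · rw [if_neg hβ] at e1 ⊢
          have e2 := hostWeight_le (f := f) hCN s(u, v)
          have e3 := hq u v hβ
          rw [← hNdef]; linarith
    · induction e with
      | h u v =>
        have e1 := hwaβ u v
        have e2 : (if β u = β v then 0 else a) ≤ a := by split_ifs <;> simp [ha0]
        linarith
    · obtain ⟨T, hvT, hT, hTq⟩ := hwad v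
      have e1 : ∑ u ∈ T, wa s(v, u) ≤ ∑ u ∈ Finset.univ.erase v, wa s(v, u) :=
        Finset.sum_le_sum_of_subset_of_nonneg
          (fun u hu => Finset.mem_erase.2 ⟨fun h => hvT (h ▸ hu), Finset.mem_univ _⟩)
          fun u _ _ => hwa0 v u
      rw [Finset.sum_congr rfl hT, Finset.sum_const, nsmul_eq_mul] at e1
      have e2 : (T.card : ℝ) * (C / N) ≤ C := by
        have : (T.card : ℝ) ≤ N := by rw [hNdef]; exact_mod_cast Finset.card_le_univ T
        calc (T.card : ℝ) * (C / N) ≤ N * (C / N) := mul_le_mul_of_nonneg_right this hCN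
          _ = C := by field_simp
      have e3 : (T.card : ℝ) * a = q * T.card - 2 * (T.card * (C / N)) := by rw [ha]; ring
      linarith [le_max_left W₁ 0]
    · rw [Finset.sum_congr rfl fun u hu => hwaf v u ((hYmem v u).1 hu).1, Finset.sum_const,
        nsmul_eq_mul]
      calc min 1 (c / 8) * L ≤ c / 8 * L := by gcongr; exact min_le_right _ _
        _ = c / 4 * (L / 2) := by ring
        _ ≤ c / 4 * (a * N) := by gcongr
        _ = c * N / 4 * a := by ring
        _ ≤ (Y v).card * a := mul_le_mul_of_nonneg_right (hYcard v) ha0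
    · have := ((hYmem v v).1 hv).1
      have := hf1 v
      omega
    · have hdisj : ∀ b v, Disjoint (Y v) (Z b ∪ Z' b) := fun b v =>
        Finset.disjoint_left.2 fun u hu => ((hYmem v u).1 hu).2 b
      have hZb : ∀ b, ∀ u ∈ Z b, ∀ v ∈ Z' b, C / N ≤ wb s(u, v) := fun b u hu v hv => by
        rw [hwb', if_neg (hZβ b u hu v hv)]
      have hdis : ∀ b, Disjoint (Z b) (Z' b) := fun b =>
        Finset.disjoint_left.2 fun u hu hu' => hZβ b u hu u hu' rfl
      rcases hwap x A g hs hg hA with h | ⟨h, h'⟩ | ⟨h, h'⟩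
      · exact Or.inl h
      · refine Or.inr ⟨-1, Z false, Z' false, Or.inr rfl, hdis _, hZcard _, fun v hv => ?_,
          hdisj _, hZb _, by linarith, ?_⟩
        · rw [hfJ', hZJ false v hv]; simp
        · rw [← hNdef]; push_cast; linarith
      · refine Or.inr ⟨1, Z true, Z' true, Or.inl rfl, hdis _, hZcard _, fun v hv => ?_,
          hdisj _, hZb _, by linarith, ?_⟩
        · rw [hfJ, hZJ true v hv]
        · rw [← hNdef]; push_cast; linarith
  have himb : ∀ A g, (imbalance f A g : ℝ) =
      ((∑ s ∈ A, (2 * f s + f (g s false) + f (g s true)) : ℤ) : ℝ) + 2 * (N - 2 * U) := by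
    intro A g
    rw [imbalance, Int.cast_sub, Int.cast_mul, hfsum]; push_cast; ring
  have hnot : ∀ i, ((Finset.univ.filter fun v => β v ≠ i).card : ℝ) =
      N - (Finset.univ.filter fun v => β v = i).card := by
    intro i
    have := Finset.card_filter_add_card_filter_not (s := (Finset.univ : Finset V))
      (fun v => β v = i)
    rw [Finset.card_univ] at this
    rw [hNdef, ← this]; push_cast; ring
  rcases hmode with ⟨i, hi, hΔ, hmode⟩ | ⟨hZΔ, hmode⟩
  · -- only pairs between the two sides
    have hUi : (U : ℝ) = (Finset.univ.filter fun v => β v = i).card := by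
      rw [hU, hi]; simp
    have hwaf : ∀ u v, f u + f v = 0 → hostWeight f a s(u, v) = a := fun u v huv =>
      hostWeight_of ⟨by rw [Sym2.mk_isDiag_iff]; rintro rfl; have := hf1 u; omega, huv⟩
    refine key (hostWeight f a) (fun u v => hostWeight_nonneg ha0 _) (fun u v => ?_) hwaf
      (fun v => ?_) (fun x A g hs hg hA => ?_)
    · by_cases hβ : β u = β v
      · rw [if_pos hβ, hostWeight, if_neg]
        rintro ⟨-, h⟩
        exact hcross u v h hβ
      · rw [if_neg hβ]; exact hostWeight_le ha0 _
    · rcases hf1 v with hv | hv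
      · refine ⟨Finset.univ.filter fun u => β u ∉ J, by simpa using (hfJ v).1 hv, fun u hu => ?_, ?_⟩
        · refine hwaf v u ?_
          rw [hv, (hfJ' u).2 (by simpa using hu)]; norm_num
        · rw [hcardW, hUi]
          linarith [hdeg i]
      · refine ⟨Finset.univ.filter fun u => β u ∈ J, by simpa using (hfJ' v).1 hv, fun u hu => ?_, ?_⟩
        · refine hwaf v u ?_
          rw [hv, (hfJ u).2 (by simpa using hu)]; norm_num
        · rw [← hU]
          have e1 := hdeg i
          rw [← hUi] at e1
          -- A vertex of the larger side sees only the single block `i`. Compared with the bound for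
          -- block `i` it loses `q * (N - 2 * U)`, which is small because the sides are almost
          -- equal.
          have e2 : q * (N - 2 * U) ≤ 1 := by
            calc q * (N - 2 * U) ≤ (K * L / N) * η :=
                  mul_le_mul hκ hΔ (by linarith) (by positivity)
              _ = 2 * K / L := by rw [hη]; field_simp
              _ ≤ 1 := by rw [div_le_one (by linarith)]; exact hLK
          linarith
    -- Forced pairs join the two sides here, so the forced paths contribute nothing. The imbalance
    -- is twice the difference of the sides and has a known sign.
    · have hzero : ∑ s ∈ A, (2 * f s + f (g s false) + f (g s true)) = 0 := by
        refine Finset.sum_eq_zero fun s hsA => ?_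
        have hb : ∀ b, f s + f (g s b) = 0 := fun b => by
          have := hs _ (hg.adj s hsA b)
          rw [hostWeight, pairSum_mk] at this
          by_contra h
          exact this (if_neg fun h' => h h'.2)
        have := hb false; have := hb true
        omega
      have h2 := himb A g
      rw [hzero, Int.cast_zero, zero_add] at h2
      rcases hmode with h | h
      · left
        have h3 : (imbalance f A g : ℝ) = 0 := by
          have : 2 * (U : ℝ) = N := by rw [hNdef]; exact_mod_cast h
          rw [h2, ← this]; ring
        exact_mod_cast h3
      · refine Or.inr (Or.inl ⟨?_, by linarith⟩)
        have : (0 : ℝ) ≤ imbalance f A g := by rw [h2]; linarith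
        exact_mod_cast this
  · -- all pairs between different blocks
    set wa : Sym2 V → ℝ := fun e => if pairSum (classIndicator β) e = 0 then 0 else a with hwa
    have hwa' : ∀ u v, wa s(u, v) = if β u = β v then 0 else a := fun u v => by
      simp only [hwa, pairSum_mk, classIndicator_add_eq_zero]
    refine key wa (fun u v => ?_) (fun u v => (hwa' u v).le) (fun u v huv => ?_) (fun v => ?_)
      (fun x A g hs hg hA => ?_)
    · rw [hwa']; split_ifs <;> simp [ha0]
    · rw [hwa', if_neg (hcross u v huv)]
    · refine ⟨Finset.univ.filter fun u => β u ≠ β v, by simp, fun u hu => ?_, ?_⟩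
      · rw [hwa', if_neg]
        exact fun h => (by simpa using hu : β u ≠ β v) h.symm
      · rw [hnot]; linarith [hdeg (β v)]
    -- Forced paths may now use pairs inside a side, and each contributes at most 4 in absolute
    -- value.
    · have habs : |((∑ s ∈ A, (2 * f s + f (g s false) + f (g s true)) : ℤ) : ℝ)| ≤ 4 * A.card := by
        have : |∑ s ∈ A, (2 * f s + f (g s false) + f (g s true))| ≤ ∑ _s ∈ A, (4 : ℤ) := by
          refine (Finset.abs_sum_le_sum_abs _ _).trans (Finset.sum_le_sum fun s _ => ?_)
          have := hf1 s; have := hf1 (g s false); have := hf1 (g s true)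
          rw [abs_le]; omega
        rw [Finset.sum_const, nsmul_eq_mul] at this
        have h2 : ((|∑ s ∈ A, (2 * f s + f (g s false) + f (g s true))| : ℤ) : ℝ) ≤
            ((A.card * 4 : ℤ) : ℝ) := by exact_mod_cast this
        rw [Int.cast_abs] at h2
        push_cast at h2 ⊢
        linarith
      have hA4 : 4 * (A.card : ℝ) ≤ 2 * η := by rw [hη]; linarith
      obtain ⟨h2, h3⟩ := abs_le.1 habs
      have h4 := himb A g
      rcases le_total 0 (imbalance f A g) with h5 | h5
      · exact Or.inr (Or.inl ⟨h5, by linarith⟩)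
      · have h6 : (imbalance f A g : ℝ) ≤ 0 := by exact_mod_cast h5
        rcases hmode with h | h
        · linarith
        · exact Or.inr (Or.inr ⟨h5, by linarith⟩)

end RandomSubset

/-! ### From the product measure to finite sums -/

namespace RandomSubset

lemma weight_piEquivPiSubtypeProd_symm {E : Type*} [Fintype E] (s : E → Prop) [DecidablePred s]
    (w : E → ℝ) (x : {e // s e} → Bool) (y : {e // ¬ s e} → Bool) :
    weight w ((Equiv.piEquivPiSubtypeProd s fun _ => Bool).symm (x, y)) =
      weight (fun e : {e // s e} => w e) x * weight (fun e : {e // ¬ s e} => w e) y := by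
  rw [weight, ← Fintype.prod_subtype_mul_prod_subtype s, weight, weight]
  congr 1 <;> refine Finset.prod_congr rfl fun e _ => ?_ <;>
    simp [Equiv.piEquivPiSubtypeProd, e.2]

/-- Coordinates that do not influence an event may be dropped. -/
lemma prob_comp_restrict {E : Type*} [Fintype E] [DecidableEq E] (s : E → Prop) [DecidablePred s]
    (w : E → ℝ) (P : ({e // s e} → Bool) → Prop) :
    prob w (fun x => P fun e => x e) = prob (fun e : {e // s e} => w e) P := by
  classical
  rw [prob_eq, prob_eq, expect, expect,
    ← (Equiv.piEquivPiSubtypeProd s fun _ => Bool).symm.sum_comp, Fintype.sum_prod_type]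
  refine Finset.sum_congr rfl fun x _ => ?_
  have h1 : ∀ y, (fun e : {e // s e} =>
      (Equiv.piEquivPiSubtypeProd s fun _ => Bool).symm (x, y) e) = x := fun y => by
    ext e; simp [Equiv.piEquivPiSubtypeProd, e.2]
  simp only [h1, weight_piEquivPiSubtypeProd_symm]
  rw [← Finset.sum_mul, ← Finset.mul_sum]
  have h2 := expect_one fun e : {e // ¬ s e} => w e
  simp only [expect, mul_one] at h2
  rw [h2, mul_one]

lemma measure_pi_real_eq_prob {E : Type*} [Fintype E] [DecidableEq E] {w : E → ℝ}
    (h0 : ∀ e, 0 ≤ w e) (h1 : ∀ e, w e ≤ 1) (P : (E → Bool) → Prop) :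
    (Measure.pi fun e => ENNReal.ofReal (w e) • Measure.dirac true +
      ENNReal.ofReal (1 - w e) • Measure.dirac false).real {x | P x} = prob w P := by
  classical
  have hfin : ∀ e, IsFiniteMeasure (ENNReal.ofReal (w e) • Measure.dirac true +
      ENNReal.ofReal (1 - w e) • Measure.dirac false) := fun e =>
    ⟨by simp [ENNReal.ofReal_lt_top, ENNReal.add_lt_top]⟩
  have hset : {x : E → Bool | P x} = ((Finset.univ.filter P : Finset (E → Bool)) : Set _) := by
    ext; simp
  rw [prob_eq, expect, hset, ← sum_measureReal_singleton, Finset.sum_filter]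
  refine Finset.sum_congr rfl fun x _ => ?_
  rw [mul_ite, mul_one, mul_zero]
  refine if_congr Iff.rfl ?_ rfl
  rw [measureReal_def, Measure.pi_singleton, ENNReal.toReal_prod, weight]
  refine Finset.prod_congr rfl fun e _ => ?_
  cases x e
  · simp [h1 e]
  · simp [h0 e]

end RandomSubset

namespace BlockModel

open RandomSubset

/-- The measurable structure is pulled back along adjacency, which is injective, and there are
finitely many relations. -/
lemma measurableSet_simpleGraph {V : Type*} [Finite V] (S : Set (SimpleGraph V)) :
    MeasurableSet S :=
  ⟨SimpleGraph.Adj '' S, (Set.toFinite _).measurableSet,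
    Set.preimage_image_eq _ fun _ _ h => SimpleGraph.ext h⟩

variable {k : ℕ}

lemma edgeProb_mk (n : Fin k → ℕ) (p q : I) (u v : Vertex n) :
    edgeProb n p q s(u, v) = if u.1 = v.1 then p else q := rfl

lemma graphOf_restrict (n : Fin k → ℕ) (x : Sym2 (Vertex n) → Bool) :
    graphOf n (fun e => x e) = graph x := by
  ext u v
  simp only [graphOf, graph_adj, SimpleGraph.fromEdgeSet_adj, Set.mem_ofPred_eq,
    Sym2.mk_isDiag_iff]
  constructor
  · rintro ⟨⟨-, h⟩, hne⟩; exact ⟨h, hne⟩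
  · rintro ⟨h, hne⟩; exact ⟨⟨hne, h⟩, hne⟩

/-- The probability of Hamiltonicity as a finite sum over all configurations of edges. -/
theorem hamProb_eq_prob (n : Fin k → ℕ) (p q : I) :
    hamProb n p q =
      prob (fun e => (edgeProb n p q e : ℝ)) fun x => (graph x).IsHamiltonian := by
  have hmeas : Measurable (graphOf n) := measurable_of_finite _
  rw [hamProb, stochasticBlockModel, map_measureReal_apply hmeas (measurableSet_simpleGraph _),
    edgeLaw, Set.preimage_ofPred_eq,
    measure_pi_real_eq_prob (w := fun e : Pair n => (edgeProb n p q e : ℝ))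
      (fun e => (edgeProb n p q e).2.1) (fun e => (edgeProb n p q e).2.2),
    ← prob_comp_restrict (fun e : Sym2 (Vertex n) => ¬ e.IsDiag)
      (fun e => (edgeProb n p q e : ℝ)) fun x => (graphOf n x).IsHamiltonian]
  simp only [graphOf_restrict]

end BlockModel

/-! ### The regimes of the block model above the threshold -/

namespace BlockModel

open RandomSubset

variable {k : ℕ}

lemma card_vertex (n : Fin k → ℕ) : Fintype.card (Vertex n) = order n := by
  simp [order]

lemma card_block (n : Fin k → ℕ) (i : Fin k) :
    (Finset.univ.filter fun v : Vertex n => v.1 = i).card = n i := by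
  have : (Finset.univ.filter fun v : Vertex n => v.1 = i) =
      Finset.univ.map (Function.Embedding.sigmaMk i) := by
    ext ⟨j, v⟩
    simp only [Finset.mem_filter, Finset.mem_univ, true_and, Finset.mem_map,
      Function.Embedding.sigmaMk_apply]
    constructor
    · rintro rfl; exact ⟨v, rfl⟩
    · rintro ⟨u, hu⟩; exact (congrArg Sigma.fst hu).symm
  rw [this, Finset.card_map, Finset.card_univ, Fintype.card_fin]

lemma sum_block (n : Fin k → ℕ) (v : Vertex n) (a b : ℝ) :
    ∑ u : Vertex n, (if v.1 = u.1 then a else b) = a * n v.1 + b * (order n - n v.1) := by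
  have h1 : (Finset.univ.filter fun u : Vertex n => v.1 = u.1).card = n v.1 := by
    rw [← card_block n v.1]; congr 1; ext u; simp [eq_comm]
  have h2 := Finset.card_filter_add_card_filter_not (s := (Finset.univ : Finset (Vertex n)))
    (fun u => v.1 = u.1)
  rw [h1, Finset.card_univ, card_vertex] at h2
  rw [Finset.sum_ite, Finset.sum_const, Finset.sum_const, h1, nsmul_eq_mul, nsmul_eq_mul, ← h2]
  push_cast; ring

lemma le_order (n : Fin k → ℕ) (i : Fin k) : n i ≤ order n :=
  Finset.single_le_sum (f := n) (fun _ _ => Nat.zero_le _) (Finset.mem_univ i)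

lemma minExcess_le (n : Fin k → ℕ) (p q : I) (i : Fin k) :
    minExcess n p q ≤ (p : ℝ) * n i + ((order n : ℝ) - n i) * q - Real.log (n i) :=
  ciInf_le (Set.finite_range _).bddBelow i

/-- Truncation of the edge probabilities does not spoil large expected degrees. -/
lemma le_truncated {p q κ L X c K n N : ℝ} (hκ : κ = K * L / N) (hK : K * c = 3) (hN : 0 < N)
    (hc : 0 < c) (hL : 0 ≤ L) (hp : 0 ≤ p) (hq : 0 ≤ q) (hn : c * N ≤ n) (hnN : n ≤ N)
    (hN' : N - n = 0 ∨ c * N ≤ N - n) (hX : X ≤ 3 * L) (h : X ≤ p * n + (N - n) * q) :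
    X ≤ min p κ * n + min q κ * (N - n) := by
  have hK0 : 0 < K := by
    by_contra! hK'
    have := mul_nonpos_of_nonpos_of_nonneg hK' hc.le
    linarith
  have hκ0 : 0 ≤ κ := by rw [hκ]; positivity
  have hκN : κ * (c * N) = 3 * L := by
    rw [hκ, ← hK]; field_simp
  have hn0 : 0 ≤ n := le_trans (by positivity) hn
  have h1 : 0 ≤ min p κ * n := mul_nonneg (le_min hp hκ0) hn0
  have h2 : 0 ≤ min q κ * (N - n) := mul_nonneg (le_min hq hκ0) (by linarith)
  rcases le_total p κ with hpκ | hpκ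
  · rcases hN' with h0 | h0
    · rw [h0] at h ⊢
      rw [min_eq_left hpκ]; linarith
    · rcases le_total q κ with hqκ | hqκ
      · rw [min_eq_left hpκ, min_eq_left hqκ]; linarith
      · rw [min_eq_right hqκ] at h2 ⊢
        have := mul_le_mul_of_nonneg_left h0 hκ0
        linarith
  · rw [min_eq_right hpκ] at h1 ⊢
    have := mul_le_mul_of_nonneg_left hn hκ0
    linarith

/-- The quantitative form of the statement that the model is Hamiltonian with high
probability. -/
theorem exists_le_hamProb {c : ℝ} (hc : 0 < c) (hc1 : c ≤ 1) : ∃ C₀ : ℝ, ∀ ε : ℝ, 0 < ε →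
    ∃ (N₀ : ℕ) (W Q₀ : ℝ), ∀ (n : Fin (k + 1) → ℕ) (p q : I), N₀ ≤ order n →
      (∀ i, c * order n ≤ n i) →
      ((p : ℝ) ≤ C₀ / order n → ∀ i, (n i : ℝ) ≤ (order n : ℝ) / 2) →
      Q₀ ≤ (q : ℝ) * (order n : ℝ) ^ 2 →
      Real.log (Real.log (order n)) + W ≤ minExcess n p q → 1 - ε ≤ hamProb n p q := by
  -- A probability truncated at `K * L / N` already contributes `3 * L` to a degree through `c * N`
  -- vertices, so truncation does no harm to expected degrees.
  set K : ℝ := 3 / c with hKdef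
  have hKc : K * c = 3 := by rw [hKdef]; field_simp
  have hK : 1 ≤ K := by rw [hKdef, le_div_iff₀ hc]; linarith
  have hK0 : 0 < K := by linarith
  obtain ⟨C₁, hC₁, h₁⟩ := exists_prob_not_isHamiltonian_le_of_complete hK
  have hlinks : ∃ C : ℝ, 1 ≤ C ∧ ∀ ε : ℝ, 0 < ε → ∃ (N₀ : ℕ) (W₀ Q₀ : ℝ), 1 ≤ k →
      ∀ (V : Type) [Fintype V] [DecidableEq V] (w : Sym2 V → ℝ) (β : V → Fin (k + 1)) (p q : ℝ),
        N₀ ≤ Fintype.card V → (∀ e, 0 ≤ w e) → (∀ e, w e ≤ 1) → 0 ≤ q →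
        (∀ u v, u ≠ v → β u = β v → p ≤ w s(u, v)) → (∀ u v, β u ≠ β v → q ≤ w s(u, v)) →
        C / Fintype.card V ≤ p → p ≤ K * Real.log (Fintype.card V) / Fintype.card V → p ≤ 1 →
        (∀ i, c * Fintype.card V ≤ (Finset.univ.filter fun v => β v = i).card) →
        (∀ i, Real.log (Fintype.card V) + Real.log (Real.log (Fintype.card V)) + W₀ ≤
          p * (Finset.univ.filter fun v => β v = i).card) →
        Q₀ ≤ q * (Fintype.card V) ^ 2 →
        prob w (fun x => ¬ (graph x).IsHamiltonian) ≤ ε := by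
    by_cases hk : 1 ≤ k
    · obtain ⟨C, hC, h⟩ := exists_prob_not_isHamiltonian_le_of_links hK hc hk
      refine ⟨C, hC, fun ε hε => ?_⟩
      obtain ⟨N₀, W₀, Q₀, h⟩ := h ε hε
      exact ⟨N₀, W₀, Q₀, fun _ => h⟩
    · exact ⟨1, le_rfl, fun ε _ => ⟨0, 0, 0, fun h => absurd h hk⟩⟩
  obtain ⟨C₂, hC₂, h₂⟩ := hlinks
  set C₀ := max C₁ C₂ with hC₀
  have hC₀1 : 1 ≤ C₀ := hC₁.trans (le_max_left _ _)
  refine ⟨C₀, fun ε hε => ?_⟩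
  obtain ⟨N₁, W₁, h₁⟩ := h₁ ε hε
  obtain ⟨N₂, W₂, Q₂, h₂⟩ := h₂ ε hε
  obtain ⟨N₃, W₃, h₃⟩ := exists_prob_not_isHamiltonian_le_of_multipartite hK hc (k := k + 1) hε
  set W : ℝ := max (max W₁ W₂) (max W₃ 0) + C₀ with hW
  have hWa : W₁ + C₀ ≤ W := by
    have := (le_max_left W₁ W₂).trans (le_max_left _ (max W₃ 0)); linarith
  have hWb : W₂ + C₀ ≤ W := by
    have := (le_max_right W₁ W₂).trans (le_max_left _ (max W₃ 0)); linarith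
  have hWc : W₃ + C₀ ≤ W := by
    have := (le_max_left W₃ 0).trans (le_max_right (max W₁ W₂) _); linarith
  have hW0 : C₀ ≤ W := by
    have := (le_max_right W₃ 0).trans (le_max_right (max W₁ W₂) _); linarith
  obtain ⟨N₄, hN₄⟩ := eventually_exists_card
    (eventually_ge_atTop (max (max 1 W) (max (C₀ / K) Q₂)))
  -- The shift by `log c` replaces `log n_i` by `log N`, as `n_i ≥ c * N`. The summand `C₀` in `W`
  -- allows a probability below `C₀ / N` to be dropped from the degrees.
  refine ⟨max (max N₁ N₂) (max N₃ (max N₄ 1)), W - Real.log c, Q₂, ?_⟩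
  intro n p q hN hcn hA3 hQ hex
  have hN1 : N₁ ≤ order n := (le_max_left _ _).trans ((le_max_left _ _).trans hN)
  have hN2 : N₂ ≤ order n := (le_max_right _ _).trans ((le_max_left _ _).trans hN)
  have hN3 : N₃ ≤ order n := (le_max_left _ _).trans ((le_max_right _ _).trans hN)
  have hN4 : max N₄ 1 ≤ order n := (le_max_right _ _).trans ((le_max_right _ _).trans hN)
  have hL := hN₄ _ ((le_max_left _ _).trans hN4)
  set N : ℝ := ((order n : ℕ) : ℝ) with hNdef
  have hNone : 1 ≤ N := by rw [hNdef]; exact_mod_cast (le_max_right _ _).trans hN4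
  have hN0 : 0 < N := by linarith
  set L := Real.log N with hLdef
  have hL1 : 1 ≤ L := (le_max_left _ _).trans ((le_max_left _ _).trans hL)
  have hLW : W ≤ L := (le_max_right _ _).trans ((le_max_left _ _).trans hL)
  have hLC : C₀ ≤ K * L := by
    have := (div_le_iff₀ hK0).1 ((le_max_left _ _).trans ((le_max_right _ _).trans hL))
    linarith
  have hLQ : Q₂ ≤ L := (le_max_right _ _).trans ((le_max_right _ _).trans hL)
  have hLL : Real.log L ≤ L := (Real.log_le_sub_one_of_pos (by linarith)).trans (by linarith)
  have hLL0 : 0 ≤ Real.log L := Real.log_nonneg hL1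
  set κ : ℝ := K * L / N with hκ
  have hκ0 : 0 ≤ κ := by positivity
  set p' : ℝ := min (p : ℝ) κ with hp'
  set q' : ℝ := min (q : ℝ) κ with hq'
  have hp'0 : 0 ≤ p' := le_min p.2.1 hκ0
  have hq'0 : 0 ≤ q' := le_min q.2.1 hκ0
  have hp'1 : p' ≤ 1 := (min_le_left _ _).trans p.2.2
  have hnN : ∀ i, (n i : ℝ) ≤ N := fun i => by rw [hNdef]; exact_mod_cast le_order n i
  have hdeg : ∀ i, L + Real.log L + W ≤ p' * n i + q' * (N - n i) := by
    intro i
    have h1 := hex.trans (minExcess_le n p q i)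
    rw [← hNdef] at h1
    have hni : Real.log c + L ≤ Real.log (n i) := by
      rw [hLdef, ← Real.log_mul hc.ne' hN0.ne']
      exact Real.log_le_log (by positivity) (hcn i)
    refine le_truncated hκ hKc hN0 hc (by linarith) p.2.1 q.2.1 (hcn i) (hnN i) ?_ (by linarith)
      (by linarith)
    by_cases h : ∃ j, j ≠ i
    · right
      obtain ⟨j, hj⟩ := h
      have h2 : n j + n i ≤ order n := by
        rw [order, ← Finset.sum_pair hj]
        exact Finset.sum_le_sum_of_subset (Finset.subset_univ _)
      have h3 : (n j : ℝ) + n i ≤ N := by rw [hNdef]; exact_mod_cast h2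
      linarith [hcn j]
    · left
      push Not at h
      have h2 : order n = n i := by
        rw [order]
        exact Fintype.sum_eq_single i fun j hj => absurd (h j) hj
      rw [hNdef, h2, sub_self]
  set w : Sym2 (Vertex n) → ℝ := fun e => (edgeProb n p q e : ℝ) with hw
  have hw0 : ∀ e, 0 ≤ w e := fun e => (edgeProb n p q e).2.1
  have hw1 : ∀ e, w e ≤ 1 := fun e => (edgeProb n p q e).2.2
  have hwuv : ∀ u v, w s(u, v) = if u.1 = v.1 then (p : ℝ) else q := fun u v => by
    simp only [hw, edgeProb_mk]; split_ifs <;> rfl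
  have hsame : ∀ u v : Vertex n, u ≠ v → u.1 = v.1 → p' ≤ w s(u, v) := fun u v _ h => by
    rw [hwuv, if_pos h]; exact min_le_left _ _
  have hdiff : ∀ u v : Vertex n, u.1 ≠ v.1 → q' ≤ w s(u, v) := fun u v h => by
    rw [hwuv, if_neg h]; exact min_le_left _ _
  suffices h : prob w (fun x => ¬ (graph x).IsHamiltonian) ≤ ε by
    rw [prob_not] at h
    rw [hamProb_eq_prob]
    linarith
  have hsmall : ∀ x y : ℝ, 0 ≤ y → y ≤ N → x < C₀ / N → x * y ≤ C₀ := by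
    intro x y hy0 hy hx
    calc x * y ≤ C₀ / N * y := mul_le_mul_of_nonneg_right hx.le hy0
      _ ≤ C₀ / N * N := by gcongr
      _ = C₀ := by field_simp
  -- If the pairs inside blocks are this rare they are given up, and (A3) provides blocks of at most
  -- half the order.
  by_cases hpC : p' < C₀ / N
  · have hpp : p' = p := by
      rw [hp', min_eq_left]
      by_contra! h
      rw [hp', min_eq_right h.le, hκ] at hpC
      have := (div_lt_div_iff_of_pos_right hN0).1 hpC
      linarith
    have hhalf := hA3 (by rw [← hpp]; exact hpC.le)
    refine h₃ (Vertex n) w (fun v => v.1) q' (by rw [card_vertex]; exact hN3) hw0 hw1 hdiff hq'0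
      (by rw [card_vertex]; exact min_le_right _ _) (fun i => ?_) (fun i => ?_) (fun i => ?_)
    · rw [card_vertex, card_block]; exact hcn i
    · rw [card_vertex, card_block]
      have := hhalf i
      have : 2 * (n i : ℝ) ≤ (order n : ℕ) := by linarith
      exact_mod_cast this
    · rw [card_vertex, card_block]
      have h4 := hsmall p' (n i) (by positivity) (hnN i) hpC
      rw [← hNdef]
      linarith [hdeg i]
  · push Not at hpC
    -- With a single block there are no pairs of probability `q`, so the complete host applies
    -- whatever `q` is.
    by_cases hqC : (∃ i j : Fin (k + 1), i ≠ j) → C₀ / N ≤ q'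
    · set w' : Sym2 (Vertex n) → ℝ := fun e => min (w e) κ with hw'
      have hw'uv : ∀ u v, w' s(u, v) = if u.1 = v.1 then p' else q' := fun u v => by
        simp only [hw', hwuv]; split_ifs <;> rfl
      have hw'0 : ∀ e, 0 ≤ w' e := fun e => le_min (hw0 e) hκ0
      have hmono := prob_mono_weight (w₁ := w') (w₂ := w) hw'0 (fun e => min_le_left _ _) hw1
        (monotone_isHamiltonian (V := Vertex n))
      have h := h₁ (Vertex n) w' (by rw [card_vertex]; exact hN1) hw'0
        (fun e => (min_le_left _ _).trans (hw1 e)) (fun e _ => ?_)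
        (fun e => by rw [card_vertex]; exact min_le_right _ _) (fun v => ?_)
      · rw [prob_not] at h ⊢
        linarith
      · induction e with
        | h u v =>
          have hCC : C₁ / N ≤ C₀ / N := by gcongr; exact le_max_left _ _
          rw [hw'uv, card_vertex]
          split_ifs with h
          · exact hCC.trans hpC
          · exact hCC.trans (hqC ⟨_, _, h⟩)
      · rw [Finset.sum_erase_eq_sub (Finset.mem_univ v)]
        simp only [hw'uv]
        rw [sum_block, if_pos trivial, card_vertex, ← hNdef]
        linarith [hdeg v.1]
    · push Not at hqC
      obtain ⟨⟨i, j, hij⟩, hqC⟩ := hqC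
      have hk : 1 ≤ k := by
        by_contra! h
        obtain rfl : k = 0 := by omega
        exact hij (Fin.ext (by omega))
      refine h₂ hk (Vertex n) w (fun v => v.1) p' q' (by rw [card_vertex]; exact hN2) hw0 hw1 hq'0
        hsame hdiff ?_ (by rw [card_vertex]; exact min_le_right _ _) hp'1 (fun i => ?_) (fun i => ?_)
        ?_
      · rw [card_vertex, ← hNdef]
        have hCC : C₂ / N ≤ C₀ / N := by gcongr; exact le_max_right _ _
        exact hCC.trans hpC
      · rw [card_vertex, card_block]; exact hcn i
      · rw [card_vertex, card_block, ← hNdef]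
        have h4 := hsmall q' (N - n i) (by linarith [hnN i])
          (by linarith [(Nat.cast_nonneg (n i) : (0 : ℝ) ≤ n i)]) hqC
        linarith [hdeg i]
      · rw [card_vertex, ← hNdef, hq']
        rcases le_total (q : ℝ) κ with h | h
        · rw [min_eq_left h]; exact hQ
        · rw [min_eq_right h, hκ]
          have e1 : K * L / N * N ^ 2 = K * (L * N) := by field_simp
          rw [e1]
          have e2 : L ≤ L * N := by nlinarith
          nlinarith

end BlockModel

/-! ### Second moment method for vertices of degree at most one -/

namespace RandomSubset

section independence

variable {E : Type*} [Fintype E] [DecidableEq E]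

omit [Fintype E] in
lemma indicator_filter_eq_sum (s : Finset E) (P : Finset E → Prop) [DecidablePred P]
    (x : E → Bool) :
    (if P (s.filter fun e => x e = true) then (1 : ℝ) else 0) =
      ∑ A ∈ s.powerset, (if P A then (1 : ℝ) else 0) *
        ∏ e ∈ s, if (e ∈ A ↔ x e = true) then (1 : ℝ) else 0 := by
  have hprod : ∀ A ∈ s.powerset, (∏ e ∈ s, if (e ∈ A ↔ x e = true) then (1 : ℝ) else 0) =
      if A = s.filter (fun e => x e = true) then 1 else 0 := by
    intro A hA
    rw [Finset.mem_powerset] at hA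
    split_ifs with h
    · refine Finset.prod_eq_one fun e he => if_pos ?_
      rw [h, Finset.mem_filter]
      exact ⟨fun h => h.2, fun h => ⟨he, h⟩⟩
    · rw [Finset.prod_eq_zero_iff]
      by_contra! h'
      refine h (Finset.ext fun e => ?_)
      rw [Finset.mem_filter]
      have h2 : ∀ e ∈ s, (e ∈ A ↔ x e = true) := fun e he => by
        by_contra h3; exact h' e he (if_neg h3)
      exact ⟨fun he => ⟨hA he, (h2 e (hA he)).1 he⟩, fun he => (h2 e he.1).2 he.2⟩
  rw [Finset.sum_congr rfl fun A hA => by rw [hprod A hA]]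
  simp only [mul_ite, mul_one, mul_zero]
  rw [Finset.sum_ite_eq', if_pos (Finset.mem_powerset.2 (Finset.filter_subset _ _))]

open Classical in
lemma prob_filter (w : E → ℝ) (s : Finset E) (P : Finset E → Prop) :
    prob w (fun x => P (s.filter fun e => x e = true)) =
      ∑ A ∈ s.powerset, (if P A then (1 : ℝ) else 0) *
        ∏ e ∈ s, if e ∈ A then w e else 1 - w e := by
  rw [prob_eq]
  simp only [indicator_filter_eq_sum s P]
  rw [expect_sum]
  refine Finset.sum_congr rfl fun A _ => ?_
  rw [expect_const_mul,
    expect_prod_finset w s fun e b => if (e ∈ A ↔ b = true) then (1 : ℝ) else 0]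
  congr 1
  refine Finset.prod_congr rfl fun e _ => ?_
  by_cases h : e ∈ A <;> simp [h]

/-- Events that depend on disjoint sets of coordinates are independent. -/
lemma prob_filter_and_filter (w : E → ℝ) {s t : Finset E} (hst : Disjoint s t)
    (P Q : Finset E → Prop) :
    prob w (fun x => P (s.filter fun e => x e = true) ∧ Q (t.filter fun e => x e = true)) =
      prob w (fun x => P (s.filter fun e => x e = true)) *
        prob w (fun x => Q (t.filter fun e => x e = true)) := by
  classical
  rw [prob_filter, prob_filter, Finset.sum_mul_sum, prob_eq]
  have h : ∀ x : E → Bool, (if P (s.filter fun e => x e = true) ∧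
      Q (t.filter fun e => x e = true) then (1 : ℝ) else 0) =
      ∑ A ∈ s.powerset, ∑ B ∈ t.powerset,
        ((if P A then (1 : ℝ) else 0) * (if Q B then (1 : ℝ) else 0)) *
          ((∏ e ∈ s, if (e ∈ A ↔ x e = true) then (1 : ℝ) else 0) *
            ∏ e ∈ t, if (e ∈ B ↔ x e = true) then (1 : ℝ) else 0) := by
    intro x
    rw [ite_and, ← mul_boole, indicator_filter_eq_sum s P, indicator_filter_eq_sum t Q, mul_comm,
      Finset.sum_mul_sum]
    refine Finset.sum_congr rfl fun A _ => Finset.sum_congr rfl fun B _ => by ring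
  simp only [h]
  rw [expect_sum]
  refine Finset.sum_congr rfl fun A _ => ?_
  rw [expect_sum]
  refine Finset.sum_congr rfl fun B _ => ?_
  rw [expect_const_mul, expect_prod_mul_prod w hst
    (fun e b => if (e ∈ A ↔ b = true) then (1 : ℝ) else 0)
    fun e b => if (e ∈ B ↔ b = true) then (1 : ℝ) else 0]
  have h1 : ∀ (s A : Finset E), (∏ e ∈ s, (w e * (if (e ∈ A ↔ true = true) then (1 : ℝ) else 0) +
      (1 - w e) * if (e ∈ A ↔ false = true) then (1 : ℝ) else 0)) =
      ∏ e ∈ s, if e ∈ A then w e else 1 - w e := fun s A =>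
    Finset.prod_congr rfl fun e _ => by by_cases h : e ∈ A <;> simp [h]
  rw [h1, h1]
  ring

/-- Only the outcomes with no element and with exactly one element count. In the latter the missing
factor `1 - w e` is at most one and may be inserted. -/
lemma le_prob_card_le_one {w : E → ℝ} (s : Finset E) (h0 : ∀ e ∈ s, 0 ≤ w e)
    (h1 : ∀ e ∈ s, w e ≤ 1) :
    (1 + ∑ e ∈ s, w e) * ∏ e ∈ s, (1 - w e) ≤
      prob w (fun x => (s.filter fun e => x e = true).card ≤ 1) := by
  classical
  rw [prob_filter w s fun A => A.card ≤ 1]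
  have hnn : ∀ A : Finset E, 0 ≤ ∏ e ∈ s, if e ∈ A then w e else 1 - w e := fun A =>
    Finset.prod_nonneg fun e he => by
      split_ifs
      · exact h0 e he
      · linarith [h1 e he]
  have hsub : insert ∅ (s.image fun e => ({e} : Finset E)) ⊆ s.powerset := by
    intro A hA
    rcases Finset.mem_insert.1 hA with rfl | hA
    · simp
    · obtain ⟨e, he, rfl⟩ := Finset.mem_image.1 hA
      simpa using he
  refine le_trans ?_ (Finset.sum_le_sum_of_subset_of_nonneg hsub fun A _ _ =>
    mul_nonneg (by split_ifs <;> norm_num) (hnn A))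
  rw [Finset.sum_insert (by simp), Finset.sum_image fun a _ b _ h => Finset.singleton_injective h]
  simp only [Finset.card_empty, Finset.card_singleton, zero_le, le_refl, if_true, one_mul,
    Finset.notMem_empty, if_false, Finset.mem_singleton]
  rw [add_mul, one_mul, Finset.sum_mul]
  refine add_le_add le_rfl (Finset.sum_le_sum fun e he => ?_)
  rw [← Finset.mul_prod_erase s _ he, ← Finset.mul_prod_erase s (fun a => if a = e then _ else _) he,
    if_pos rfl]
  refine mul_le_mul_of_nonneg_left ?_ (h0 e he)
  have h2 : ∏ a ∈ s.erase e, (if a = e then w a else 1 - w a) = ∏ a ∈ s.erase e, (1 - w a) :=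
    Finset.prod_congr rfl fun a ha => if_neg (Finset.ne_of_mem_erase ha)
  rw [h2]
  refine mul_le_of_le_one_left (Finset.prod_nonneg fun a ha => ?_) (by linarith [h0 e he])
  linarith [h1 a (Finset.mem_of_mem_erase ha)]

lemma exp_neg_sub_sq_le {y : ℝ} (h0 : 0 ≤ y) (h1 : y ≤ 1 / 2) :
    Real.exp (-(y + y ^ 2)) ≤ 1 - y := by
  have h2 := Real.quadratic_le_exp_of_nonneg (by positivity : 0 ≤ y + y ^ 2)
  rw [Real.exp_neg, inv_le_comm₀ (Real.exp_pos _) (by linarith)]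
  refine le_trans ?_ h2
  rw [inv_le_iff_one_le_mul₀ (by linarith)]
  have h3 : y ^ 2 ≤ 1 / 4 := by nlinarith
  have h4 : y ^ 3 ≤ 1 / 8 := by nlinarith
  have h5 : 0 ≤ y ^ 2 / 2 * (1 - y - y ^ 2 - y ^ 3) := mul_nonneg (by positivity) (by linarith)
  linear_combination h5

/-- A lower bound for the probability of at most one success, in terms of an upper bound for the
expected number of successes. -/
lemma le_prob_card_le_one_of_sum_le {w : E → ℝ} {s : Finset E} {κ D : ℝ}
    (h0 : ∀ e ∈ s, 0 ≤ w e) (hκ : ∀ e ∈ s, w e ≤ κ) (hκ2 : κ ≤ 1 / 2)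
    (hD : ∑ e ∈ s, w e ≤ D) (hκD : κ * D ≤ 1) (hκ0 : 0 ≤ κ) :
    (1 + D) * Real.exp (-D - 1) ≤
      prob w (fun x => (s.filter fun e => x e = true).card ≤ 1) := by
  refine le_trans ?_ (le_prob_card_le_one s h0 fun e he => by linarith [hκ e he])
  set d := ∑ e ∈ s, w e with hd
  have hd0 : 0 ≤ d := Finset.sum_nonneg h0
  have h1 : Real.exp (-d - 1) ≤ ∏ e ∈ s, (1 - w e) := by
    calc Real.exp (-d - 1) ≤ Real.exp (∑ e ∈ s, -(w e + w e ^ 2)) := by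
          refine Real.exp_le_exp.2 ?_
          rw [Finset.sum_neg_distrib, Finset.sum_add_distrib, ← hd]
          have : ∑ e ∈ s, w e ^ 2 ≤ κ * d := by
            rw [hd, Finset.mul_sum]
            refine Finset.sum_le_sum fun e he => ?_
            rw [sq]
            exact mul_le_mul_of_nonneg_right (hκ e he) (h0 e he)
          have h3 : κ * d ≤ κ * D := mul_le_mul_of_nonneg_left hD hκ0
          linarith
      _ = ∏ e ∈ s, Real.exp (-(w e + w e ^ 2)) := Real.exp_sum _ _
      _ ≤ _ := Finset.prod_le_prod (fun _ _ => (Real.exp_pos _).le) fun e he =>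
          exp_neg_sub_sq_le (h0 e he) ((hκ e he).trans hκ2)
  refine le_trans ?_ (mul_le_mul_of_nonneg_left h1 (by linarith))
  -- The function `(1 + d) * exp (-d)` decreases for `d ≥ 0`, so the true mean may be replaced by
  -- its upper bound `D`.
  have h2 : Real.exp (-d - 1) = Real.exp (D - d) * Real.exp (-D - 1) := by
    rw [← Real.exp_add]; congr 1; ring
  rw [h2, ← mul_assoc]
  refine mul_le_mul_of_nonneg_right ?_ (Real.exp_pos _).le
  have h3 : 1 + (D - d) ≤ Real.exp (D - d) := by linarith [Real.add_one_le_exp (D - d)]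
  refine le_trans ?_ (mul_le_mul_of_nonneg_left h3 (by linarith))
  nlinarith [mul_nonneg hd0 (sub_nonneg.2 hD)]

end independence

section degrees

variable {V : Type*} [Fintype V] [DecidableEq V]

omit [Fintype V] in
lemma degreeTo_eq_card_filter_image (x : Sym2 V → Bool) (Z : Finset V) (v : V) :
    degreeTo x Z v = ((Z.image fun u => s(v, u)).filter fun e => x e = true).card := by
  rw [Finset.filter_image, Finset.card_image_of_injective _ fun a b h => Sym2.congr_right.1 h]
  rfl

variable {w : Sym2 V → ℝ} {κ : ℝ}

/-- The events that two vertices have degree at most one are almost independent. -/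
lemma prob_degree_le_one_and_le (h0 : ∀ e, 0 ≤ w e) (h1 : ∀ e, w e ≤ 1) (hκ2 : κ ≤ 1 / 2)
    {u v : V} (huv : u ≠ v) (hκ : w s(u, v) ≤ κ) :
    prob w (fun x => degreeTo x (Finset.univ.erase u) u ≤ 1 ∧
        degreeTo x (Finset.univ.erase v) v ≤ 1) ≤
      (1 + 6 * κ) * (prob w (fun x => degreeTo x (Finset.univ.erase u) u ≤ 1) *
        prob w (fun x => degreeTo x (Finset.univ.erase v) v ≤ 1)) := by
  set Z : Finset V := (Finset.univ.erase u).erase v with hZ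
  have huZ : u ∉ Z := by simp [hZ]
  have hvZ : v ∉ Z := by simp [hZ]
  have hκ0 : 0 ≤ κ := (h0 _).trans hκ
  have hmono : ∀ x : Sym2 V → Bool, ∀ {Z Z' : Finset V} {v : V}, Z ⊆ Z' →
      degreeTo x Z v ≤ degreeTo x Z' v := fun x _ _ _ h =>
    Finset.card_le_card <| Finset.filter_subset_filter _ h
  -- The only pair relevant to both degrees is `s(u, v)`. Its absence has probability at least `1 -
  -- κ`, and without it the two degrees are independent.
  have hsingle : ∀ a b : V, s(a, b) = s(u, v) → a ∉ Z → insert b Z = Finset.univ.erase a →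
      (1 - κ) * prob w (fun x => degreeTo x Z a ≤ 1) ≤
        prob w (fun x => degreeTo x (Finset.univ.erase a) a ≤ 1) := by
    intro a b hab haZ hins
    have hbZ : b ∉ Z := by
      rcases Sym2.eq_iff.1 hab with ⟨-, rfl⟩ | ⟨-, rfl⟩ <;> assumption
    have hdisj : Disjoint ({s(u, v)} : Finset (Sym2 V)) (Z.image fun y => s(a, y)) := by
      rw [Finset.disjoint_singleton_left, Finset.mem_image]
      rintro ⟨y, hy, h⟩
      rw [← hab, Sym2.congr_right] at h
      exact hbZ (h ▸ hy)
    have h2 := prob_filter_and_filter w hdisj (fun A => A = ∅) fun A => A.card ≤ 1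
    simp only [← degreeTo_eq_card_filter_image] at h2
    have h3 : prob w (fun x => ({s(u, v)} : Finset (Sym2 V)).filter (fun e => x e = true) = ∅) =
        1 - w s(u, v) := by
      rw [prob_filter w {s(u, v)} fun A => A = ∅]
      simp [Finset.sum_ite]
    rw [h3] at h2
    calc _ ≤ (1 - w s(u, v)) * prob w (fun x => degreeTo x Z a ≤ 1) :=
          mul_le_mul_of_nonneg_right (by linarith) (prob_nonneg h0 h1 _)
      _ ≤ _ := by
          rw [← h2]
          refine prob_mono h0 h1 fun x hx => ?_
          obtain ⟨hx1, hx2⟩ := hx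
          have hx3 : ¬ x s(a, b) = true := by
            rw [hab]; intro h
            simp [Finset.filter_singleton, h] at hx1
          rw [← hins, degreeTo, Finset.filter_insert, if_neg hx3]
          exact hx2
  have hu := hsingle u v rfl huZ (Finset.insert_erase (by simp [huv.symm]))
  have hv := hsingle v u Sym2.eq_swap hvZ (by
    rw [hZ, Finset.erase_right_comm]; exact Finset.insert_erase (by simp [huv]))
  have hdisj : Disjoint (Z.image fun y => s(u, y)) (Z.image fun y => s(v, y)) := by
    rw [Finset.disjoint_left]
    simp only [Finset.mem_image]
    rintro e ⟨y, hy, rfl⟩ ⟨z, hz, h⟩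
    rcases Sym2.eq_iff.1 h with ⟨h, -⟩ | ⟨h, -⟩
    · exact huv h.symm
    · exact hvZ (h ▸ hy)
  have hind := prob_filter_and_filter w hdisj (fun A => A.card ≤ 1) fun A => A.card ≤ 1
  simp only [← degreeTo_eq_card_filter_image] at hind
  have hle : prob w (fun x => degreeTo x (Finset.univ.erase u) u ≤ 1 ∧
        degreeTo x (Finset.univ.erase v) v ≤ 1) ≤
      prob w (fun x => degreeTo x Z u ≤ 1) * prob w (fun x => degreeTo x Z v ≤ 1) := by
    rw [← hind]
    refine prob_mono h0 h1 fun x hx =>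
      ⟨(hmono x (Finset.erase_subset _ _)).trans hx.1, (hmono x ?_).trans hx.2⟩
    exact Finset.erase_subset_erase _ (Finset.erase_subset _ _)
  have hnu := prob_nonneg h0 h1 fun x => degreeTo x Z u ≤ 1
  have hnv := prob_nonneg h0 h1 fun x => degreeTo x Z v ≤ 1
  set a := prob w (fun x => degreeTo x Z u ≤ 1)
  set b := prob w (fun x => degreeTo x Z v ≤ 1)
  have hprod := mul_le_mul hu hv (mul_nonneg (by linarith) hnv) (prob_nonneg h0 h1 _)
  refine hle.trans (le_trans ?_ (mul_le_mul_of_nonneg_left hprod (by linarith)))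
  -- The difference of the two sides is `κ * (1 - 2 * κ) * (4 - 3 * κ)`, which is nonnegative for `κ
  -- ≤ 1 / 2`.
  have hκ3 : 1 ≤ (1 + 6 * κ) * (1 - κ) ^ 2 := by
    have : 0 ≤ κ * ((1 - 2 * κ) * (4 - 3 * κ)) :=
      mul_nonneg hκ0 (mul_nonneg (by linarith) (by linarith))
    nlinarith
  calc a * b = 1 * (a * b) := (one_mul _).symm
    _ ≤ (1 + 6 * κ) * (1 - κ) ^ 2 * (a * b) :=
        mul_le_mul_of_nonneg_right hκ3 (mul_nonneg hnu hnv)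
    _ = _ := by ring

/-- If the expected number of vertices of degree at most one is large, then such a vertex
exists with high probability. -/
theorem prob_forall_two_le_degree_le (h0 : ∀ e, 0 ≤ w e) (h1 : ∀ e, w e ≤ 1) (hκ0 : 0 ≤ κ)
    (hκ2 : κ ≤ 1 / 2) (B : Finset V) (hκ : ∀ u ∈ B, ∀ v, u ≠ v → w s(u, v) ≤ κ) {m : ℝ}
    (hm : 0 < m)
    (hB : m ≤ ∑ v ∈ B, prob w (fun x => degreeTo x (Finset.univ.erase v) v ≤ 1)) :
    prob w (fun x => ∀ v, 2 ≤ degreeTo x (Finset.univ.erase v) v) ≤ 1 / m + 6 * κ := by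
  classical
  set d : V → (Sym2 V → Bool) → ℝ := fun v x =>
    if degreeTo x (Finset.univ.erase v) v ≤ 1 then 1 else 0 with hd
  set π : V → ℝ := fun v => prob w (fun x => degreeTo x (Finset.univ.erase v) v ≤ 1) with hπ
  set M : ℝ := ∑ v ∈ B, π v with hM
  have hM0 : 0 < M := hm.trans_le hB
  have hdπ : ∀ v, expect w (d v) = π v := fun v => (prob_eq w _).symm
  have hX : expect w (fun x => ∑ v ∈ B, d v x) = M := by
    rw [expect_sum]; exact Finset.sum_congr rfl fun v _ => hdπ v
  have hX2 : expect w (fun x => (∑ v ∈ B, d v x) ^ 2) ≤ M + (1 + 6 * κ) * M ^ 2 := by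
    simp only [sq, Finset.sum_mul_sum]
    rw [expect_sum]
    have huv : ∀ u ∈ B, ∀ v ∈ B, expect w (fun x => d u x * d v x) ≤
        (if u = v then π u else 0) + (1 + 6 * κ) * (π u * π v) := by
      intro u hu v _
      have hπ0 : ∀ v, 0 ≤ π v := fun v => prob_nonneg h0 h1 _
      have hpos : 0 ≤ (1 + 6 * κ) * (π u * π v) :=
        mul_nonneg (by linarith) (mul_nonneg (hπ0 u) (hπ0 v))
      split_ifs with h
      · subst h
        have : (fun x => d u x * d u x) = d u := by
          ext x; simp only [hd]; split_ifs <;> norm_num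
        rw [this, hdπ]; linarith
      · rw [zero_add]
        refine le_trans (le_of_eq ?_) (prob_degree_le_one_and_le h0 h1 hκ2 h (hκ u hu v h))
        rw [prob_eq]
        congr 1; ext x
        simp only [hd, ite_and, mul_boole]
        split_ifs <;> rfl
    calc ∑ u ∈ B, expect w (fun x => ∑ v ∈ B, d u x * d v x)
        = ∑ u ∈ B, ∑ v ∈ B, expect w (fun x => d u x * d v x) :=
          Finset.sum_congr rfl fun u _ => expect_sum _ _ _
      _ ≤ ∑ u ∈ B, ∑ v ∈ B, ((if u = v then π u else 0) + (1 + 6 * κ) * (π u * π v)) :=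
          Finset.sum_le_sum fun u hu => Finset.sum_le_sum fun v hv => huv u hu v hv
      _ = _ := by
          simp only [Finset.sum_add_distrib, ← Finset.mul_sum, ← Finset.sum_mul]
          rw [← hM]
          congr 1
          exact Finset.sum_congr rfl fun u hu => by rw [Finset.sum_ite_eq, if_pos hu]
  -- Chebyshev's inequality: the square `(X - M) ^ 2 / M ^ 2` equals one if no vertex of `B` has
  -- degree at most one.
  have hcheb : prob w (fun x => ∀ v, 2 ≤ degreeTo x (Finset.univ.erase v) v) ≤
      expect w (fun x => (1 / M ^ 2) * ((∑ v ∈ B, d v x) ^ 2 +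
        ((-2 * M) * (∑ v ∈ B, d v x) + M ^ 2))) := by
    refine prob_le_expect h0 h1 (fun x => mul_nonneg (by positivity) ?_) fun x hx => ?_
    · nlinarith [sq_nonneg (∑ v ∈ B, d v x - M)]
    · have : ∑ v ∈ B, d v x = 0 := Finset.sum_eq_zero fun v _ => by
        simp only [hd]; rw [if_neg]; have := hx v; omega
      rw [this]
      apply le_of_eq; field_simp; ring
  refine hcheb.trans ?_
  rw [expect_const_mul, expect_add, expect_add, expect_const_mul, expect_const, hX]
  calc _ ≤ (1 / M ^ 2) * (M + (1 + 6 * κ) * M ^ 2 + (-2 * M * M + M ^ 2)) := by gcongr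
    _ = 1 / M + 6 * κ := by field_simp; ring
    _ ≤ _ := by gcongr

/-- The successor and the predecessor on the cycle are distinct neighbours. -/
lemma two_le_degreeTo_of_isHamiltonian {x : Sym2 V → Bool}
    (hV : 2 ≤ Fintype.card V) (h : (graph x).IsHamiltonian) (v : V) :
    2 ≤ degreeTo x (Finset.univ.erase v) v := by
  obtain ⟨a, c, hc⟩ := h (by omega)
  have hv := hc.mem_support v
  have hcy := (hc.isCycle.rotate hv)
  have hnil := hcy.not_nil
  have h1 := (c.rotate v hv).adj_snd hnil
  have h2 := (c.rotate v hv).adj_penultimate hnil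
  have hne := hcy.snd_ne_penultimate
  rw [graph_adj] at h1 h2
  rw [degreeTo, ← Finset.card_pair hne]
  refine Finset.card_le_card fun y hy => ?_
  rw [Finset.mem_filter, Finset.mem_erase]
  rcases Finset.mem_insert.1 hy with rfl | hy
  · exact ⟨⟨h1.2.symm, Finset.mem_univ _⟩, h1.1⟩
  · rw [Finset.mem_singleton] at hy
    subst hy
    exact ⟨⟨h2.2, Finset.mem_univ _⟩, by rw [Sym2.eq_swap]; exact h2.1⟩

end degrees

end RandomSubset

/-! ### The block model below the threshold -/

namespace BlockModel

open RandomSubset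

variable {k : ℕ}

/-- The quantitative form of the statement that the model has a vertex of degree at most one
with high probability. -/
theorem exists_hamProb_le {c : ℝ} (hc : 0 < c) {ε : ℝ} (hε : 0 < ε) :
    ∃ (N₀ : ℕ) (W : ℝ), ∀ (n : Fin (k + 1) → ℕ) (p q : I), N₀ ≤ order n →
      (∀ i, c * order n ≤ n i) →
      minExcess n p q ≤ Real.log (Real.log (order n)) - W → hamProb n p q ≤ ε := by
  set W : ℝ := 1 + max 0 (Real.log (4 / ε)) with hW
  have hW1 : 1 ≤ W := by rw [hW]; linarith [le_max_left 0 (Real.log (4 / ε))]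
  have hWε : 4 / ε ≤ Real.exp (W - 1) := by
    rw [← Real.log_le_iff_le_exp (by positivity), hW]
    linarith [le_max_right 0 (Real.log (4 / ε))]
  set δ : ℝ := min (1 / 2) (ε / 12) with hδ
  have hδ0 : 0 < δ := lt_min (by norm_num) (by positivity)
  have hlog : Tendsto (fun N : ℕ => Real.log N) atTop atTop :=
    Real.tendsto_log_atTop.comp tendsto_natCast_atTop_atTop
  have hev : ∀ᶠ N : ℕ in atTop, Real.log (N : ℝ) ^ 2 ≤ (δ * c / 4) * N := by
    have := (Real.isLittleO_pow_log_id_atTop (n := 2)).comp_tendsto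
      (tendsto_natCast_atTop_atTop (R := ℝ))
    filter_upwards [this.bound (show 0 < δ * c / 4 by positivity)] with N hN
    simpa [Function.comp_def, abs_of_nonneg] using hN
  obtain ⟨N₀, hN₀⟩ := eventually_atTop.1 (hev.and <| (hlog.eventually_ge_atTop (1 : ℝ)).and <|
    (hlog.eventually_ge_atTop (-2 * Real.log c)).and <|
    ((Real.tendsto_log_atTop.comp hlog).eventually_ge_atTop W).and <| eventually_ge_atTop 2)
  refine ⟨N₀, W, fun n p q hN hcn hex => ?_⟩
  obtain ⟨hN1, hN2, hN3, hN4, hN5⟩ := hN₀ _ hN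
  simp only [Function.comp_apply] at hN4
  set N : ℝ := (order n : ℝ) with hNdef
  set L : ℝ := Real.log N with hL
  have hN0 : 0 < N := by rw [hNdef]; exact_mod_cast (by omega : 0 < order n)
  obtain ⟨i, hi⟩ := exists_eq_ciInf_of_finite
    (f := fun i => (p : ℝ) * n i + (N - n i) * q - Real.log (n i))
  have hi' : (p : ℝ) * n i + (N - n i) * q - Real.log (n i) ≤ Real.log L - W := by
    refine le_trans (le_of_eq hi) hex
  have hni0 : (0 : ℝ) < n i := lt_of_lt_of_le (by positivity) (hcn i)
  have hniN : (n i : ℝ) ≤ N := by rw [hNdef]; exact_mod_cast le_order n i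
  have hlogn : Real.log (n i) ≤ L := Real.log_le_log hni0 hniN
  have hLL : Real.log L ≤ L := (Real.log_le_sub_one_of_pos (by linarith)).trans (by linarith)
  set D : ℝ := Real.log (n i) + Real.log L - W with hD
  have hD2 : D ≤ 2 * L := by rw [hD]; linarith
  have hdeg : (p : ℝ) * n i + (N - n i) * q ≤ D := by rw [hD]; linarith
  have hp0 : (0 : ℝ) ≤ p := p.2.1
  have hq0 : (0 : ℝ) ≤ q := q.2.1
  set κ : ℝ := 2 * L / (c * N) with hκ
  have hκ0 : 0 ≤ κ := by rw [hκ]; have : 0 ≤ L := by linarith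
                         positivity
  have hκL : κ * (2 * L) ≤ δ := by
    rw [hκ, div_mul_eq_mul_div, div_le_iff₀ (by positivity)]
    nlinarith
  have hκδ : κ ≤ δ / 2 := by nlinarith
  have hδ2 : δ ≤ 1 / 2 := min_le_left _ _
  have hδε : δ ≤ ε / 12 := min_le_right _ _
  -- A probability that applies to at least `c * N` neighbours of a vertex of block `i` is of order
  -- `log N / N`, because the expected degree is at most `2 * L`.
  have hκof : ∀ a b : ℝ, 0 ≤ a → c * N ≤ b → a * b ≤ D → a ≤ κ := by
    intro a b ha hb hab
    rw [hκ, le_div_iff₀ (by positivity)]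
    linarith [mul_le_mul_of_nonneg_left hb ha]
  have hpκ : (p : ℝ) ≤ κ := by
    refine hκof p (n i) hp0 (hcn i) ?_
    linarith [mul_nonneg (sub_nonneg.2 hniN) hq0]
  have hqκ : ∀ j, i ≠ j → (q : ℝ) ≤ κ := by
    intro j hij
    refine hκof q (N - n i) hq0 ((hcn j).trans ?_) ?_
    · have := Finset.add_le_sum (f := n) (fun _ _ => Nat.zero_le _) (Finset.mem_univ i)
        (Finset.mem_univ j) hij
      have h2 : ((n i : ℕ) : ℝ) + n j ≤ N := by
        rw [hNdef, order]; exact_mod_cast this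
      linarith
    · linarith [mul_nonneg hp0 hni0.le]
  set w : Sym2 (Vertex n) → ℝ := fun e => (edgeProb n p q e : ℝ) with hw
  have hw0 : ∀ e, 0 ≤ w e := fun e => (edgeProb n p q e).2.1
  have hw1 : ∀ e, w e ≤ 1 := fun e => (edgeProb n p q e).2.2
  have hwuv : ∀ u v, w s(u, v) = if u.1 = v.1 then (p : ℝ) else q := fun u v => by
    simp only [hw, edgeProb_mk]; split_ifs <;> rfl
  set B : Finset (Vertex n) := Finset.univ.filter fun v => v.1 = i with hB
  have hwκ : ∀ u ∈ B, ∀ v, w s(u, v) ≤ κ := by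
    intro u hu v
    rw [hB, Finset.mem_filter] at hu
    rw [hwuv]
    split_ifs with h
    · exact hpκ
    · exact hqκ v.1 (hu.2 ▸ h)
  have hone : ∀ v ∈ B, (1 + D) * Real.exp (-D - 1) ≤
      prob w (fun x => degreeTo x (Finset.univ.erase v) v ≤ 1) := by
    intro v hv
    simp only [degreeTo_eq_card_filter_image]
    refine le_prob_card_le_one_of_sum_le (κ := κ) (fun e _ => hw0 e) (fun e he => ?_)
      (by linarith) ?_ ?_ hκ0
    · obtain ⟨u, -, rfl⟩ := Finset.mem_image.1 he
      exact hwκ v hv u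
    · rw [Finset.sum_image fun a _ b _ h => Sym2.congr_right.1 h]
      refine (Finset.sum_le_sum_of_subset_of_nonneg (Finset.erase_subset v Finset.univ)
        fun e _ _ => hw0 _).trans ?_
      simp only [hwuv]
      rw [sum_block, (Finset.mem_filter.1 hv).2, ← hNdef]
      linarith
    · linarith [mul_le_mul_of_nonneg_left hD2 hκ0]
  have hm : 2 / ε ≤ ∑ v ∈ B, prob w (fun x => degreeTo x (Finset.univ.erase v) v ≤ 1) := by
    refine le_trans ?_ (Finset.card_nsmul_le_sum B _ _ hone)
    rw [nsmul_eq_mul, hB, card_block]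
    -- By the definition of `D` the expected number of vertices of degree at most one in block `i`
    -- is at least `exp (W - 1) / 2`, and `W` is chosen so that this is at least `2 / ε`.
    have h1 : (n i : ℝ) * L * Real.exp (-D - 1) = Real.exp (W - 1) := by
      nth_rewrite 1 [← Real.exp_log hni0]
      nth_rewrite 1 [← Real.exp_log (by linarith : 0 < L)]
      rw [← Real.exp_add, ← Real.exp_add, hD]
      congr 1; ring
    have h2 : L / 2 ≤ 1 + D := by
      have h3 : L + Real.log c ≤ Real.log (n i) := by
        rw [hL, add_comm, ← Real.log_mul hc.ne' hN0.ne']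
        exact Real.log_le_log (by positivity) (hcn i)
      rw [hD]; linarith
    calc 2 / ε = (4 / ε) / 2 := by ring
      _ ≤ Real.exp (W - 1) / 2 := by gcongr
      _ = (n i : ℝ) * (L / 2 * Real.exp (-D - 1)) := by rw [← h1]; ring
      _ ≤ _ := by gcongr
  rw [hamProb_eq_prob]
  refine (prob_mono hw0 hw1 fun x hx v => two_le_degreeTo_of_isHamiltonian
    (by rw [card_vertex]; exact hN5) hx v).trans ?_
  refine (prob_forall_two_le_degree_le hw0 hw1 hκ0 (by linarith) B
    (fun u hu v _ => hwκ u hu v) (by positivity : (0 : ℝ) < 2 / ε) hm).trans ?_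
  have : 1 / (2 / ε) = ε / 2 := by field_simp
  rw [this]
  linarith

end BlockModel

theorem mainTheorem2 {k : ℕ} (hk : 1 ≤ k) (n : ℕ → Fin k → ℕ) (p q : ℕ → unitInterval)
    (hn : Tendsto (fun t => BlockModel.order (n t)) atTop atTop)
    (hA2 : BlockModel.CondA2 n q) (hA3 : BlockModel.CondA3 n p) (hA4 : BlockModel.CondA4 n) :
    (∀ w : ℕ → ℝ, Tendsto w atTop atTop →
      (∀ᶠ t in atTop, BlockModel.minExcess (n t) (p t) (q t) <
        Real.log (Real.log (BlockModel.order (n t))) - w t) →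
      Tendsto (fun t => BlockModel.hamProb (n t) (p t) (q t)) atTop (𝓝 0)) ∧
    (∀ w : ℕ → ℝ, Tendsto w atTop atTop →
      (∀ᶠ t in atTop, BlockModel.minExcess (n t) (p t) (q t) >
        Real.log (Real.log (BlockModel.order (n t))) + w t) →
      Tendsto (fun t => BlockModel.hamProb (n t) (p t) (q t)) atTop (𝓝 1)) := by
  obtain ⟨k, rfl⟩ : ∃ k', k = k' + 1 := ⟨k - 1, by omega⟩
  obtain ⟨c, hc, hcn⟩ := hA4
  have h0 : ∀ t, 0 ≤ BlockModel.hamProb (n t) (p t) (q t) := fun t => measureReal_nonneg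
  have h1 : ∀ t, BlockModel.hamProb (n t) (p t) (q t) ≤ 1 := fun t => by
    rw [BlockModel.hamProb_eq_prob]
    exact RandomSubset.prob_le_one (fun e => (BlockModel.edgeProb _ _ _ e).2.1)
      (fun e => (BlockModel.edgeProb _ _ _ e).2.2) _
  refine ⟨fun w hw hex => ?_, fun w hw hex => ?_⟩
  · rw [Metric.tendsto_atTop']
    intro ε hε
    obtain ⟨N₀, W, h⟩ := BlockModel.exists_hamProb_le (k := k) hc (half_pos hε)
    obtain ⟨T, hT⟩ := eventually_atTop.1 (hcn.and <| hex.and <| (hn.eventually_ge_atTop N₀).and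
      (hw.eventually_ge_atTop W))
    refine ⟨T, fun t ht => ?_⟩
    obtain ⟨ht1, ht2, ht3, ht4⟩ := hT t ht.le
    have := h (n t) (p t) (q t) ht3 ht1 (by linarith)
    rw [Real.dist_eq, sub_zero, abs_of_nonneg (h0 t)]
    linarith
  · rw [Metric.tendsto_atTop']
    intro ε hε
    -- The constant `C₀` depends on the lower bound for the blocks but not on `ε`; condition (A3) is
    -- needed only for this constant.
    obtain ⟨C₀, h⟩ := BlockModel.exists_le_hamProb (k := k) (lt_min hc one_pos) (min_le_right c 1)
    obtain ⟨N₀, W, Q₀, h⟩ := h (ε / 2) (half_pos hε)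
    obtain ⟨T, hT⟩ := eventually_atTop.1 (hcn.and <| hex.and <| (hn.eventually_ge_atTop N₀).and <|
      (hw.eventually_ge_atTop W).and <| (hA3 C₀).and (hA2.eventually_ge_atTop Q₀))
    refine ⟨T, fun t ht => ?_⟩
    obtain ⟨ht1, ht2, ht3, ht4, ht5, ht6⟩ := hT t ht.le
    have := h (n t) (p t) (q t) ht3 (fun i => (mul_le_mul_of_nonneg_right (min_le_left c 1)
      (Nat.cast_nonneg _)).trans (ht1 i)) ht5 ht6 (by linarith)
    rw [Real.dist_eq, abs_sub_comm, abs_of_nonneg (sub_nonneg.2 (h1 t))]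
    linarith
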